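/- **Setting.** Let $\mathbb k$ be a field of characteristic $0$ (for instance $\mathbb C$ or $\mathbb C(q)$), $q\in\mathbb k^\times$, and let $A=A_0\oplus A_1$ be an associative unital superalgebra over $\mathbb k$. For $i\in[m+n]$ put $\bar i=0$ if $i\le m$ and $\bar i=1$ if $i>m$; let $\varepsilon(a)\in\{1,0,-1\}$ be the sign of an integer $a$. A matrix $M=(M_{ij})_{i,j\in[m+n]}$ over $A$ is a *$q$-super Manin matrix* if $M_{ij}$ is homogeneous of parity $\bar i+\bar j$ and, for all indices, $$M_{ij}^2=0\ (\bar i=1,\bar j=0),\qquad M_{ik}M_{il}=q^{\varepsilon(l-k)}(-1)^{(\bar k+1)(\bar l+1)}M_{il}M_{ik}\ (\bar i=1),\qquad M_{ik}M_{jk}=q^{\varepsilon(i-j)}(-1)^{\bar i\bar j}M_{jk}M_{ik}\ (\bar k=0),$$ $$M_{ij}M_{kl}-q^{\varepsilon(i-k)+\varepsilon(l-j)}(-1)^{(\bar i+\bar j)(\bar k+\bar l)}M_{kl}M_{ij}=q^{\varepsilon(i-k)}(-1)^{\bar i\bar k+\bar j\bar k+\bar i\bar j}M_{kj}M_{il}-q^{\varepsilon(l-j)}(-1)^{\bar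 j\bar k+\bar j\bar l+\bar k\bar l}M_{il}M_{kj}.$$ For an invertible matrix $X$ over $A$ whose index set consists of $r$ even indices $a_1<\dots<a_r$ and $s$ odd indices $b_1<\dots<b_s$, the *quantum Berezinian* is $$\mathrm{Ber}_q(X)=\sum_{\sigma\in\mathfrak S_r}(-q)^{-l(\sigma)}X_{a_{\sigma(1)}a_1}\cdots X_{a_{\sigma(r)}a_r}\ \cdot\ \sum_{\rho\in\mathfrak S_s}(-q)^{-l(\rho)}(X^{-1})_{b_1b_{\rho(1)}}\cdots(X^{-1})_{b_sb_{\rho(s)}},$$ where $l$ is the number of inversions; $\mathrm{Ber}_{q^{-1}}$ is the same expression with $q$ replaced by $q^{-1}$. For a set $J$ of indices, $X_J$ is the submatrix with rows and columns in $J$, in increasing order. The supertranspose is $(X^{st})_{ij}=(-1)^{\bar i(\bar i+\bar j)}X_{ji}$. The $\Pi$-transpose $X^\Pi$ of a $k\times k$ matrix $X$ has entries $(X^\Pi)_{ij}=X_{k+1-i,\,k+1-j}$, where the index $i$ of $X^\Pi$ has the parity opposite to that of the index $k+1-i$ of $X$; and $X^{\Pi\circ st}=(X^\Pi)^{st}$.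 **Theorem 4.4 (Jacobi ratio theorem for the quantum Berezinian).** Let $M$ be an $(m+n)\times(m+n)$ $q$-super Manin matrix over $A$ which is invertible and whose inverse $M^{-1}$ is a $q^{-1}$-super Manin matrix (for instance the generator matrix of the Hopf superalgebra $\widetilde{\mathcal M}_{m|n}$ obtained from the algebra with the above relations by adjoining an antipode). Let $I\subseteq[m+n]$ have complement $I^c$, and suppose that $I\subseteq[m]$ or $[m]\subseteq I$. Suppose moreover that the matrices $M_I$ and $((M^{-1})_{I^c})^{\Pi\circ st}$, whose Berezinians occur below, are invertible over $A$. Then $$\mathrm{Ber}_q(M)=\mathrm{Ber}_q(M_I)\cdot\mathrm{Ber}_{q^{-1}}\big(((M^{-1})_{I^c})^{\Pi\circ st}\big).$$ -/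

import Mathlib

noncomputable section

namespace SuperManin

/-- The parity on `[m+n]`: the first `m` indices are even, the last `n` are odd. -/
def parity (m n : ℕ) (i : Fin (m + n)) : ZMod 2 := if (i : ℕ) < m then 0 else 1

/-- The sign `(-1)^a` for `a` in `ℤ/2`. -/
def sgn (R : Type*) [Ring R] (a : ZMod 2) : R := (-1) ^ a.val

/-- `q ^ ε(i - j)`, where `ε(i - j)` is `1`, `0`, `-1` according to `i > j`, `i = j`, `i < j`. -/
def qeps {𝕜 ι : Type*} [Field 𝕜] [LinearOrder ι] (q : 𝕜) (i j : ι) : 𝕜 :=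
  if j < i then q else if i < j then q⁻¹ else 1

/-- `M` is a `q`-super Manin matrix over the superalgebra `A` (with homogeneous components
`𝒜 0` and `𝒜 1`), its rows and columns being indexed by a linearly ordered set with parity `p`:
the entry `M i j` is homogeneous of parity `p i + p j`, and the entries satisfy
the defining relations of the right quantum superalgebra. -/
structure IsSuperManin {𝕜 A ι : Type*} [Field 𝕜] [Ring A] [Algebra 𝕜 A] [LinearOrder ι]
    (𝒜 : ZMod 2 → Submodule 𝕜 A) (q : 𝕜) (p : ι → ZMod 2) (M : Matrix ι ι A) : Prop where
  homogeneous : ∀ i j, M i j ∈ 𝒜 (p i + p j)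
  square : ∀ i j, p i = 1 → p j = 0 → M i j * M i j = 0
  row : ∀ i k l, p i = 1 →
    M i k * M i l - (qeps q l k * sgn 𝕜 ((p k + 1) * (p l + 1))) • (M i l * M i k) = 0
  column : ∀ i j k, p k = 0 →
    M i k * M j k - (qeps q i j * sgn 𝕜 (p i * p j)) • (M j k * M i k) = 0
  cross : ∀ i j k l,
    M i j * M k l
        - (qeps q i k * qeps q l j * sgn 𝕜 ((p i + p j) * (p k + p l))) • (M k l * M i j)
      = (qeps q i k * sgn 𝕜 (p i * p k + p j * p k + p i * p j)) • (M k j * M i l)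
        - (qeps q l j * sgn 𝕜 (p j * p k + p j * p l + p k * p l)) • (M i l * M k j)

/-- The number of inversions of a permutation of a finite linearly ordered set. -/
def invCount {ι : Type*} [Fintype ι] [LinearOrder ι] (σ : Equiv.Perm ι) : ℕ :=
  (Finset.univ.filter fun a : ι × ι => a.1 < a.2 ∧ σ a.2 < σ a.1).card

/-- The product of the `f i`, taken from left to right in increasing order of `i`. -/
def orderedProd {A ι : Type*} [Ring A] [Fintype ι] [LinearOrder ι] (f : ι → A) : A :=
  (((Finset.univ : Finset ι).sort (· ≤ ·)).map f).prod

/-- `∑_σ (-q)^{-l(σ)} X_{σ(1),1} X_{σ(2),2} ⋯ X_{σ(r),r}`. -/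
def colDet {𝕜 A ι : Type*} [Field 𝕜] [Ring A] [Algebra 𝕜 A] [Fintype ι] [LinearOrder ι]
    (q : 𝕜) (X : Matrix ι ι A) : A :=
  ∑ σ : Equiv.Perm ι, ((-q)⁻¹ ^ invCount σ) • orderedProd fun i => X (σ i) i

/-- `∑_ρ (-q)^{-l(ρ)} X_{1,ρ(1)} X_{2,ρ(2)} ⋯ X_{s,ρ(s)}`. -/
def rowDet {𝕜 A ι : Type*} [Field 𝕜] [Ring A] [Algebra 𝕜 A] [Fintype ι] [LinearOrder ι]
    (q : 𝕜) (X : Matrix ι ι A) : A :=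
  ∑ ρ : Equiv.Perm ι, ((-q)⁻¹ ^ invCount ρ) • orderedProd fun i => X i (ρ i)

/-- The principal submatrix of `X` with rows and columns satisfying `P` (in the induced order). -/
def principal {A ι : Type*} (P : ι → Prop) (X : Matrix ι ι A) :
    Matrix {i // P i} {i // P i} A :=
  X.submatrix Subtype.val Subtype.val

/-- The quantum Berezinian of an invertible matrix `X` whose index set has the parity `p`:
the column determinant of the even-even block of `X` times the row determinant of the
odd-odd block of the inverse of `X`. -/
def ber {𝕜 A ι : Type*} [Field 𝕜] [Ring A] [Algebra 𝕜 A] [Fintype ι] [LinearOrder ι]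
    (q : 𝕜) (p : ι → ZMod 2) (X : Matrix ι ι A) : A :=
  colDet q (principal (fun i => p i = 0) X) *
    rowDet q (principal (fun i => p i = 1) (Ring.inverse X))

/-- The supertranspose `X^{st}_{ij} = (-1)^{p i (p i + p j)} X_{ji}`. -/
def superTranspose {A ι : Type*} [Ring A] (p : ι → ZMod 2) (X : Matrix ι ι A) : Matrix ι ι A :=
  fun i j => sgn A (p i * (p i + p j)) * X j i

/-- The `Π`-transpose. Both blocks and the indices inside the blocks are put in the opposite order,
so that the whole index set is reversed. -/
def piTranspose {A ι : Type*} (X : Matrix ι ι A) : Matrix ιᵒᵈ ιᵒᵈ A :=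
  X.submatrix OrderDual.ofDual OrderDual.ofDual

/-- The parity of the index set of the `Π`-transpose: even and odd indices are exchanged. -/
def piParity {ι : Type*} (p : ι → ZMod 2) (i : ιᵒᵈ) : ZMod 2 := p (OrderDual.ofDual i) + 1

/-- `X^{Π∘st} = (X^Π)^{st}`. -/
def piSt {A ι : Type*} [Ring A] (p : ι → ZMod 2) (X : Matrix ι ι A) : Matrix ιᵒᵈ ιᵒᵈ A :=
  superTranspose (piParity p) (piTranspose X)

end SuperManin

end

noncomputable section

set_option linter.unusedSectionVars false

namespace SkewFock

/-! ### Skew polynomials: monomials, multiplication by the variables, transformed variables -/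

section Monomials

open Finset

/-! Quantum determinants are studied through their action on skew polynomials. Take variables x_i
with x_i x_j = ε_ij x_j x_i, some of them fermionic (square zero), the others bosonic, and
coefficients in a ring B commuting with all of them. The relations of a Manin matrix P say that the
elements y_j = ∑_b x_b P_bj obey the same commutation rules (`phi_comm`); if P has an inverse with
the dual relations, the substitution x ↦ y is bijective (`subst_bijective`). Applied to the vacuum,
the product of the fermionic y_j is, modulo bosonic variables, the product of the fermionic x_j
times the determinant of the fermionic block (`list_phi_sub_mem`), so facts about this determinant
become facts about the substitution.

Three such facts are needed. An exactness argument of Koszul type (`mem_rangeSum_of_mem`) shows that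
the fermionic block is invertible (`ferBlock_isUnit`) and that its determinant is left cancellable
(`cdet_mul_eq_zero`). If every variable is fermionic, comparison of top degrees gives the Schur
complement factorization (`cdet_eq_schur`) and Jacobi's theorem on complementary minors
(`cdet_eq_minor_mul`). Finally, multiplying the product of all transformed fermions by one further
transformed variable from the left and from the right (`exists_coefficients`) shows that, for N the
inverse of M, the Schur complement of the odd block in the transpose of N is the transposed inverse
of the even block of M, up to conjugation by the odd determinant and diagonal scalars.

The super signs are absorbed by letting the entries act on A and composing with powers of the parity
automorphism (`uManin_twistR`, `uManin_twistL`). The even indices are fermionic for M, the odd ones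
for the transpose of N. If I contains all even indices, M and M_I have the same even determinant,
and the claim is the Schur factorization of the odd block of N. If I consists of even indices,
Jacobi's theorem is applied to the even block of M; the conjugation above moves the odd determinant
to its place between the two minors (`cdet_ratio`). -/

/-- Commutation factors for a family of variables, some of which are fermionic. -/
structure Skew (𝕜 ι : Type*) [Field 𝕜] where
  ε : ι → ι → 𝕜
  fer : ι → Prop
  mul_swap : ∀ i j, ε i j * ε j i = 1
  diag_fer : ∀ i, fer i → ε i i = -1
  diag_bos : ∀ i, ¬ fer i → ε i i = 1

variable {𝕜 ι : Type*} [Field 𝕜] [CharZero 𝕜] [Fintype ι] [LinearOrder ι]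

namespace Skew

variable (S : Skew 𝕜 ι)

theorem ne_zero (i j : ι) : S.ε i j ≠ 0 := left_ne_zero_of_mul_eq_one (S.mul_swap i j)

/-- The factor picked up when the variable `j` is moved to its place in the monomial `e`. -/
def coef (j : ι) (e : ι → ℕ) : 𝕜 := ∏ i, if i < j then S.ε j i ^ e i else 1

/-- The factor picked up when the variable `k` is moved through the monomial `e`. -/
def tw (k : ι) (e : ι → ℕ) : 𝕜 := ∏ i, S.ε i k ^ e i

theorem coef_ne_zero (j : ι) (e : ι → ℕ) : S.coef j e ≠ 0 := by
  refine Finset.prod_ne_zero_iff.2 fun i _ => ?_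
  split_ifs
  · exact pow_ne_zero _ (S.ne_zero _ _)
  · exact one_ne_zero

theorem tw_ne_zero (j : ι) (e : ι → ℕ) : S.tw j e ≠ 0 :=
  Finset.prod_ne_zero_iff.2 fun _ _ => pow_ne_zero _ (S.ne_zero _ _)

theorem coef_add (j k : ι) (e : ι → ℕ) :
    S.coef j (e + Pi.single k 1) = (if k < j then S.ε j k else 1) * S.coef j e := by
  have h : (if k < j then S.ε j k else 1) =
      ∏ i, if i = k then (if k < j then S.ε j k else 1) else 1 := by simp
  rw [h, coef, coef, ← Finset.prod_mul_distrib]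
  refine Finset.prod_congr rfl fun i _ => ?_
  by_cases hik : i = k
  · subst hik
    by_cases hij : i < j <;> simp [hij, pow_succ, mul_comm]
  · simp [hik]

theorem tw_add (j k : ι) (e : ι → ℕ) :
    S.tw j (e + Pi.single k 1) = S.ε k j * S.tw j e := by
  have h : S.ε k j = ∏ i, if i = k then S.ε k j else 1 := by simp
  rw [h, tw, tw, ← Finset.prod_mul_distrib]
  refine Finset.prod_congr rfl fun i _ => ?_
  by_cases hik : i = k
  · subst hik
    simp [pow_succ, mul_comm]
  · simp [hik]

/-- The exponents of the monomials: fermionic variables occur at most once. -/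
def State : Type _ := {e : ι → ℕ // ∀ i, S.fer i → e i ≤ 1}

variable {S}

namespace State

instance : CoeFun S.State fun _ => ι → ℕ := ⟨Subtype.val⟩

@[ext] theorem ext {e e' : S.State} (h : ∀ i, e i = e' i) : e = e' := Subtype.ext (funext h)

/-- The exponent `0`. -/
def vac : S.State := ⟨0, fun _ _ => Nat.zero_le _⟩

@[simp] theorem vac_apply (i : ι) : (vac : S.State) i = 0 := rfl

/-- Raise the exponent of `j`. -/
def up (j : ι) (e : S.State) (h : S.fer j → e j = 0) : S.State :=
  ⟨e.1 + Pi.single j 1, fun i hi => by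
    by_cases hij : i = j
    · subst hij; simp [h hi]
    · simpa [hij] using e.2 i hi⟩

/-- Lower the exponent of `j`. -/
def down (j : ι) (e : S.State) : S.State :=
  ⟨fun i => e i - (Pi.single j 1 : ι → ℕ) i, fun i hi => (Nat.sub_le _ _).trans (e.2 i hi)⟩

theorem up_val (j : ι) (e : S.State) (h) : (up j e h).1 = e.1 + Pi.single j 1 := rfl

theorem up_apply (j : ι) (e : S.State) (h) (i : ι) :
    up j e h i = e i + (Pi.single j 1 : ι → ℕ) i := rfl

theorem down_apply (j : ι) (e : S.State) (i : ι) :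
    down j e i = e i - (Pi.single j 1 : ι → ℕ) i := rfl

@[simp] theorem up_self (j : ι) (e : S.State) (h) : up j e h j = e j + 1 := by simp [up_apply]

theorem up_of_ne {i j : ι} (hij : i ≠ j) (e : S.State) (h) : up j e h i = e i := by
  simp [up_apply, hij]

@[simp] theorem down_self (j : ι) (e : S.State) : down j e j = e j - 1 := by simp [down_apply]

theorem down_of_ne {i j : ι} (hij : i ≠ j) (e : S.State) : down j e i = e i := by
  simp [down_apply, hij]

@[simp] theorem down_up (j : ι) (e : S.State) (h) : down j (up j e h) = e := by
  ext i; simp [down_apply, up_apply]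

theorem down_ok {j : ι} {e : S.State} (_ : e j ≠ 0) (hf : S.fer j) : down j e j = 0 := by
  have := e.2 j hf
  change e j ≤ 1 at this
  rw [down_self]; omega

theorem up_down (j : ι) (e : S.State) (h : e j ≠ 0) :
    up j (down j e) (down_ok h) = e := by
  ext i
  by_cases hij : i = j
  · subst hij; rw [up_self, down_self]; omega
  · rw [up_of_ne hij, down_of_ne hij]

theorem down_val_add (j : ι) (e : S.State) (h : e j ≠ 0) :
    (down j e).1 + Pi.single j 1 = e.1 := by
  rw [← up_val j _ (down_ok h), up_down j e h]

theorem down_comm (i j : ι) (e : S.State) : down i (down j e) = down j (down i e) := by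
  ext k; simp only [down_apply]; omega

@[elab_as_elim]
theorem induction {p : S.State → Prop} (h0 : p vac)
    (hup : ∀ j e h, p e → p (up j e h)) (e : S.State) : p e := by
  induction hn : ∑ i, e i generalizing e with
  | zero =>
    have : e = vac := by
      ext i; simpa using (Finset.sum_eq_zero_iff.1 hn) i (Finset.mem_univ i)
    rwa [this]
  | succ n ih =>
    obtain ⟨j, -, hj⟩ : ∃ j ∈ Finset.univ, e j ≠ 0 :=
      Finset.exists_ne_zero_of_sum_ne_zero (by rw [hn]; omega)
    rw [← up_down j e hj]
    refine hup _ _ _ (ih _ ?_)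
    have h1 : ∑ i, e i = ∑ i, (down j e i + (Pi.single j 1 : ι → ℕ) i) :=
      Finset.sum_congr rfl fun i _ => (congrFun (down_val_add j e hj) i).symm
    rw [Finset.sum_add_distrib, hn] at h1
    simp at h1
    omega

end State

end Skew

open Skew State

variable (S : Skew 𝕜 ι) (B : Type*) [Ring B] [Algebra 𝕜 B]

/-- The space with basis the monomials, over the ring `B`. -/
abbrev Fock : Type _ := S.State →₀ B

variable {B}

/-- Multiplication by the variable `j`. -/
def X (j : ι) : Module.End 𝕜 (Fock S B) :=
  open Classical in
  Finsupp.lsum 𝕜 fun e => if h : S.fer j → e j = 0 then S.coef j e • Finsupp.lsingle (up j e h)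
    else 0

/-- Only the monomial `e` with one x_j removed contributes to the coefficient at `e`. Working with
coefficients instead of basis vectors turns ideal membership into vanishing conditions on exponents.
-/
theorem X_apply (j : ι) (w : Fock S B) (e : S.State) :
    X S j w e = if e j = 0 then 0 else S.coef j (down j e) • w (down j e) := by
  induction w using Finsupp.induction_linear with
  | zero => simp
  | add f g hf hg => rw [map_add, Finsupp.add_apply, hf, hg]; split_ifs <;> simp
  | single e' b =>
    rw [X, Finsupp.lsum_single]
    split_ifs with h h1 h2
    · simp only [LinearMap.smul_apply, Finsupp.lsingle_apply, Finsupp.smul_apply]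
      rw [Finsupp.single_eq_of_ne, smul_zero]
      rintro rfl
      simp at h1
    · simp only [LinearMap.smul_apply, Finsupp.lsingle_apply, Finsupp.smul_apply]
      by_cases he : e' = down j e
      · subst he
        rw [up_down j e h1]; simp
      · rw [Finsupp.single_eq_of_ne, Finsupp.single_eq_of_ne]
        · simp
        · exact fun h2 => he h2.symm
        · rintro rfl; simp at he
    · simp
    · rw [Finsupp.single_eq_of_ne]
      · simp
      · rintro rfl
        exact h fun hf => down_ok h2 hf

theorem X_single (j : ι) (e : S.State) (h : S.fer j → e j = 0) (b : B) :
    X S j (Finsupp.single e b) = S.coef j e • Finsupp.single (up j e h) b := by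
  rw [X, Finsupp.lsum_single, dif_pos h]; rfl

theorem X_single_of_ne (j : ι) (e : S.State) (h : ¬ (S.fer j → e j = 0)) (b : B) :
    X S j (Finsupp.single e b) = 0 := by
  rw [X, Finsupp.lsum_single, dif_neg h]; rfl

theorem single_up (j : ι) (e : S.State) (h : S.fer j → e j = 0) (b : B) :
    (Finsupp.single (up j e h) b : Fock S B) = (S.coef j e)⁻¹ • X S j (Finsupp.single e b) := by
  rw [X_single S j e h, smul_smul, inv_mul_cancel₀ (S.coef_ne_zero _ _), one_smul]

theorem X_apply_up (j : ι) (w : Fock S B) (e : S.State) (h : S.fer j → e j = 0) :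
    X S j w (up j e h) = S.coef j e • w e := by
  rw [X_apply]; simp

/-- For i = j both sides vanish in the fermionic case, and the factor is 1 in the bosonic case. For
i ≠ j only the larger index meets the smaller one on its way to its slot, so exactly one of the two
orders of multiplication picks up an extra factor. -/
theorem X_comm (i j : ι) (w : Fock S B) : X S i (X S j w) = S.ε i j • X S j (X S i w) := by
  ext e
  rw [Finsupp.smul_apply]
  by_cases hij : i = j
  · subst hij
    by_cases hf : S.fer i
    · have : X S i (X S i w) e = 0 := by
        rw [X_apply, X_apply]
        split_ifs with h1 h2
        · rfl
        · simp
        · exact absurd (down_ok h1 hf) h2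
      rw [this, smul_zero]
    · rw [S.diag_bos i hf, one_smul]
  · simp only [X_apply, down_of_ne hij, down_of_ne (Ne.symm hij)]
    split_ifs with h1 h2 h3
    · simp
    · simp
    · simp
    · rw [down_comm j i, smul_smul, smul_smul, smul_smul]
      congr 1
      have hi : (down i e).1 = (down i (down j e)).1 + Pi.single j 1 := by
        rw [down_comm i j, down_val_add]; rwa [down_of_ne (Ne.symm hij)]
      have hj : (down j e).1 = (down i (down j e)).1 + Pi.single i 1 := by
        rw [down_val_add]; rwa [down_of_ne hij]
      rw [hi, hj, S.coef_add, S.coef_add]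
      rcases lt_or_gt_of_ne hij with h | h
      · simp only [h, h.not_gt, if_true, if_false]
        linear_combination (-S.coef i (down i (down j e)) * S.coef j (down i (down j e))) *
          S.mul_swap i j
      · simp only [h, h.not_gt, if_true, if_false]
        ring

/-- The sum over an antisymmetric coefficient vanishes. -/
theorem sum_X_X_eq_zero (C : ι → ι → Fock S B) (hC : ∀ i k, C i k = -(S.ε k i • C k i)) :
    ∑ i, ∑ k, X S i (X S k (C i k)) = 0 := by
  -- Exchanging the names of the two indices and then the two variables turns the sum into its own
  -- negative, and 2 is invertible.
  have h : ∑ i, ∑ k, X S i (X S k (C i k)) = -∑ i, ∑ k, X S i (X S k (C i k)) := by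
    conv_lhs => rw [Finset.sum_comm]
    rw [← Finset.sum_neg_distrib]
    refine Finset.sum_congr rfl fun i _ => ?_
    rw [← Finset.sum_neg_distrib]
    refine Finset.sum_congr rfl fun k _ => ?_
    rw [hC k i, X_comm]
    simp only [map_neg, map_smul, smul_neg, smul_smul, mul_comm, S.mul_swap, one_smul]
  have h2 : (2 : 𝕜) • ∑ i, ∑ k, X S i (X S k (C i k)) = 0 := by
    rw [two_smul]; exact eq_neg_iff_add_eq_zero.1 h
  exact (smul_eq_zero.1 h2).resolve_left two_ne_zero

/-- Left multiplication of the coefficients. -/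
abbrev lm : B →ₐ[𝕜] Module.End 𝕜 (Fock S B) := Algebra.lsmul 𝕜 𝕜 (Fock S B)

theorem lm_single (b : B) (e : S.State) (c : B) :
    lm S b (Finsupp.single e c) = Finsupp.single e (b * c) := by simp

theorem lm_apply (b : B) (w : Fock S B) (e : S.State) : lm S b w e = b * w e := by simp

theorem X_lm (j : ι) (b : B) (w : Fock S B) : X S j (lm S b w) = lm S b (X S j w) := by
  ext e
  simp only [X_apply, lm_apply]
  split_ifs <;> simp

/-- The transformed variable `∑ b, x_b P_{b j}`. -/
def phi (P : Matrix ι ι B) (j : ι) : Module.End 𝕜 (Fock S B) := ∑ b, X S b * lm S (P b j)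

variable {S} in
theorem phi_apply (P : Matrix ι ι B) (j : ι) (w : Fock S B) :
    phi S P j w = ∑ b, X S b (lm S (P b j) w) := by
  simp [phi]

/-- The relations of `P` which make the `phi S P j` skew commute. -/
def PM (P : Matrix ι ι B) : Prop :=
  ∀ i j k l, P i j * P k l - S.ε j l • (P i l * P k j) =
    -(S.ε k i • (P k j * P i l - S.ε j l • (P k l * P i j)))

/-- The relations of the inverse matrix. -/
def QM (Q : Matrix ι ι B) : Prop :=
  ∀ j l a b, Q l b * Q j a - S.ε a b • (Q l a * Q j b) =
    -(S.ε l j • (Q j b * Q l a - S.ε a b • (Q j a * Q l b)))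

variable {S}

/-- The coefficient of x_i x_k in y_j y_l - ε_jl y_l y_j is P_ij P_kl - ε_jl P_il P_kj, and `PM` is
precisely the antisymmetry under which `sum_X_X_eq_zero` applies. -/
theorem phi_comm {P : Matrix ι ι B} (hP : PM S P) (j l : ι) :
    phi S P j * phi S P l = S.ε j l • (phi S P l * phi S P j) := by
  refine LinearMap.ext fun w => ?_
  rw [← sub_eq_zero]
  have := sum_X_X_eq_zero S (fun i k => lm S (P i j * P k l - S.ε j l • (P i l * P k j)) w)
    fun i k => by rw [hP i j k l]; simp
  rw [← this, Finset.sum_comm]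
  simp only [Module.End.mul_apply, LinearMap.smul_apply, phi_apply, map_sum, Finset.smul_sum,
    ← Finset.sum_sub_distrib]
  refine Finset.sum_congr rfl fun i _ => Finset.sum_congr rfl fun k _ => ?_
  simp only [← X_lm, map_sub, LinearMap.sub_apply, map_mul, Module.End.mul_apply, map_smul,
    LinearMap.smul_apply]

variable (S) in
/-- The diagonal operator of passing `x_k` through a monomial. -/
def twist (k : ι) : Module.End 𝕜 (Fock S B) :=
  Finsupp.lsum 𝕜 fun e => S.tw k e • Finsupp.lsingle e

theorem twist_apply (k : ι) (w : Fock S B) (e : S.State) :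
    twist S k w e = S.tw k e • w e := by
  induction w using Finsupp.induction_linear with
  | zero => simp
  | add f g hf hg => rw [map_add, Finsupp.add_apply, hf, hg]; simp
  | single e' b =>
    rw [twist, Finsupp.lsum_single]
    by_cases h : e' = e
    · subst h; simp
    · simp [Finsupp.single_eq_of_ne (Ne.symm h)]

theorem twist_lm (k : ι) (b : B) (w : Fock S B) :
    twist S k (lm S b w) = lm S b (twist S k w) := by
  ext e; simp [twist_apply]

theorem twist_X (k j : ι) (w : Fock S B) :
    twist S k (X S j w) = S.ε j k • X S j (twist S k w) := by
  ext e
  simp only [twist_apply, X_apply, Finsupp.smul_apply]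
  split_ifs with h
  · simp
  · rw [smul_smul, smul_smul, smul_smul]
    congr 1
    conv_lhs => rw [← down_val_add j e h, S.tw_add]
    ring

variable (S) in
/-- Multiplication by the variable `k` from the right. -/
def Xr (k : ι) : Module.End 𝕜 (Fock S B) := X S k * twist S k

theorem Xr_apply (k : ι) (w : Fock S B) : Xr S k w = X S k (twist S k w) := rfl

theorem Xr_X (k j : ι) (w : Fock S B) : Xr S k (X S j w) = X S j (Xr S k w) := by
  rw [Xr_apply, Xr_apply, twist_X, map_smul, X_comm S j k]

theorem Xr_lm (k : ι) (b : B) (w : Fock S B) : Xr S k (lm S b w) = lm S b (Xr S k w) := by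
  rw [Xr_apply, Xr_apply, twist_lm, X_lm]

/-- Right multiplication commutes with left multiplication by variables and by coefficients without
any factor. Hence bosons acting from the right and transformed fermions acting from the left form
two strictly commuting families. -/
theorem Xr_phi (P : Matrix ι ι B) (k j : ι) (w : Fock S B) :
    Xr S k (phi S P j w) = phi S P j (Xr S k w) := by
  simp only [phi_apply, map_sum, Xr_X, Xr_lm]

theorem twist_surjective (k : ι) : Function.Surjective (twist S k : Fock S B → Fock S B) := by
  intro w
  induction w using Finsupp.induction_linear with
  | zero => exact ⟨0, map_zero _⟩
  | add f g hf hg =>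
    obtain ⟨a, rfl⟩ := hf
    obtain ⟨b, rfl⟩ := hg
    exact ⟨a + b, map_add _ _ _⟩
  | single e b =>
    refine ⟨(S.tw k e)⁻¹ • Finsupp.single e b, ?_⟩
    rw [map_smul, twist, Finsupp.lsum_single, LinearMap.smul_apply, smul_smul,
      inv_mul_cancel₀ (S.tw_ne_zero _ _), one_smul]
    rfl

theorem range_Xr (k : ι) : LinearMap.range (Xr S k : Module.End 𝕜 (Fock S B)) =
    LinearMap.range (X S k : Module.End 𝕜 (Fock S B)) := by
  rw [Xr, Module.End.mul_eq_comp, LinearMap.range_comp_of_range_eq_top]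
  exact LinearMap.range_eq_top.2 (twist_surjective k)

theorem Xr_comm (k l : ι) (w : Fock S B) :
    Xr S k (Xr S l w) = S.ε l k • Xr S l (Xr S k w) := by
  have tw_comm : ∀ v : Fock S B, twist S k (twist S l v) = twist S l (twist S k v) := by
    intro v; ext e; simp only [twist_apply, smul_smul, mul_comm]
  simp only [Xr_apply, twist_X, map_smul, tw_comm, smul_smul]
  rw [X_comm S k l, smul_smul]

end Monomials

/-! ### Substitution of the transformed variables and its inverse -/

section Substitution

open Finset Skew State

variable {𝕜 ι : Type*} [Field 𝕜] [CharZero 𝕜] [Fintype ι] [LinearOrder ι] {S : Skew 𝕜 ι}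

section Mono

variable {T : Type*} [Semiring T] [Algebra 𝕜 T]

/-- The ordered monomial with exponents `e` in the elements `y i`. -/
def mono (y : ι → T) (e : ι → ℕ) : T :=
  (((Finset.univ : Finset ι).sort (· ≤ ·)).map fun i => y i ^ e i).prod

/-- Elements which commute up to the factors of `S`. -/
def SkewComm (S : Skew 𝕜 ι) (y : ι → T) : Prop := ∀ i j, y i * y j = S.ε i j • (y j * y i)

theorem SkewComm.mul_self {y : ι → T} (hy : SkewComm S y) {j : ι} (hj : S.fer j) :
    y j * y j = 0 := by
  have h := hy j j
  rw [S.diag_fer j hj] at h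
  have h2 : (2 : 𝕜) • (y j * y j) = 0 := by
    rw [two_smul]
    nth_rewrite 1 [h]
    nth_rewrite 2 [← one_smul 𝕜 (y j * y j)]
    rw [← add_smul, neg_add_cancel, zero_smul]
  rw [← one_smul 𝕜 (y j * y j), ← inv_mul_cancel₀ (two_ne_zero (α := 𝕜)), mul_smul, h2, smul_zero]

theorem SkewComm.mul_pow {y : ι → T} (hy : SkewComm S y) (j a : ι) (k : ℕ) :
    y j * y a ^ k = S.ε j a ^ k • (y a ^ k * y j) := by
  induction k with
  | zero => simp
  | succ k ih =>
    rw [pow_succ (y a), ← mul_assoc, ih, smul_mul_assoc, mul_assoc, hy j a, mul_smul_comm,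
      smul_smul, pow_succ, mul_assoc]

theorem list_mul_mono {y : ι → T} (hy : SkewComm S y) (e : ι → ℕ) (j : ι) (l : List ι)
    (hl : l.Pairwise (· < ·)) (hj : j ∈ l) :
    y j * (l.map fun i => y i ^ e i).prod =
      (l.map fun i => if i < j then S.ε j i ^ e i else 1).prod •
        (l.map fun i => y i ^ (e + Pi.single j 1 : ι → ℕ) i).prod := by
  induction l with
  | nil => simp at hj
  | cons a l ih =>
    rw [List.pairwise_cons] at hl
    simp only [List.map_cons, List.prod_cons]
    rcases List.mem_cons.1 hj with rfl | h
    · have h1 : (l.map fun i => if i < j then S.ε j i ^ e i else 1) = l.map fun _ => 1 :=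
        List.map_congr_left fun i hi => if_neg (hl.1 i hi).not_gt
      have h2 : (l.map fun i => y i ^ (e + Pi.single j 1 : ι → ℕ) i) = l.map fun i => y i ^ e i :=
        List.map_congr_left fun i hi => by simp [(hl.1 i hi).ne']
      rw [h1, h2]
      simp [pow_succ', mul_assoc]
    · rw [← mul_assoc, hy.mul_pow, smul_mul_assoc, mul_assoc, ih hl.2 h, mul_smul_comm, smul_smul,
        if_pos (hl.1 j h)]
      have : (e + Pi.single j 1 : ι → ℕ) a = e a := by simp [(hl.1 j h).ne]
      rw [this]

theorem mul_mono {y : ι → T} (hy : SkewComm S y) (e : ι → ℕ) (j : ι) :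
    y j * mono y e = S.coef j e • mono y (e + Pi.single j 1) := by
  rw [mono, list_mul_mono hy e j _ (Finset.sortedLT_sort _).pairwise (by simp), mono, Skew.coef,
    ← List.prod_toFinset _ (Finset.sort_nodup _ _), Finset.sort_toFinset]

theorem mono_eq_zero {y : ι → T} (hy : SkewComm S y) {e : ι → ℕ} {j : ι} (hj : S.fer j)
    (h : 2 ≤ e j) : mono y e = 0 := by
  refine List.prod_eq_zero (List.mem_map.2 ⟨j, by simp, ?_⟩)
  obtain ⟨k, hk⟩ := Nat.exists_eq_add_of_le h
  rw [hk, pow_add, pow_two, hy.mul_self hj, zero_mul]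

theorem mono_zero (y : ι → T) : mono y 0 = 1 := by simp [mono]

end Mono

variable {B : Type*} [Ring B] [Algebra 𝕜 B]

theorem fock_induction {V : Submodule 𝕜 (Fock S B)} (h0 : ∀ b, Finsupp.single vac b ∈ V)
    (hX : ∀ j, ∀ w ∈ V, X S j w ∈ V) (w : Fock S B) : w ∈ V := by
  induction w using Finsupp.induction_linear with
  | zero => exact V.zero_mem
  | add f g hf hg => exact V.add_mem hf hg
  | single e b =>
    induction e using State.induction with
    | h0 => exact h0 b
    | hup j e h ih => rw [single_up]; exact V.smul_mem _ (hX j _ ih)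

section Lift

variable {W : Type*} [AddCommMonoid W] [Module 𝕜 W]

/-- The linear map sending the monomial `e` with coefficient `b` to `(mono y e g₀) b`. -/
def lift (S : Skew 𝕜 ι) (y : ι → Module.End 𝕜 (B →ₗ[𝕜] W)) (g₀ : B →ₗ[𝕜] W) :
    Fock S B →ₗ[𝕜] W :=
  Finsupp.lsum 𝕜 fun e => mono y e.1 g₀

variable {y : ι → Module.End 𝕜 (B →ₗ[𝕜] W)} {g₀ : B →ₗ[𝕜] W}

theorem lift_single (e : S.State) (b : B) :
    lift S y g₀ (Finsupp.single e b) = mono y e.1 g₀ b := by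
  rw [lift, Finsupp.lsum_single]

theorem lift_vac (b : B) : lift S y g₀ (Finsupp.single vac b) = g₀ b := by
  rw [lift_single]
  change mono y 0 g₀ b = _
  rw [mono_zero]; rfl

theorem lift_X_single (hy : SkewComm S y) (j : ι) (e : S.State) (b : B) :
    lift S y g₀ (X S j (Finsupp.single e b)) = y j (mono y e.1 g₀) b := by
  rw [← Module.End.mul_apply, mul_mono hy]
  by_cases h : S.fer j → e j = 0
  · rw [X_single S j e h, map_smul, lift_single, up_val]; rfl
  · rw [X_single_of_ne S j e h, map_zero]
    push Not at h
    rw [mono_eq_zero hy h.1]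
    · simp
    · have := h.2
      simp; omega

/-- Composition with an endomorphism. -/
def post (f : Module.End 𝕜 W) : Module.End 𝕜 (B →ₗ[𝕜] W) where
  toFun g := f ∘ₗ g
  map_add' g h := LinearMap.comp_add g h f
  map_smul' c g := LinearMap.comp_smul f c g

theorem post_skewComm {f : ι → Module.End 𝕜 W} (hf : SkewComm S f) :
    SkewComm S fun i => (post (f i) : Module.End 𝕜 (B →ₗ[𝕜] W)) := fun i j => by
  ext g b
  exact LinearMap.congr_fun (hf i j) (g b)

theorem lift_post_X {f : ι → Module.End 𝕜 W} (hf : SkewComm S f) (j : ι) (w : Fock S B) :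
    lift S (fun i => post (f i)) g₀ (X S j w) = f j (lift S (fun i => post (f i)) g₀ w) := by
  induction w using Finsupp.induction_linear with
  | zero => simp
  | add f g hf hg => simp only [map_add, hf, hg]
  | single e b => rw [lift_X_single (post_skewComm hf), lift_single]; rfl

end Lift

/-- The vacuum vector with coefficient `b`. -/
def vacuum (S : Skew 𝕜 ι) : B →ₗ[𝕜] Fock S B := Finsupp.lsingle vac

variable (S) in
/-- The substitution of the transformed variables. -/
def subst (P : Matrix ι ι B) : Module.End 𝕜 (Fock S B) :=
  lift S (fun i => post (phi S P i)) (vacuum S)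

theorem phi_skewComm {P : Matrix ι ι B} (hP : PM S P) : SkewComm S (phi S P) := phi_comm hP

theorem subst_X {P : Matrix ι ι B} (hP : PM S P) (j : ι) (w : Fock S B) :
    subst S P (X S j w) = phi S P j (subst S P w) := lift_post_X (phi_skewComm hP) j w

theorem subst_vacuum (P : Matrix ι ι B) (b : B) : subst S P (vacuum S b) = vacuum S b :=
  lift_vac b

theorem phi_lm (P : Matrix ι ι B) (j : ι) (b : B) (w : Fock S B) :
    phi S P j (lm S b w) = ∑ a, X S a (lm S (P a j * b) w) := by
  simp only [phi_apply, map_mul, Module.End.mul_apply]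

theorem sum_phi_lm {P Q : Matrix ι ι B} (h : P * Q = 1) (a : ι) (w : Fock S B) :
    ∑ j, phi S P j (lm S (Q j a) w) = X S a w := by
  simp only [phi_lm]
  rw [Finset.sum_comm]
  simp only [← map_sum, ← LinearMap.sum_apply, ← Matrix.mul_apply, h, Matrix.one_apply]
  rw [Finset.sum_eq_single a (fun b _ hb => by simp [hb]) (by simp)]
  simp

/-- Since x_j = ∑_k y_k Q_kj, a monomial is a combination of the y_k applied to the shorter monomial
with coefficients Q_kj b. The coefficient changes, so the induction on monomials must range over all
coefficients. -/
theorem subst_surjective {P Q : Matrix ι ι B} (hP : PM S P) (h : P * Q = 1) :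
    Function.Surjective (subst S P) := by
  rw [← LinearMap.range_eq_top, eq_top_iff]
  rintro w -
  induction w using Finsupp.induction_linear with
  | zero => exact Submodule.zero_mem _
  | add f g hf hg => exact Submodule.add_mem _ hf hg
  | single e b =>
    induction e using State.induction generalizing b with
    | h0 => exact ⟨_, subst_vacuum P b⟩
    | hup j e he ih =>
      rw [single_up, ← sum_phi_lm h]
      refine Submodule.smul_mem _ _ (Submodule.sum_mem _ fun k _ => ?_)
      rw [lm_single]
      obtain ⟨v, hv⟩ := ih (Q k j * b)
      exact ⟨X S k v, by rw [subst_X hP, hv]⟩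

/-- The operator `g ↦ ∑ j, x_j g (Q_{j a} ·)`. -/
def xi (S : Skew 𝕜 ι) (Q : Matrix ι ι B) (a : ι) : Module.End 𝕜 (B →ₗ[𝕜] Fock S B) where
  toFun g := ∑ j, X S j ∘ₗ g ∘ₗ LinearMap.mulLeft 𝕜 (Q j a)
  map_add' f g := by
    simp [LinearMap.add_comp, LinearMap.comp_add, Finset.sum_add_distrib]
  map_smul' c g := by
    simp [LinearMap.smul_comp, LinearMap.comp_smul, Finset.smul_sum]

theorem xi_apply (Q : Matrix ι ι B) (a : ι) (g : B →ₗ[𝕜] Fock S B) (b : B) :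
    xi S Q a g b = ∑ j, X S j (g (Q j a * b)) := by
  simp [xi]

/-- The inverse substitution has to send x_a w to ∑_j x_j times the image of Q_ja w. The matrix
entry meets the coefficient before the map is applied, which is why these operators act on linear
maps from B and not on the Fock space itself. `QM` makes the coefficients of their skew commutators
antisymmetric. -/
theorem xi_skewComm {Q : Matrix ι ι B} (hQ : QM S Q) : SkewComm S (xi S Q) := fun a b => by
  ext1 g
  refine LinearMap.ext fun h => ?_
  rw [← sub_eq_zero]
  have := sum_X_X_eq_zero S
    (fun j l => g ((Q l b * Q j a - S.ε a b • (Q l a * Q j b)) * h))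
    fun i k => by rw [hQ i k a b]; simp [sub_mul]
  rw [← this]
  simp only [Module.End.mul_apply, LinearMap.smul_apply, xi_apply, map_sum, Finset.smul_sum,
    ← Finset.sum_sub_distrib]
  refine Finset.sum_congr rfl fun i _ => Finset.sum_congr rfl fun k _ => ?_
  simp only [sub_mul, map_sub, mul_assoc, smul_mul_assoc, map_smul]

variable (S) in
/-- The inverse substitution. -/
def unsubst (Q : Matrix ι ι B) : Module.End 𝕜 (Fock S B) := lift S (xi S Q) (vacuum S)

theorem lift_xi_X {Q : Matrix ι ι B} (hQ : QM S Q) (j : ι) (w : Fock S B) :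
    unsubst S Q (X S j w) = ∑ k, X S k (unsubst S Q (lm S (Q k j) w)) := by
  induction w using Finsupp.induction_linear with
  | zero => simp
  | add f g hf hg => simp only [map_add, hf, hg, Finset.sum_add_distrib]
  | single e b =>
    rw [unsubst, lift_X_single (xi_skewComm hQ), xi_apply]
    simp only [lm_single, lift_single]

theorem unsubst_phi {P Q : Matrix ι ι B} (hQ : QM S Q) (h : Q * P = 1) (j : ι) (w : Fock S B) :
    unsubst S Q (phi S P j w) = X S j (unsubst S Q w) := by
  rw [phi_apply, map_sum]
  simp only [lift_xi_X hQ, ← Module.End.mul_apply (lm S _), ← map_mul]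
  rw [Finset.sum_comm]
  simp only [← map_sum, ← LinearMap.sum_apply, ← Matrix.mul_apply, h, Matrix.one_apply]
  rw [Finset.sum_eq_single j (fun b _ hb => by simp [hb]) (by simp)]
  simp

theorem unsubst_subst {P Q : Matrix ι ι B} (hP : PM S P) (hQ : QM S Q) (h : Q * P = 1)
    (w : Fock S B) : unsubst S Q (subst S P w) = w := by
  refine fock_induction (V := LinearMap.eqLocus (unsubst S Q * subst S P) 1)
    (fun b => ?_) (fun j w hw => ?_) w
  · exact (congrArg _ (subst_vacuum P b)).trans (lift_vac b)
  · have hw' : unsubst S Q (subst S P w) = w := hw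
    change unsubst S Q (subst S P (X S j w)) = X S j w
    rw [subst_X hP, unsubst_phi hQ h, hw']

/-- The two one-sided inverse identities play separate roles: QP = 1 gives the left inverse
`unsubst`, and PQ = 1 gives surjectivity. -/
theorem subst_bijective {P Q : Matrix ι ι B} (hP : PM S P) (hQ : QM S Q) (h : P * Q = 1)
    (h' : Q * P = 1) : Function.Bijective (subst S P) :=
  ⟨Function.LeftInverse.injective (unsubst_subst hP hQ h'), subst_surjective hP h⟩

end Substitution

/-! ### Exactness modulo bosons and invertibility of the fermionic block -/

section Regularity

open Finset Skew State

section Grid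

variable {𝕜 ι W : Type*} [Field 𝕜] [DecidableEq ι] [AddCommGroup W] [Module 𝕜 W]

/-- The sum of the ranges of the `x k`, `k ∈ A`, and the `y f`, `f ∈ F`. -/
def rangeSum (x y : ι → Module.End 𝕜 W) (A F : Finset ι) : Submodule 𝕜 W :=
  (⨆ k ∈ A, LinearMap.range (x k)) ⊔ ⨆ f ∈ F, LinearMap.range (y f)

variable {x y : ι → Module.End 𝕜 W} {A F : Finset ι}

theorem mem_rangeSum_left {k : ι} (hk : k ∈ A) (u : W) : x k u ∈ rangeSum x y A F :=
  Submodule.mem_sup_left (Submodule.mem_iSup_of_mem k (Submodule.mem_iSup_of_mem hk ⟨u, rfl⟩))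

theorem mem_rangeSum_right {f : ι} (hf : f ∈ F) (u : W) : y f u ∈ rangeSum x y A F :=
  Submodule.mem_sup_right (Submodule.mem_iSup_of_mem f (Submodule.mem_iSup_of_mem hf ⟨u, rfl⟩))

theorem rangeSum_le {V : Submodule 𝕜 W} (hx : ∀ k ∈ A, ∀ u, x k u ∈ V)
    (hy : ∀ f ∈ F, ∀ u, y f u ∈ V) : rangeSum x y A F ≤ V := by
  refine sup_le (iSup₂_le fun k hk => ?_) (iSup₂_le fun f hf => ?_)
  · rintro _ ⟨u, rfl⟩; exact hx k hk u
  · rintro _ ⟨u, rfl⟩; exact hy f hf u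

theorem rangeSum_mono {A' F' : Finset ι} (hA : A ⊆ A') (hF : F ⊆ F') :
    rangeSum x y A F ≤ rangeSum x y A' F' :=
  rangeSum_le (fun _ hk u => mem_rangeSum_left (hA hk) u)
    fun _ hf u => mem_rangeSum_right (hF hf) u

theorem mem_rangeSum_insert_left {a : ι} {w : W} :
    w ∈ rangeSum x y (insert a A) F ↔ ∃ u, w - x a u ∈ rangeSum x y A F := by
  rw [rangeSum, Finset.iSup_insert, sup_assoc, ← rangeSum, Submodule.mem_sup]
  constructor
  · rintro ⟨_, ⟨u, rfl⟩, v, hv, rfl⟩; exact ⟨u, by simpa using hv⟩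
  · rintro ⟨u, hu⟩; exact ⟨_, ⟨u, rfl⟩, _, hu, by simp⟩

theorem mem_rangeSum_insert_right {f : ι} {w : W} :
    w ∈ rangeSum x y A (insert f F) ↔ ∃ u, w - y f u ∈ rangeSum x y A F := by
  rw [rangeSum, Finset.iSup_insert, sup_left_comm, ← rangeSum, Submodule.mem_sup]
  constructor
  · rintro ⟨_, ⟨u, rfl⟩, v, hv, rfl⟩; exact ⟨u, by simpa using hv⟩
  · rintro ⟨u, hu⟩; exact ⟨_, ⟨u, rfl⟩, _, hu, by simp⟩

theorem rangeSum_invariant {T : Module.End 𝕜 W} (hx : ∀ k u, ∃ v, T (x k u) = x k v)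
    (hy : ∀ f u, ∃ v, T (y f u) = y f v) {w : W} (hw : w ∈ rangeSum x y A F) :
    T w ∈ rangeSum x y A F := by
  suffices h : rangeSum x y A F ≤ (rangeSum x y A F).comap T from h hw
  refine rangeSum_le (fun k hk u => ?_) (fun f hf u => ?_)
  · obtain ⟨v, hv⟩ := hx k u
    rw [Submodule.mem_comap, hv]; exact mem_rangeSum_left hk v
  · obtain ⟨v, hv⟩ := hy f u
    rw [Submodule.mem_comap, hv]; exact mem_rangeSum_right hf v

/-- Regularity of a family of commuting operators of polynomial type `x` and
exterior type `y`: exactness without `x` and injectivity without `y` imply exactness. -/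
theorem mem_rangeSum_of_mem {fer : ι → Prop}
    (hxx : ∀ k l u, ∃ v, x k (x l u) = x l v) (hyy : ∀ f g u, ∃ v, y f (y g u) = y g v)
    (hxy : ∀ k f u, x k (y f u) = y f (x k u)) (hsq : ∀ f, fer f → ∀ u, y f (y f u) = 0)
    (hE : ∀ F : Finset ι, (∀ g ∈ F, fer g) → ∀ f, fer f → f ∉ F → ∀ w,
      y f w ∈ rangeSum x y ∅ F → w ∈ rangeSum x y ∅ (insert f F))
    (hI : ∀ A : Finset ι, (∀ g ∈ A, ¬ fer g) → ∀ k, ¬ fer k → k ∉ A → ∀ w,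
      x k w ∈ rangeSum x y A ∅ → w ∈ rangeSum x y A ∅)
    (A : Finset ι) (hA : ∀ g ∈ A, ¬ fer g) :
    ∀ F : Finset ι, (∀ g ∈ F, fer g) → ∀ f, fer f → f ∉ F → ∀ w,
      y f w ∈ rangeSum x y A F → w ∈ rangeSum x y A (insert f F) := by
  induction A using Finset.induction_on with
  | empty => exact hE
  | insert a A ha ih =>
    have hAA : ∀ g ∈ A, ¬ fer g := fun g hg => hA g (Finset.mem_insert_of_mem hg)
    have haf := hA a (Finset.mem_insert_self _ _)
    specialize ih hAA
    -- Injectivity of x_a modulo the span, by induction on F. If x_a w = y_f u modulo (A, F), then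
    -- applying y_f kills the right side and gives x_a y_f w = 0, so y_f w = 0 by the inner
    -- induction, and exactness for A yields w in the span enlarged by f.
    have hinj : ∀ F : Finset ι, (∀ g ∈ F, fer g) → ∀ w,
        x a w ∈ rangeSum x y A F → w ∈ rangeSum x y A F := by
      intro F
      induction F using Finset.induction_on with
      | empty => exact fun _ w => hI A hAA a haf ha w
      | insert f F hf ihF =>
        intro hF w hw
        have hFF : ∀ g ∈ F, fer g := fun g hg => hF g (Finset.mem_insert_of_mem hg)
        have hff := hF f (Finset.mem_insert_self _ _)
        obtain ⟨u, hu⟩ := mem_rangeSum_insert_right.1 hw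
        have h1 := rangeSum_invariant (T := y f) (fun k u => ⟨y f u, (hxy k f u).symm⟩)
          (hyy f) hu
        rw [map_sub, hsq f hff, sub_zero, ← hxy] at h1
        exact ih F hFF f hff hf w (ihF hFF _ h1)
    intro F hF f hf hfF w hw
    -- Modulo (A, F), y_f w = x_a u. Applying y_f and cancelling x_a gives y_f u = 0, hence u = y_f
    -- u'. Then w - x_a u' is killed by y_f, and exactness for A applies to it.
    obtain ⟨u, hu⟩ := mem_rangeSum_insert_left.1 hw
    have h1 := rangeSum_invariant (T := y f) (fun k u => ⟨y f u, (hxy k f u).symm⟩) (hyy f) hu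
    rw [map_sub, hsq f hf, zero_sub, Submodule.neg_mem_iff, ← hxy] at h1
    obtain ⟨u', hu'⟩ := mem_rangeSum_insert_right.1 (ih F hF f hf hfF u (hinj F hF _ h1))
    have h2 := rangeSum_invariant (T := x a) (hxx a) (fun g v => ⟨x a v, hxy a g v⟩) hu'
    have h3 : y f (w - x a u') ∈ rangeSum x y A F := by
      have := Submodule.add_mem _ hu h2
      rw [map_sub, hxy] at this
      rwa [map_sub, ← hxy a f u', ← sub_add_sub_cancel _ (x a u) _, hxy a f u']
    have h4 := ih F hF f hf hfF _ h3
    exact mem_rangeSum_insert_left.2 ⟨u', h4⟩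

end Grid

variable {𝕜 ι : Type*} [Field 𝕜] [CharZero 𝕜] [Fintype ι] [LinearOrder ι] {S : Skew 𝕜 ι}
variable {B : Type*} [Ring B] [Algebra 𝕜 B]

variable (S B) in
/-- The vectors all of whose monomials involve a variable in `A`. -/
def involving (A : Finset ι) : Submodule 𝕜 (Fock S B) where
  carrier := {w | ∀ e : S.State, (∀ b ∈ A, e b = 0) → w e = 0}
  add_mem' {v w} hv hw e he := by rw [Finsupp.add_apply, hv e he, hw e he, add_zero]
  zero_mem' _ _ := rfl
  smul_mem' c w hw e he := by rw [Finsupp.smul_apply, hw e he, smul_zero]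

theorem X_mem_involving {A : Finset ι} {a : ι} (ha : a ∈ A) (w : Fock S B) :
    X S a w ∈ involving S B A := fun e he => by rw [X_apply, if_pos (he a ha)]

theorem involving_eq (A : Finset ι) :
    involving S B A = ⨆ a ∈ A, LinearMap.range (X S a : Module.End 𝕜 (Fock S B)) := by
  refine le_antisymm (fun w hw => ?_) (iSup₂_le fun a ha => ?_)
  · rw [← Finsupp.sum_single w]
    refine Submodule.sum_mem _ fun e he => ?_
    obtain ⟨a, ha, hae⟩ : ∃ a ∈ A, e a ≠ 0 := by
      by_contra! h
      exact (Finsupp.mem_support_iff.1 he) (hw e h)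
    rw [← up_down a e hae, single_up]
    exact Submodule.smul_mem _ _ (Submodule.mem_iSup_of_mem a
      (Submodule.mem_iSup_of_mem ha ⟨_, rfl⟩))
  · rintro _ ⟨u, rfl⟩; exact X_mem_involving ha u

theorem mem_involving_of_X_mem {A : Finset ι} {j : ι} (hj : j ∉ A) {w : Fock S B}
    (hw : X S j w ∈ involving S B A) {e : S.State} (he : ∀ b ∈ A, e b = 0)
    (hje : S.fer j → e j = 0) : w e = 0 := by
  have h := hw (up j e hje) fun b hb => by
    rw [up_of_ne (fun h : b = j => hj (h ▸ hb)), he b hb]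
  rw [X_apply_up] at h
  exact (smul_eq_zero.1 h).resolve_left (S.coef_ne_zero _ _)

section Crux

variable {P Q : Matrix ι ι B}

variable (S) in
/-- The span of the ranges of the variables in `A` and the transformed variables in `F`. -/
abbrev mixed (P : Matrix ι ι B) (A F : Finset ι) : Submodule 𝕜 (Fock S B) :=
  rangeSum (Xr S) (phi S P) A F

theorem mixed_empty_right (A : Finset ι) : mixed S P A ∅ = involving S B A := by
  simp [mixed, rangeSum, range_Xr, involving_eq]

/-- The substitution intertwines x_f with y_f. Being surjective, it carries the range of x_f onto
the whole range of y_f. -/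
theorem mixed_empty_left (hP : PM S P) (hsurj : Function.Surjective (subst S P))
    (F : Finset ι) : mixed S P ∅ F = (involving S B F).map (subst S P) := by
  have h : ∀ f, LinearMap.range (phi S P f) = (LinearMap.range (X S f)).map (subst S P) := by
    intro f
    ext w
    simp only [LinearMap.mem_range, Submodule.mem_map, exists_exists_eq_and, subst_X hP]
    exact (hsurj.exists (p := fun v => phi S P f v = w))
  simp [mixed, rangeSum, involving_eq, Submodule.map_iSup, h]

/-- Both extreme cases are visible on exponents. Without bosons, the substitution pulls the claim
back to the original variables, where x_f w lying in the ideal of F forces w into that of F and f.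
Without transformed fermions, a bosonic variable is injective modulo other variables. -/
theorem mem_mixed_of_phi_mem (hP : PM S P) (hbij : Function.Bijective (subst S P))
    {A F : Finset ι} (hA : ∀ g ∈ A, ¬ S.fer g) (hF : ∀ g ∈ F, S.fer g) {f : ι} (hf : S.fer f)
    (hfF : f ∉ F) {w : Fock S B} (hw : phi S P f w ∈ mixed S P A F) :
    w ∈ mixed S P A (insert f F) := by
  refine mem_rangeSum_of_mem (fer := S.fer) (fun k l u => ⟨S.ε l k • Xr S k u, ?_⟩)
    (fun f g u => ⟨S.ε f g • phi S P f u, ?_⟩) (fun k f u => Xr_phi P k f u) (fun f hf u => ?_)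
    (fun F hF f hf hfF w hw => ?_) (fun A hA k hk hkA w hw => ?_) A hA F hF f hf hfF w hw
  · rw [map_smul]; exact Xr_comm k l u
  · rw [map_smul]; exact LinearMap.congr_fun (phi_comm hP f g) u
  · exact LinearMap.congr_fun ((phi_skewComm hP).mul_self hf) u
  · change _ ∈ mixed S P ∅ F at hw
    change w ∈ mixed S P ∅ _
    rw [mixed_empty_left hP hbij.2] at hw ⊢
    obtain ⟨w, rfl⟩ := hbij.2 w
    rw [← subst_X hP] at hw
    obtain ⟨v, hv, hvw⟩ := hw
    rw [hbij.1 hvw] at hv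
    refine ⟨w, fun e he => ?_, rfl⟩
    exact mem_involving_of_X_mem hfF hv (fun b hb => he b (Finset.mem_insert_of_mem hb))
      fun _ => he f (Finset.mem_insert_self _ _)
  · change _ ∈ mixed S P A ∅ at hw
    change w ∈ mixed S P A ∅
    rw [mixed_empty_right] at hw ⊢
    obtain ⟨u, hu⟩ : ∃ u, u = twist S k w := ⟨_, rfl⟩
    rw [Xr_apply, ← hu] at hw
    intro e he
    have := mem_involving_of_X_mem hkA hw he fun h => absurd h hk
    rw [hu, twist_apply] at this
    exact (smul_eq_zero.1 this).resolve_left (S.tw_ne_zero _ _)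

theorem mem_mixed_of_list_mem (hP : PM S P) (hbij : Function.Bijective (subst S P))
    {A : Finset ι} (hA : ∀ g ∈ A, ¬ S.fer g) (l : List ι) (hl : l.Nodup)
    (hfer : ∀ f ∈ l, S.fer f) {F : Finset ι} (hF : ∀ g ∈ F, S.fer g)
    (hd : ∀ f ∈ l, f ∉ F) {w : Fock S B}
    (hw : (l.map (phi S P)).prod w ∈ mixed S P A F) : w ∈ mixed S P A (F ∪ l.toFinset) := by
  induction l generalizing F with
  | nil => simpa using hw
  | cons a l ih =>
    rw [List.map_cons, List.prod_cons, Module.End.mul_apply] at hw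
    rw [List.nodup_cons] at hl
    have h1 := mem_mixed_of_phi_mem hP hbij hA hF (hfer a List.mem_cons_self)
      (hd a List.mem_cons_self) hw
    have := ih hl.2 (fun f hf => hfer f (List.mem_cons_of_mem _ hf)) (F := insert a F)
      (fun g hg => by
        rcases Finset.mem_insert.1 hg with rfl | hg
        · exact hfer _ List.mem_cons_self
        · exact hF g hg)
      (fun f hf => by
        rw [Finset.mem_insert, not_or]
        exact ⟨fun h => hl.1 (h ▸ hf), hd f (List.mem_cons_of_mem _ hf)⟩) h1
    rw [List.toFinset_cons, Finset.union_insert]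
    rwa [Finset.insert_union] at this

theorem phi_apply_vac (P : Matrix ι ι B) (f : ι) (w : Fock S B) : phi S P f w vac = 0 := by
  rw [phi_apply, Finsupp.finsetSum_apply]
  exact Finset.sum_eq_zero fun i _ => by rw [X_apply, if_pos (vac_apply i)]

theorem apply_vac_of_mem_mixed {A F : Finset ι} {w : Fock S B} (hw : w ∈ mixed S P A F) :
    w vac = 0 := by
  suffices h : mixed S P A F ≤ LinearMap.ker (Finsupp.lapply (R := 𝕜) (vac : S.State)) from h hw
  refine rangeSum_le (fun k _ u => ?_) (fun f _ u => phi_apply_vac P f u)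
  change Xr S k u vac = 0
  rw [Xr_apply, X_apply, if_pos (vac_apply k)]

theorem vacuum_apply (b : B) : vacuum S b vac = b := Finsupp.single_eq_same

variable (S) in
open Classical in
/-- The set of the variables which are not fermionic. -/
def bosons : Finset ι := Finset.univ.filter fun i => ¬ S.fer i

theorem mem_bosons {i : ι} : i ∈ bosons S ↔ ¬ S.fer i := by simp [bosons]

/-- Peeling off the transformed fermions one at a time puts the vacuum with coefficient b into a
space whose members have no constant term. -/
theorem eq_zero_of_list_mem (hP : PM S P) (hbij : Function.Bijective (subst S P))
    (l : List ι) (hl : l.Nodup) (hfer : ∀ f ∈ l, S.fer f) {b : B}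
    (hw : (l.map (phi S P)).prod (vacuum S b) ∈ involving S B (bosons S)) : b = 0 := by
  rw [← mixed_empty_right (P := P)] at hw
  have := apply_vac_of_mem_mixed (mem_mixed_of_list_mem hP hbij (fun g hg => mem_bosons.1 hg) l hl
    hfer (F := ∅) (by simp) (by simp) hw)
  rwa [vacuum_apply] at this

variable (S B) in
/-- The homogeneous vectors of degree `d`. -/
def degree (d : ℕ) : Submodule 𝕜 (Fock S B) where
  carrier := {w | ∀ e : S.State, ∑ i, e i ≠ d → w e = 0}
  add_mem' {v w} hv hw e he := by rw [Finsupp.add_apply, hv e he, hw e he, add_zero]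
  zero_mem' _ _ := rfl
  smul_mem' c w hw e he := by rw [Finsupp.smul_apply, hw e he, smul_zero]

theorem sum_up (j : ι) (e : S.State) (h) : ∑ i, up j e h i = ∑ i, e i + 1 := by
  simp only [up_apply, Finset.sum_add_distrib]; simp

theorem X_mem_degree {d : ℕ} {w : Fock S B} (hw : w ∈ degree S B d) (j : ι) :
    X S j w ∈ degree S B (d + 1) := fun e he => by
  rw [X_apply]
  split_ifs with h
  · rfl
  · rw [hw, smul_zero]
    rintro rfl
    apply he
    rw [← sum_up j (down j e) (down_ok h), up_down j e h]

theorem lm_mem_degree {d : ℕ} {w : Fock S B} (hw : w ∈ degree S B d) (b : B) :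
    lm S b w ∈ degree S B d := fun e he => by rw [lm_apply, hw e he, mul_zero]

theorem phi_mem_degree {d : ℕ} {w : Fock S B} (hw : w ∈ degree S B d) (j : ι) :
    phi S P j w ∈ degree S B (d + 1) := by
  rw [phi_apply]
  exact Submodule.sum_mem _ fun i _ => X_mem_degree (lm_mem_degree hw _) _

theorem vacuum_mem_degree (b : B) : vacuum S b ∈ degree S B 0 := fun e he => by
  refine Finsupp.single_eq_of_ne ?_
  rintro rfl
  simp at he

theorem list_mem_degree {Z : ι → Module.End 𝕜 (Fock S B)}
    (hZ : ∀ j d, ∀ w ∈ degree S B d, Z j w ∈ degree S B (d + 1)) {d : ℕ} {w : Fock S B}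
    (hw : w ∈ degree S B d) (l : List ι) :
    (l.map Z).prod w ∈ degree S B (d + l.length) := by
  induction l with
  | nil => simpa using hw
  | cons a l ih => exact hZ a _ _ ih

/-- Pigeonhole: a monomial without bosons has degree at most the number of fermions. -/
theorem mem_involving_of_mem_degree {d : ℕ} {w : Fock S B} (hw : w ∈ degree S B d)
    {l : List ι} (hl : ∀ f, S.fer f → f ∈ l) (hd : l.length < d) :
    w ∈ involving S B (bosons S) := fun e he => hw e <| by
  refine ne_of_lt (lt_of_le_of_lt ?_ hd)
  calc ∑ i, e i ≤ ∑ i, if i ∈ l then 1 else 0 := by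
        refine Finset.sum_le_sum fun i _ => ?_
        by_cases hi : S.fer i
        · rw [if_pos (hl i hi)]; exact e.2 i hi
        · rw [he i (mem_bosons.2 hi)]; exact Nat.zero_le _
    _ ≤ l.length := by
        rw [← Finset.sum_filter, Finset.sum_const, smul_eq_mul, mul_one]
        refine le_trans (Finset.card_le_card (t := l.toFinset) fun i hi => ?_)
          (List.toFinset_card_le l)
        simpa using hi

variable (S) in
/-- The state with a single variable `a`. -/
def unit (a : ι) : S.State := up a vac fun _ => vac_apply a

theorem unit_apply_of_ne {a b : ι} (h : b ≠ a) : unit S a b = 0 := by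
  rw [unit, up_of_ne h, vac_apply]

theorem coef_vac (a : ι) : S.coef a (vac : S.State) = 1 :=
  Finset.prod_eq_one fun i _ => by simp

theorem X_apply_unit (a b : ι) (w : Fock S B) :
    X S b w (unit S a) = if b = a then w vac else 0 := by
  split_ifs with h
  · subst h; rw [unit, X_apply_up, coef_vac, one_smul]
  · rw [X_apply, if_pos (unit_apply_of_ne h)]

theorem phi_apply_unit (a f : ι) (w : Fock S B) :
    phi S P f w (unit S a) = P a f * w vac := by
  simp [phi_apply, Finsupp.finsetSum_apply, X_apply_unit]

theorem rangeSum_univ_iff {𝕜 W : Type*} [Field 𝕜] [AddCommGroup W] [Module 𝕜 W]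
    {x y : ι → Module.End 𝕜 W} {A F : Finset ι} {w : W} :
    w ∈ rangeSum x y A F ↔ ∃ u : ι → W, w - ∑ f ∈ F, y f (u f) ∈ rangeSum x y A ∅ := by
  induction F using Finset.induction_on generalizing w with
  | empty => simp
  | insert f F hf ih =>
    rw [mem_rangeSum_insert_right]
    constructor
    · rintro ⟨v, hv⟩
      obtain ⟨u, hu⟩ := ih.1 hv
      refine ⟨Function.update u f v, ?_⟩
      rw [Finset.sum_insert hf, Function.update_self, ← sub_sub]
      rwa [Finset.sum_congr rfl fun g hg => by
        rw [Function.update_of_ne (fun h : g = f => hf (h ▸ hg))]]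
    · rintro ⟨u, hu⟩
      refine ⟨u f, ih.2 ⟨u, ?_⟩⟩
      rwa [Finset.sum_insert hf, ← sub_sub] at hu

variable (S) in
/-- The fermionic block of a matrix. -/
abbrev ferBlock (P : Matrix ι ι B) : Matrix {i // S.fer i} {i // S.fer i} B :=
  P.submatrix Subtype.val Subtype.val

/-- Modulo bosons, exactness in degree one says that the transformed fermions generate the degree
one part and are independent over the coefficients. The first gives a right inverse of the block,
the second left cancellability. -/
theorem ferBlock_isUnit [DecidablePred S.fer] (hP : PM S P) (hbij : Function.Bijective (subst S P)) :
    IsUnit (ferBlock S P) := by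
  have hbos : ∀ g ∈ bosons S, ¬ S.fer g := fun g hg => mem_bosons.1 hg
  obtain ⟨F, hF⟩ : ∃ F : Finset ι, ∀ i, i ∈ F ↔ S.fer i := ⟨univ.filter S.fer, by simp⟩
  have hright : ∀ b : {i // S.fer i}, ∃ u : {i // S.fer i} → B,
      ∀ a : {i // S.fer i}, ∑ f, P a.1 f.1 * u f = if a = b then 1 else 0 := by
    intro b
    -- All transformed fermions together with x_b give a degree one larger than the number of
    -- fermions, so every monomial contains a boson. Exactness then writes x_b as a combination of
    -- the y_f modulo bosons.
    have h1 : (F.toList.map (phi S P)).prod (X S b (vacuum S 1)) ∈ mixed S P (bosons S) ∅ := by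
      rw [mixed_empty_right]
      refine mem_involving_of_mem_degree (list_mem_degree (d := 1)
        (fun j d w hw => phi_mem_degree hw j) (X_mem_degree (vacuum_mem_degree 1) _) F.toList)
        (l := F.toList) (fun f hf => by simpa [hF] using hf) (by omega)
    have h2 := mem_mixed_of_list_mem hP hbij hbos F.toList F.nodup_toList
      (fun f hf => by simpa [hF] using hf) (by simp) (by simp) h1
    rw [Finset.toList_toFinset, Finset.empty_union] at h2
    obtain ⟨u, hu⟩ := rangeSum_univ_iff.1 h2
    change _ ∈ mixed S P (bosons S) ∅ at hu
    rw [mixed_empty_right] at hu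
    refine ⟨fun f => u f vac, fun a => ?_⟩
    have h3 := hu (unit S a) fun b hb =>
      unit_apply_of_ne fun h => hbos b hb (h ▸ a.2)
    rw [Finsupp.sub_apply, Finsupp.finsetSum_apply, sub_eq_zero, X_apply_unit] at h3
    simp only [phi_apply_unit, vacuum_apply] at h3
    rw [Finset.sum_subtype F hF (fun f => P a f * u f vac)] at h3
    rw [← h3]
    simp [Subtype.ext_iff, eq_comm]
  have hleft : ∀ h : {i // S.fer i} → B, (∀ a : {i // S.fer i}, ∑ f, P a.1 f.1 * h f = 0) →
      ∀ f, h f = 0 := by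
    intro h hh f
    have h1 : ∑ g, phi S P g.1 (vacuum S (h g)) ∈ mixed S P (bosons S) ∅ := by
      rw [mixed_empty_right]
      have : ∑ g, phi S P g.1 (vacuum S (h g)) =
          ∑ a, X S a (vacuum S (∑ g, P a g.1 * h g)) := by
        simp only [phi_apply]
        rw [Finset.sum_comm]
        refine Finset.sum_congr rfl fun a _ => ?_
        rw [map_sum, map_sum]
        refine Finset.sum_congr rfl fun g _ => ?_
        rw [vacuum, Finsupp.lsingle_apply, lm_single]; rfl
      rw [this]
      refine Submodule.sum_mem _ fun a _ => ?_
      by_cases ha : S.fer a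
      · rw [hh ⟨a, ha⟩, map_zero, map_zero]; exact Submodule.zero_mem _
      · exact X_mem_involving (mem_bosons.2 ha) _
    -- One term of the relation is isolated, so exactness over the remaining fermions applies to the
    -- vacuum with coefficient `h f`, whose constant term must then vanish.
    have h2 : phi S P f.1 (vacuum S (h f)) ∈ mixed S P (bosons S) (F.erase f) := by
      rw [← Finset.add_sum_erase _ _ (Finset.mem_univ f)] at h1
      have h3 := rangeSum_mono (Finset.Subset.refl _) (Finset.empty_subset (F.erase f)) h1
      refine (Submodule.add_mem_iff_left _ (Submodule.sum_mem _ fun g hg => ?_)).1 h3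
      refine mem_rangeSum_right (Finset.mem_erase.2 ⟨?_, (hF _).2 g.2⟩) _
      exact fun h => (Finset.ne_of_mem_erase hg) (Subtype.ext h)
    have h3 := apply_vac_of_mem_mixed (mem_mixed_of_phi_mem hP hbij hbos
      (fun g hg => (hF g).1 (Finset.mem_of_mem_erase hg)) f.2 (Finset.notMem_erase _ _) h2)
    rwa [vacuum_apply] at h3
  choose Z hZ using hright
  have h1 : ferBlock S P * Matrix.of (fun f b => Z b f) = 1 := by
    ext a b
    rw [Matrix.mul_apply, Matrix.one_apply]
    exact hZ b a
  refine ⟨⟨_, _, h1, ?_⟩, rfl⟩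
  rw [← sub_eq_zero]
  ext f b
  refine hleft (fun f => (Matrix.of (fun f b => Z b f) * ferBlock S P - 1 :
    Matrix {i // S.fer i} {i // S.fer i} B) f b) (fun a => ?_) f
  have h2 : ferBlock S P * (Matrix.of (fun f b => Z b f) * ferBlock S P - 1) = 0 := by
    rw [mul_sub, ← mul_assoc, h1, one_mul, mul_one, sub_self]
  exact congrFun (congrFun h2 a) b

end Crux

end Regularity

/-! ### Ordered products and the quantum determinant -/

section QuantumDeterminant

open Finset Skew State SuperManin

section Words

variable {𝕜 α T : Type*} [Field 𝕜] [LinearOrder α] [Semiring T] [Algebra 𝕜 T]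

/-- The number of inversions of a list. -/
def listInv : List α → ℕ
  | [] => 0
  | a :: l => l.countP (· < a) + listInv l

theorem prod_orderedInsert {y : α → T} {c : 𝕜} (hy : ∀ a b, a < b → y b * y a = c • (y a * y b))
    (a : α) (l : List α) (hl : l.Pairwise (· ≤ ·)) :
    y a * (l.map y).prod = c ^ l.countP (· < a) • ((l.orderedInsert (· ≤ ·) a).map y).prod := by
  induction l with
  | nil => simp
  | cons b l ih =>
    rw [List.pairwise_cons] at hl
    by_cases hab : a ≤ b
    · have h : (b :: l).countP (· < a) = 0 := by
        rw [List.countP_eq_zero]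
        rintro d hd
        rcases List.mem_cons.1 hd with rfl | hd
        · simpa using hab
        · simpa using hab.trans (hl.1 d hd)
      rw [h, pow_zero, one_smul, List.orderedInsert_cons, if_pos hab]
      simp
    · rw [List.orderedInsert_cons, if_neg hab, List.map_cons, List.prod_cons, ← mul_assoc,
        hy b a (not_le.1 hab), smul_mul_assoc, mul_assoc, ih hl.2, List.map_cons, List.prod_cons,
        mul_smul_comm, smul_smul, List.countP_cons_of_pos (by simpa using hab), pow_succ']

theorem prod_insertionSort {y : α → T} {c : 𝕜}
    (hy : ∀ a b, a < b → y b * y a = c • (y a * y b)) (l : List α) :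
    (l.map y).prod = c ^ listInv l • ((l.insertionSort (· ≤ ·)).map y).prod := by
  induction l with
  | nil => simp [listInv]
  | cons a l ih =>
    rw [List.map_cons, List.prod_cons, ih, mul_smul_comm,
      prod_orderedInsert hy a _ (List.pairwise_insertionSort _ _), smul_smul, listInv, pow_add,
      (List.perm_insertionSort _ l).countP_eq, mul_comm]
    rfl

theorem listInv_map {β : Type*} [LinearOrder β] (σ : β → α) (l : List β)
    (hl : l.Pairwise (· < ·)) : listInv (l.map σ) =
      ∑ a ∈ l.toFinset, ∑ b ∈ l.toFinset, if a < b ∧ σ b < σ a then 1 else 0 := by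
  induction l with
  | nil => simp [listInv]
  | cons x l ih =>
    rw [List.pairwise_cons] at hl
    have hx : x ∉ l.toFinset := fun h => lt_irrefl _ (hl.1 x (List.mem_toFinset.1 h))
    have hnd : l.Nodup := hl.2.imp fun h => ne_of_lt h
    rw [List.map_cons, listInv, ih hl.2, List.toFinset_cons, Finset.sum_insert hx,
      Finset.sum_insert hx]
    simp only [lt_irrefl, false_and, if_false, zero_add]
    congr 1
    · rw [List.sum_toFinset _ hnd, List.countP_map]
      clear ih hx hnd
      induction l with
      | nil => simp
      | cons b l ih =>
        rw [List.countP_cons, ih ⟨fun d hd => hl.1 d (List.mem_cons_of_mem _ hd),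
          (List.pairwise_cons.1 hl.2).2⟩]
        simp [hl.1 b List.mem_cons_self, add_comm]
    · refine Finset.sum_congr rfl fun a ha => ?_
      rw [Finset.sum_insert hx, if_neg, zero_add]
      exact fun h => lt_asymm h.1 (hl.1 a (List.mem_toFinset.1 ha))

variable [Fintype α]

/-- The product of the `f i`, taken in increasing order of `i`. -/
def oprod (f : α → T) : T := (((univ : Finset α).sort (· ≤ ·)).map f).prod

theorem oprod_perm {y : α → T} {c : 𝕜}
    (hy : ∀ a b, a < b → y b * y a = c • (y a * y b)) (σ : Equiv.Perm α) :
    oprod (fun i => y (σ i)) = c ^ invCount σ • oprod y := by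
  have h1 : (((univ : Finset α).sort (· ≤ ·)).map σ).insertionSort (· ≤ ·) =
      (univ : Finset α).sort (· ≤ ·) := by
    refine List.Perm.eq_of_pairwise' (List.pairwise_insertionSort _ _)
      (Finset.pairwise_sort _ _) ((List.perm_insertionSort _ _).trans ?_)
    rw [List.perm_ext_iff_of_nodup ((Finset.sort_nodup _ _).map σ.injective)
      (Finset.sort_nodup _ _)]
    intro a
    simp only [List.mem_map, Finset.mem_sort, Finset.mem_univ, true_and, iff_true]
    exact ⟨σ.symm a, by simp⟩
  have h2 : listInv (((univ : Finset α).sort (· ≤ ·)).map σ) = invCount σ := by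
    rw [listInv_map _ _ (Finset.sortedLT_sort _).pairwise, invCount, Finset.card_filter,
      Finset.sort_toFinset, ← Finset.univ_product_univ, Finset.sum_product]
  have h3 := prod_insertionSort hy (((univ : Finset α).sort (· ≤ ·)).map σ)
  rwa [h1, h2, List.map_map] at h3

/-- The ordered product as a multilinear map. -/
def oprodMultilinear (α T : Type*) [LinearOrder α] [Fintype α] [Semiring T] :
    MultilinearMap ℕ (fun _ : α => T) T where
  toFun := oprod
  map_update_add' m i x y := by
    simp only [oprod, List.Nodup.map_update (Finset.sort_nodup _ _), Finset.mem_sort,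
      Finset.mem_univ, if_true, List.prod_set]
    split_ifs with h
    · simp [mul_add, add_mul]
    · exact absurd (by rw [List.length_map, List.idxOf_lt_length_iff]; simp) h
  map_update_smul' m i c x := by
    simp only [oprod, List.Nodup.map_update (Finset.sort_nodup _ _), Finset.mem_sort,
      Finset.mem_univ, if_true, List.prod_set]
    split_ifs with h
    · rw [mul_smul_comm, smul_mul_assoc]
    · exact absurd (by rw [List.length_map, List.idxOf_lt_length_iff]; simp) h

theorem oprod_sum {β : Type*} [Fintype β] (Z : α → β → T) :
    oprod (fun i => ∑ a, Z i a) = ∑ g : α → β, oprod fun i => Z i (g i) := by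
  classical
  exact MultilinearMap.map_sum (oprodMultilinear α T) Z

theorem sum_eq_sum_perm [DecidableEq α] {M : Type*} [AddCommMonoid M] (F : (α → α) → M)
    (hF : ∀ g, ¬ Function.Injective g → F g = 0) : ∑ g, F g = ∑ σ : Equiv.Perm α, F σ := by
  classical
  rw [← Finset.sum_subset (Finset.filter_subset Function.Bijective univ) fun g _ hg => hF g fun h =>
    hg (by simpa using Finite.injective_iff_bijective.1 h)]
  exact Finset.sum_bij (fun g hg => Equiv.ofBijective g (by simpa using hg)) (by simp)
    (fun g _ g' _ h => congrArg (fun e : Equiv.Perm α => (e : α → α)) h)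
    (fun σ _ => ⟨σ, by simp, Equiv.ext fun _ => rfl⟩) (fun _ _ => rfl)

/-- The determinant with column-ordered products and weight `c` for each inversion. -/
def cdet (c : 𝕜) (P : Matrix α α T) : T :=
  ∑ σ : Equiv.Perm α, c ^ invCount σ • oprod fun i => P (σ i) i

theorem list_prod_mul {β : Type*} (l : List β) {y a : β → T}
    (h : ∀ i j, a i * y j = y j * a i) :
    (l.map fun i => y i * a i).prod = (l.map y).prod * (l.map a).prod := by
  induction l with
  | nil => simp
  | cons b l ih =>
    have h1 : a b * (l.map y).prod = (l.map y).prod * a b :=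
      (Commute.list_prod_right _ _ fun x hx => by
        obtain ⟨i, -, rfl⟩ := List.mem_map.1 hx
        exact h b i : Commute (a b) _)
    simp only [List.map_cons, List.prod_cons, ih]
    rw [mul_assoc, ← mul_assoc (a b), h1, mul_assoc, mul_assoc]

/-- The product of linear forms in anticommuting elements. -/
theorem oprod_sum_mul {y : α → T} {a : Matrix α α T} {c : 𝕜}
    (hy : ∀ a b, a < b → y b * y a = c • (y a * y b))
    (hsq : ∀ g : α → α, ¬ Function.Injective g → oprod (fun i => y (g i)) = 0)
    (hcomm : ∀ i j k, a j k * y i = y i * a j k) :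
    oprod (fun i => ∑ b, y b * a b i) = oprod y * cdet c a := by
  classical
  have h : ∀ g : α → α, oprod (fun i => y (g i) * a (g i) i) =
      oprod (fun i => y (g i)) * oprod fun i => a (g i) i := fun g =>
    list_prod_mul _ fun i j => hcomm _ _ _
  rw [oprod_sum, sum_eq_sum_perm]
  · rw [cdet, Finset.mul_sum]
    refine Finset.sum_congr rfl fun σ _ => ?_
    rw [h, oprod_perm hy, mul_smul_comm, smul_mul_assoc]
  · intro g hg
    rw [h, hsq g hg, zero_mul]

theorem map_cdet {T' : Type*} [Semiring T'] [Algebra 𝕜 T'] (φ : T →ₐ[𝕜] T') (c : 𝕜)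
    (P : Matrix α α T) : φ (cdet c P) = cdet c (P.map φ) := by
  simp [cdet, oprod, map_list_prod, List.map_map, Function.comp_def]

end Words

section Perm

variable {𝕜 ι : Type*} [Field 𝕜] [CharZero 𝕜] [Fintype ι] [LinearOrder ι] {S : Skew 𝕜 ι}
variable {T : Type*} [Semiring T] [Algebra 𝕜 T]

theorem SkewComm.mul_list {y : ι → T} (hy : SkewComm S y) (j : ι) (l : List ι) :
    ∃ c : 𝕜, c ≠ 0 ∧ y j * (l.map y).prod = c • ((l.map y).prod * y j) := by
  induction l with
  | nil => exact ⟨1, one_ne_zero, by simp⟩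
  | cons a l ih =>
    obtain ⟨c, hc0, hc⟩ := ih
    exact ⟨S.ε j a * c, mul_ne_zero (S.ne_zero _ _) hc0, by
      rw [List.map_cons, List.prod_cons, ← mul_assoc, hy j a, smul_mul_assoc, mul_assoc, hc,
        mul_smul_comm, smul_smul, mul_assoc]⟩

theorem SkewComm.mul_list_eq_zero {y : ι → T} (hy : SkewComm S y) {j : ι} (hj : S.fer j)
    {l : List ι} (hl : j ∈ l) : y j * (l.map y).prod = 0 := by
  obtain ⟨s, t, rfl⟩ := List.append_of_mem hl
  obtain ⟨c, -, hc⟩ := hy.mul_list j s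
  rw [List.map_append, List.prod_append, ← mul_assoc, hc, List.map_cons, List.prod_cons,
    smul_mul_assoc, mul_assoc, ← mul_assoc (y j), hy.mul_self hj, zero_mul, mul_zero, smul_zero]

theorem SkewComm.list_mul_eq_zero {y : ι → T} (hy : SkewComm S y) {j : ι} (hj : S.fer j)
    {l : List ι} (hl : j ∈ l) : (l.map y).prod * y j = 0 := by
  obtain ⟨c, hc0, hc⟩ := hy.mul_list j l
  rw [hy.mul_list_eq_zero hj hl] at hc
  rw [← one_smul 𝕜 ((l.map y).prod * y j), ← inv_mul_cancel₀ hc0, mul_smul, ← hc, smul_zero]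

theorem SkewComm.list_eq_zero {y : ι → T} (hy : SkewComm S y) {l : List ι}
    (hf : ∀ j ∈ l, S.fer j) (hl : ¬ l.Nodup) : (l.map y).prod = 0 := by
  induction l with
  | nil => exact absurd List.nodup_nil hl
  | cons a l ih =>
    rw [List.nodup_cons, not_and_or, not_not] at hl
    rw [List.map_cons, List.prod_cons]
    rcases hl with h | h
    · exact hy.mul_list_eq_zero (hf a List.mem_cons_self) h
    · rw [ih (fun j hj => hf j (List.mem_cons_of_mem _ hj)) h, mul_zero]

/-- Reordering a word costs a scalar which does not depend on the elements. -/
theorem exists_scalar_of_perm {l l' : List ι} (h : l.Perm l') : ∃ s : 𝕜, s ≠ 0 ∧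
    ∀ y : ι → T, SkewComm S y → (l.map y).prod = s • (l'.map y).prod := by
  induction h with
  | nil => exact ⟨1, one_ne_zero, fun y _ => by simp⟩
  | cons a _ ih =>
    obtain ⟨s, hs, h⟩ := ih
    exact ⟨s, hs, fun y hy => by simp [h y hy]⟩
  | swap a b l =>
    exact ⟨S.ε b a, S.ne_zero _ _, fun y hy => by
      simp only [List.map_cons, List.prod_cons, ← mul_assoc]
      rw [hy b a, smul_mul_assoc]⟩
  | trans _ _ ih1 ih2 =>
    obtain ⟨s, hs, h⟩ := ih1
    obtain ⟨s', hs', h'⟩ := ih2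
    exact ⟨s * s', mul_ne_zero hs hs', fun y hy => by rw [h y hy, h' y hy, smul_smul]⟩

end Perm

variable {𝕜 ι : Type*} [Field 𝕜] [CharZero 𝕜] [Fintype ι] [LinearOrder ι] {S : Skew 𝕜 ι}
variable {B : Type*} [Ring B] [Algebra 𝕜 B]
variable {α : Type*} [Fintype α] [LinearOrder α]

theorem X_skewComm : SkewComm S (X S : ι → Module.End 𝕜 (Fock S B)) := fun i j =>
  LinearMap.ext fun w => X_comm S i j w

/-- The enumeration of the range of `f` in increasing order of the arguments. -/
def enum (f : α → ι) : List ι := ((univ : Finset α).sort (· ≤ ·)).map f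

theorem mem_enum {f : α → ι} {i : ι} : i ∈ enum f ↔ ∃ a, f a = i := by simp [enum]

theorem enum_nodup {f : α → ι} (hf : Function.Injective f) : (enum f).Nodup :=
  (Finset.sort_nodup _ _).map hf

theorem oprod_comp {T : Type*} [Semiring T] (y : ι → T) (f : α → ι) :
    oprod (fun i => y (f i)) = ((enum f).map y).prod := by
  rw [enum, List.map_map]; rfl

theorem X_commute_lm (j : ι) (b : B) :
    (X S j : Module.End 𝕜 (Fock S B)) * lm S b = lm S b * X S j :=
  LinearMap.ext fun w => X_lm S j b w

theorem list_X_lm (l : List ι) (b : B) (w : Fock S B) :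
    (l.map (X S)).prod (lm S b w) = lm S b ((l.map (X S)).prod w) := by
  induction l with
  | nil => simp
  | cons a l ih => rw [List.map_cons, List.prod_cons, Module.End.mul_apply, ih, X_lm]; rfl

theorem oprod_X_lm {f : α → ι} (hfer : ∀ a, S.fer (f a)) {c : 𝕜}
    (hc : ∀ a b, a < b → S.ε (f b) (f a) = c) (a : Matrix α α B) :
    oprod (fun i => ∑ b, (X S (f b) * lm S (a b i) : Module.End 𝕜 (Fock S B))) =
      ((enum f).map (X S)).prod * lm S (cdet c a) := by
  have h3 := oprod_sum_mul (y := fun i => (X S (f i) : Module.End 𝕜 (Fock S B))) (c := c)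
    (a := a.map (lm S))
    (fun a b hab => by rw [← hc a b hab]; exact X_skewComm (f b) (f a)) (fun g hg => by
      rw [oprod_comp (X S) fun i => f (g i)]
      refine X_skewComm.list_eq_zero (fun j hj => ?_) fun h => hg fun a b hab => ?_
      · obtain ⟨a, rfl⟩ := mem_enum.1 hj
        exact hfer _
      · exact (List.nodup_map_iff_inj_on (Finset.sort_nodup _ _)).1 h a (by simp) b (by simp)
          (by rw [hab]))
    (fun i j k => (X_commute_lm _ _).symm)
  rwa [← map_cdet, oprod_comp (X S) f] at h3

/-- Expansion of a product of transformed fermionic variables. -/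
theorem list_phi_sub_mem {P : Matrix ι ι B} {f : α → ι} (hf : Function.Injective f)
    (hfer : ∀ a, S.fer (f a)) {c : 𝕜} (hc : ∀ a b, a < b → S.ε (f b) (f a) = c)
    {V : Submodule 𝕜 (Fock S B)} (hVX : ∀ j, ∀ w ∈ V, X S j w ∈ V)
    (hVl : ∀ b, ∀ w ∈ V, lm S b w ∈ V) {v : Fock S B}
    (hv : ∀ j, (∀ a, f a ≠ j) → X S j v ∈ V) :
    ((enum f).map (phi S P)).prod v -
      ((enum f).map (X S)).prod (lm S (cdet c (P.submatrix f f)) v) ∈ V := by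
  classical
  -- `ψ j` keeps the terms of y_j whose variable lies in the range of `f`; the discarded variables
  -- send `v` into `V`.
  set ψ : ι → Module.End 𝕜 (Fock S B) := fun j => ∑ a : α, X S (f a) * lm S (P (f a) j) with hψ
  have hφψ : ∀ j w, (∀ i, (∀ a, f a ≠ i) → X S i w ∈ V) → phi S P j w - ψ j w ∈ V := by
    intro j w hw
    have h1 : phi S P j w - ψ j w =
        ∑ b ∈ univ.filter (fun b => ¬ ∃ a, f a = b), X S b (lm S (P b j) w) := by
      rw [sub_eq_iff_eq_add, phi_apply, ← Finset.sum_filter_not_add_sum_filter _ fun b => ∃ a, f a = b]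
      congr 1
      rw [hψ, LinearMap.sum_apply]
      have : univ.filter (fun b => ∃ a, f a = b) = univ.map ⟨f, hf⟩ := by ext; simp
      rw [this, Finset.sum_map]; rfl
    rw [h1]
    refine Submodule.sum_mem _ fun b hb => ?_
    rw [X_lm]
    exact hVl _ _ (hw b (by simpa using hb))
  have hψU : ∀ j w, (∀ i, (∀ a, f a ≠ i) → X S i w ∈ V) →
      ∀ i, (∀ a, f a ≠ i) → X S i (ψ j w) ∈ V := by
    intro j w hw i hi
    rw [hψ, LinearMap.sum_apply, map_sum]
    refine Submodule.sum_mem _ fun a _ => ?_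
    rw [Module.End.mul_apply, X_comm, X_lm]
    exact V.smul_mem _ (hVX _ _ (hVl _ _ (hw i hi)))
  have hφV : ∀ j w, w ∈ V → phi S P j w ∈ V := fun j w hw => by
    rw [phi_apply]; exact Submodule.sum_mem _ fun b _ => hVX _ _ (hVl _ _ hw)
  -- The second conjunct is carried along so that the next factor may be truncated as well.
  have key : ∀ l : List ι, ((l.map (phi S P)).prod v - (l.map ψ).prod v ∈ V) ∧
      ∀ i, (∀ a, f a ≠ i) → X S i ((l.map ψ).prod v) ∈ V := by
    intro l
    induction l with
    | nil => exact ⟨by simp, hv⟩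
    | cons j l ih =>
      simp only [List.map_cons, List.prod_cons, Module.End.mul_apply]
      refine ⟨?_, hψU j _ ih.2⟩
      have := V.add_mem (hφV j _ ih.1) (hφψ j _ ih.2)
      rwa [map_sub, sub_add_sub_cancel] at this
  have h2 : ((enum f).map ψ).prod =
      ((enum f).map (X S)).prod * lm S (cdet c (P.submatrix f f)) := by
    rw [← oprod_X_lm hfer hc]
    exact (oprod_comp ψ f).symm
  rw [← Module.End.mul_apply, ← h2]
  exact (key _).1

/-- Dividing by one variable of the list enlarges the ideal by that variable; after the whole list,
`e` still avoids every generator. -/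
theorem apply_eq_zero_of_list_X_mem {A : Finset ι} {l : List ι} (hl : l.Nodup)
    (hlA : ∀ i ∈ l, i ∉ A) {w : Fock S B} (hw : (l.map (X S)).prod w ∈ involving S B A)
    {e : S.State} (he : ∀ b ∈ A, e b = 0) (hel : ∀ b ∈ l, e b = 0) : w e = 0 := by
  induction l generalizing A with
  | nil => exact hw e he
  | cons a l ih =>
    rw [List.nodup_cons] at hl
    refine ih hl.2 (A := insert a A) (fun i hi => ?_) (fun e he => ?_) (fun b hb => ?_)
      (fun b hb => hel b (List.mem_cons_of_mem _ hb))
    · rw [Finset.mem_insert, not_or]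
      exact ⟨fun h => hl.1 (h ▸ hi), hlA i (List.mem_cons_of_mem _ hi)⟩
    · exact mem_involving_of_X_mem (hlA a List.mem_cons_self) hw
        (fun b hb => he b (Finset.mem_insert_of_mem hb))
        fun _ => he a (Finset.mem_insert_self _ _)
    · rcases Finset.mem_insert.1 hb with rfl | hb
      · exact hel _ List.mem_cons_self
      · exact he b hb

theorem lm_vacuum (b c : B) : lm S b (vacuum S c) = vacuum S (b * c) := lm_single S b _ c

theorem X_mem_involving_of_mem {A : Finset ι} (j : ι) {w : Fock S B}
    (hw : w ∈ involving S B A) : X S j w ∈ involving S B A := fun e he => by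
  rw [X_apply]
  split_ifs with h
  · rfl
  · rw [hw, smul_zero]
    exact fun b hb => by rw [down_apply, he b hb, Nat.zero_sub]

theorem lm_mem_involving {A : Finset ι} (b : B) {w : Fock S B}
    (hw : w ∈ involving S B A) : lm S b w ∈ involving S B A := fun e he => by
  rw [lm_apply, hw e he, mul_zero]

/-- The determinant depends only on the set of indices, not on their enumeration. -/
theorem cdet_submatrix_eq {P : Matrix ι ι B} (hP : PM S P) {β : Type*} [Fintype β] [LinearOrder β]
    {f : α → ι} {g : β → ι} (hf : Function.Injective f) (hg : Function.Injective g)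
    (hfg : ∀ i, (∃ a, f a = i) ↔ ∃ b, g b = i) (hfer : ∀ a, S.fer (f a)) {c d : 𝕜}
    (hc : ∀ a b, a < b → S.ε (f b) (f a) = c) (hd : ∀ a b, a < b → S.ε (g b) (g a) = d) :
    cdet c (P.submatrix f f) = cdet d (P.submatrix g g) := by
  classical
  set A : Finset ι := univ.filter fun i => ∀ a, f a ≠ i
  have hferg : ∀ b, S.fer (g b) := fun b => by
    obtain ⟨a, ha⟩ := (hfg (g b)).2 ⟨b, rfl⟩
    rw [← ha]; exact hfer a
  have h1 := list_phi_sub_mem (P := P) hf hfer hc (V := involving S B A)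
    (fun j w hw => X_mem_involving_of_mem j hw) (fun b w hw => lm_mem_involving b hw)
    (v := vacuum S 1) (fun j hj => X_mem_involving (by simpa [A] using hj) _)
  have h2 := list_phi_sub_mem (P := P) hg hferg hd (V := involving S B A)
    (fun j w hw => X_mem_involving_of_mem j hw) (fun b w hw => lm_mem_involving b hw)
    (v := vacuum S 1) (fun j hj => X_mem_involving (by
      simp only [A, Finset.mem_filter, Finset.mem_univ, true_and]
      intro a ha
      obtain ⟨b, hb⟩ := (hfg j).1 ⟨a, ha⟩
      exact hj b hb) _)
  have hperm : (enum g).Perm (enum f) := by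
    rw [List.perm_ext_iff_of_nodup (enum_nodup hg) (enum_nodup hf)]
    intro i; rw [mem_enum, mem_enum, hfg]
  -- Reordering the y's costs the same nonzero scalar as reordering the x's, so the two expansions
  -- can be compared.
  obtain ⟨s, hs, h⟩ := exists_scalar_of_perm (S := S) (T := Module.End 𝕜 (Fock S B)) hperm
  rw [h _ X_skewComm, h _ (phi_skewComm hP), LinearMap.smul_apply, LinearMap.smul_apply,
    ← smul_sub, Submodule.smul_mem_iff _ hs] at h2
  have h3 := Submodule.sub_mem _ h2 h1
  rw [sub_sub_sub_cancel_left, lm_vacuum, lm_vacuum, mul_one, mul_one, ← map_sub, ← map_sub] at h3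
  have h4 := apply_eq_zero_of_list_X_mem (enum_nodup hf) (fun i hi => by
    obtain ⟨a, rfl⟩ := mem_enum.1 hi
    simp [A]) h3 (e := vac) (fun _ _ => rfl) (fun _ _ => rfl)
  rw [vacuum_apply, sub_eq_zero] at h4
  exact h4

/-- The determinant of the fermionic block is left cancellable. -/
theorem cdet_mul_eq_zero {P : Matrix ι ι B} (hP : PM S P)
    (hbij : Function.Bijective (subst S P)) {f : α → ι} (hf : Function.Injective f)
    (hfer : ∀ i, S.fer i ↔ ∃ a, f a = i) {c : 𝕜} (hc : ∀ a b, a < b → S.ε (f b) (f a) = c)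
    {b : B} (hb : cdet c (P.submatrix f f) * b = 0) : b = 0 := by
  have h1 := list_phi_sub_mem (P := P) hf (fun a => (hfer _).2 ⟨a, rfl⟩) hc
    (V := involving S B (bosons S))
    (fun j w hw => X_mem_involving_of_mem j hw) (fun b w hw => lm_mem_involving b hw)
    (v := vacuum S b) (fun j hj => X_mem_involving (mem_bosons.2 fun h => by
      obtain ⟨a, ha⟩ := (hfer j).1 h
      exact hj a ha) _)
  rw [lm_vacuum, hb, map_zero, map_zero, sub_zero] at h1
  exact eq_zero_of_list_mem hP hbij _ (enum_nodup hf) (fun i hi => (hfer i).2 (mem_enum.1 hi)) h1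

theorem sort_dual : ((univ : Finset αᵒᵈ).sort (· ≤ ·)).map OrderDual.ofDual =
    ((univ : Finset α).sort (· ≤ ·)).reverse := by
  have h1 : (((univ : Finset αᵒᵈ).sort (· ≤ ·)).map OrderDual.ofDual).Pairwise (· ≥ ·) := by
    rw [List.pairwise_map]
    exact (Finset.pairwise_sort (univ : Finset αᵒᵈ) (· ≤ ·)).imp fun h => h
  refine List.Perm.eq_of_pairwise' h1 (List.pairwise_reverse.2 (Finset.pairwise_sort _ _)) ?_
  rw [List.perm_ext_iff_of_nodup ((Finset.sort_nodup _ _).map OrderDual.ofDual.injective)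
    (List.nodup_reverse.2 (Finset.sort_nodup _ _))]
  intro a
  simp

theorem invCount_dual (σ : Equiv.Perm α) :
    invCount ((OrderDual.toDual.symm.trans σ).trans OrderDual.toDual : Equiv.Perm αᵒᵈ) =
      invCount σ := by
  refine Finset.card_bij' (fun a _ => (OrderDual.ofDual a.2, OrderDual.ofDual a.1))
    (fun a _ => (OrderDual.toDual a.2, OrderDual.toDual a.1)) ?_ ?_ ?_ ?_
  · rintro ⟨a, b⟩ h
    simp only [Finset.mem_filter, Finset.mem_univ, true_and] at h ⊢
    exact h
  · rintro ⟨a, b⟩ h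
    simp only [Finset.mem_filter, Finset.mem_univ, true_and] at h ⊢
    exact h
  · simp
  · simp

/-- The opposite ring reverses every product, which amounts to reversing the order of the indices.
Conjugating a permutation by the reversal preserves its number of inversions, so the weight `c` does
not change. -/
theorem unop_cdet (c : 𝕜) (P : Matrix α α Bᵐᵒᵖ) :
    MulOpposite.unop (cdet c P) = cdet c (Matrix.of fun i j : αᵒᵈ =>
      MulOpposite.unop (P (OrderDual.ofDual i) (OrderDual.ofDual j))) := by
  have h : ∀ g : α → Bᵐᵒᵖ, MulOpposite.unop (oprod g) =
      oprod fun i : αᵒᵈ => MulOpposite.unop (g (OrderDual.ofDual i)) := by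
    intro g
    rw [oprod, oprod, MulOpposite.unop_list_prod, List.map_map, ← List.map_reverse,
      ← sort_dual, List.map_map]
    rfl
  rw [cdet, cdet, Finset.unop_sum]
  refine Fintype.sum_equiv ((Equiv.permCongr OrderDual.toDual)) _ _ fun σ => ?_
  rw [MulOpposite.unop_smul, h]
  congr 2
  exact (invCount_dual σ).symm

end QuantumDeterminant

/-! ### The purely fermionic case: the substitution on the exterior algebra -/

section Exterior

open Finset Skew State SuperManin

variable {𝕜 ι : Type*} [Field 𝕜] [CharZero 𝕜] [Fintype ι] [LinearOrder ι] {S : Skew 𝕜 ι}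
variable {B : Type*} [Ring B] [Algebra 𝕜 B]

/-- The commutation factors of a subfamily. -/
def Skew.restrict {κ : Type*} (S : Skew 𝕜 ι) (f : κ → ι) : Skew 𝕜 κ where
  ε i j := S.ε (f i) (f j)
  fer i := S.fer (f i)
  mul_swap _ _ := S.mul_swap _ _
  diag_fer _ := S.diag_fer _
  diag_bos _ := S.diag_bos _

theorem PM.restrict {κ : Type*} [Fintype κ] [LinearOrder κ] {P : Matrix ι ι B} (hP : PM S P)
    (f : κ → ι) : PM (S.restrict f) (P.submatrix f f) := fun _ _ _ _ => hP _ _ _ _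

variable (S) in
/-- The state in which the variables of `A` occur once. -/
def Skew.State.ind (A : Finset ι) : S.State :=
  ⟨fun i => if i ∈ A then 1 else 0, fun i _ => by dsimp only; split_ifs <;> simp⟩

theorem ind_apply (A : Finset ι) (i : ι) : ind S A i = if i ∈ A then 1 else 0 := rfl

theorem ind_empty : ind S ∅ = vac := rfl

theorem up_ind {A : Finset ι} {a : ι} (ha : a ∉ A) (h) : up a (ind S A) h = ind S (insert a A) := by
  ext i
  by_cases hi : i = a
  · subst hi; simp [ind_apply, ha]
  · rw [up_of_ne hi]; simp [ind_apply, hi]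

theorem list_X_vacuum {l : List ι} (hl : l.Nodup) : ∃ s : 𝕜, s ≠ 0 ∧ ∀ b : B,
    (l.map (X S)).prod (vacuum S b) = s • Finsupp.single (ind S l.toFinset) b := by
  induction l with
  | nil => exact ⟨1, one_ne_zero, fun b => by simp [vacuum, ind_empty]⟩
  | cons a l ih =>
    rw [List.nodup_cons] at hl
    obtain ⟨s, hs, h⟩ := ih hl.2
    have ha : a ∉ l.toFinset := by simpa using hl.1
    refine ⟨s * S.coef a (ind S l.toFinset), mul_ne_zero hs (S.coef_ne_zero _ _), fun b => ?_⟩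
    rw [List.map_cons, List.prod_cons, Module.End.mul_apply, h, map_smul,
      X_single S a _ (fun _ => by rw [ind_apply, if_neg ha]), up_ind ha, smul_smul,
      List.toFinset_cons]

theorem subst_mem_degree {P : Matrix ι ι B} (hP : PM S P) {d : ℕ} {w : Fock S B}
    (hw : w ∈ degree S B d) : subst S P w ∈ degree S B d := by
  have h : ∀ (e : S.State) (b : B), subst S P (Finsupp.single e b) ∈ degree S B (∑ i, e i) := by
    intro e b
    induction e using State.induction with
    | h0 =>
      change subst S P (vacuum S b) ∈ _
      rw [subst_vacuum]
      simpa using vacuum_mem_degree b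
    | hup j e h ih =>
      rw [single_up, map_smul, subst_X hP, sum_up]
      exact Submodule.smul_mem _ _ (phi_mem_degree ih j)
  rw [← Finsupp.sum_single w, map_finsuppSum]
  refine Submodule.sum_mem _ fun e he => ?_
  have := h e (w e)
  rwa [show ∑ i, e i = d from by_contra fun h => Finsupp.mem_support_iff.1 he (hw e h)] at this

section Exterior

variable {P Q : Matrix ι ι B} {c : 𝕜}

theorem enum_id_toFinset : (enum (id : ι → ι)).toFinset = univ := by simp [enum]

/-- As for ordinary exterior powers, the top degree sees the determinant: with no variable outside
the enumeration, `list_phi_sub_mem` holds with V = 0 and is an equality. -/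
theorem subst_single_top (hall : ∀ i, S.fer i) (hc : ∀ a b : ι, a < b → S.ε b a = c)
    (hP : PM S P) (b : B) : subst S P (Finsupp.single (ind S univ) b) =
      Finsupp.single (ind S univ) (cdet c P * b) := by
  obtain ⟨s, hs, h⟩ := list_X_vacuum (S := S) (B := B) (enum_nodup (Function.injective_id (α := ι)))
  rw [enum_id_toFinset] at h
  have h1 := list_phi_sub_mem (P := P) (f := id) Function.injective_id hall hc (V := ⊥)
    (fun j w hw => by rw [(Submodule.mem_bot _).1 hw, map_zero]; exact Submodule.zero_mem _)
    (fun b w hw => by rw [(Submodule.mem_bot _).1 hw, map_zero]; exact Submodule.zero_mem _)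
    (v := vacuum S b) (fun j hj => absurd rfl (hj j))
  rw [Submodule.mem_bot, sub_eq_zero, lm_vacuum, h, Matrix.submatrix_id_id] at h1
  have h2 : ∀ (l : List ι) (w : Fock S B), subst S P ((l.map (X S)).prod w) =
      (l.map (phi S P)).prod (subst S P w) := by
    intro l w
    induction l with
    | nil => simp
    | cons a l ih =>
      simp only [List.map_cons, List.prod_cons, Module.End.mul_apply, subst_X hP, ih]
  have h3 := h2 (enum id) (vacuum S b)
  rw [h, subst_vacuum, h1, map_smul] at h3
  exact smul_right_injective _ hs h3

theorem eq_single_top (hall : ∀ i, S.fer i) {w : Fock S B} (hw : ∀ i, X S i w = 0) :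
    w = Finsupp.single (ind S univ) (w (ind S univ)) := by
  ext e
  by_cases he : e = ind S univ
  · subst he; simp
  · rw [Finsupp.single_eq_of_ne he]
    obtain ⟨i, hi⟩ : ∃ i, e i = 0 := by
      by_contra! h
      apply he
      ext i
      have h1 := e.2 i (hall i)
      change e i ≤ 1 at h1
      have h2 := h i
      rw [ind_apply, if_pos (mem_univ _)]
      omega
    have := congrArg (fun v : Fock S B => v (up i e fun _ => hi)) (hw i)
    simp only [X_apply_up, Finsupp.zero_apply] at this
    exact (smul_eq_zero.1 this).resolve_left (S.coef_ne_zero _ _)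

theorem X_single_top (i : ι) (hall : ∀ i, S.fer i) (b : B) :
    X S i (Finsupp.single (ind S univ) b) = 0 :=
  X_single_of_ne S i _ (fun h => by simpa [ind_apply] using h (hall i)) b

/-- The kernel is stable under the variables, and multiplying by enough of them reaches the top
degree, where injectivity is cancellability of the determinant. The set A in the induction contains
the variables which have not yet been shown to kill w. -/
theorem subst_injective (hall : ∀ i, S.fer i) (hc : ∀ a b : ι, a < b → S.ε b a = c)
    (hP : PM S P) (hD : ∀ b, cdet c P * b = 0 → b = 0) : Function.Injective (subst S P) := by
  rw [injective_iff_map_eq_zero]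
  suffices h : ∀ (A : Finset ι) (w : Fock S B), subst S P w = 0 → (∀ i ∉ A, X S i w = 0) → w = 0
    from fun w hw => h univ w hw (by simp)
  intro A
  induction A using Finset.induction_on with
  | empty =>
    intro w hw hX
    have h1 := eq_single_top hall fun i => hX i (by simp)
    rw [h1, subst_single_top hall hc hP, Finsupp.single_eq_zero] at hw
    rw [h1, hD _ hw, Finsupp.single_zero]
  | insert a A ha ih =>
    intro w hw hX
    have h1 : X S a w = 0 := by
      refine ih _ (by rw [subst_X hP, hw, map_zero]) fun i hi => ?_
      by_cases hia : i = a
      · subst hia; exact LinearMap.congr_fun (X_skewComm.mul_self (hall i)) w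
      · rw [X_comm, hX i (by simp [hi, hia]), map_zero, smul_zero]
    refine ih w hw fun i hi => ?_
    by_cases hia : i = a
    · rw [hia, h1]
    · exact hX i (by simp [hi, hia])

/-- The substitution preserves degrees, so the top coefficient of any image is the determinant times
some element; surjectivity makes 1 such a coefficient. -/
theorem exists_cdet_mul_eq_one (hall : ∀ i, S.fer i) (hc : ∀ a b : ι, a < b → S.ε b a = c)
    (hP : PM S P) (h : P * Q = 1) : ∃ b, cdet c P * b = 1 := by
  have h1 : ∀ w : Fock S B, ∃ b, subst S P w (ind S univ) = cdet c P * b := by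
    intro w
    induction w using Finsupp.induction_linear with
    | zero => exact ⟨0, by simp⟩
    | add f g hf hg =>
      obtain ⟨a, ha⟩ := hf
      obtain ⟨b, hb⟩ := hg
      exact ⟨a + b, by rw [map_add, Finsupp.add_apply, ha, hb, mul_add]⟩
    | single e b =>
      by_cases he : e = ind S univ
      · subst he
        exact ⟨b, by rw [subst_single_top hall hc hP, Finsupp.single_eq_same]⟩
      · refine ⟨0, ?_⟩
        rw [mul_zero]
        refine subst_mem_degree hP (d := ∑ i, e i) (fun e' he' => ?_) _ fun h => he ?_
        · exact Finsupp.single_eq_of_ne fun h => he' (by rw [h])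
        · ext i
          have h2 : ∀ i ∈ univ, e i ≤ ind S univ i := fun i _ => by
            simpa [ind_apply] using e.2 i (hall i)
          exact (Finset.sum_eq_sum_iff_of_le h2).1 h.symm i (mem_univ i)
  obtain ⟨w, hw⟩ := subst_surjective hP h (Finsupp.single (ind S univ) 1)
  obtain ⟨b, hb⟩ := h1 w
  exact ⟨b, by rw [← hb, hw, Finsupp.single_eq_same]⟩

theorem isUnit_cdet (hall : ∀ i, S.fer i) (hc : ∀ a b : ι, a < b → S.ε b a = c)
    (hP : PM S P) (h : P * Q = 1) (hD : ∀ b, cdet c P * b = 0 → b = 0) : IsUnit (cdet c P) := by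
  obtain ⟨e, he⟩ := exists_cdet_mul_eq_one hall hc hP h
  refine ⟨⟨_, e, he, ?_⟩, rfl⟩
  rw [← sub_eq_zero]
  apply hD
  rw [mul_sub, ← mul_assoc, he, one_mul, mul_one, sub_self]

/-- On the vacuum left and right multiplication by x_b agree, and the right one passes through y_j.
-/
theorem phi_X_vacuum (j b : ι) (h : B) : phi S P j (X S b (vacuum S h)) =
    Xr S b (phi S P j (vacuum S h)) := by
  rw [Xr_phi, Xr_apply]
  congr 2
  rw [twist, vacuum, Finsupp.lsingle_apply, Finsupp.lsum_single]
  simp [Skew.tw]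

theorem X_X_vacuum_apply {C : ι → ι → B} {j l : ι} (hjl : j ≠ l)
    (hC : ∑ j, ∑ l, X S j (X S l (vacuum S (C j l))) = 0) :
    C j l = -(S.ε l j • C l j) := by
  have hw : ∀ j l, (∑ l', X S l' (vacuum S (C j l'))) (unit S l) = C j l := by
    intro j l
    simp [Finsupp.finsetSum_apply, X_apply_unit, vacuum_apply]
  have hj : unit S l j = 0 := unit_apply_of_ne hjl
  have hl : unit S j l = 0 := unit_apply_of_ne hjl.symm
  have he : up j (unit S l) (fun _ => hj) = up l (unit S j) fun _ => hl := by
    ext i; simp only [unit, up_apply, vac_apply]; omega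
  have h1 : ∑ i, X S i (∑ l', X S l' (vacuum S (C i l'))) (up j (unit S l) fun _ => hj) = 0 := by
    simp only [map_sum, ← Finsupp.finsetSum_apply, hC, Finsupp.zero_apply]
  rw [Finset.sum_eq_add j l hjl (fun i _ hi => ?_) (by simp) (by simp), X_apply_up, hw, he,
    X_apply_up, hw] at h1
  · have hcoef : ∀ a b : ι, S.coef a (unit S b) = if b < a then S.ε a b else 1 := by
      intro a b
      rw [unit, up_val, S.coef_add, coef_vac, mul_one]
    rw [hcoef, hcoef] at h1
    rcases lt_or_gt_of_ne hjl with h | h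
    · rw [if_neg h.not_gt, if_pos h, one_smul] at h1
      exact eq_neg_of_add_eq_zero_left h1
    · rw [if_neg h.not_gt, if_pos h, one_smul] at h1
      rw [← eq_neg_of_add_eq_zero_right h1 |>.symm, smul_neg, smul_smul, S.mul_swap, one_smul,
        neg_neg]
  · rw [X_apply, if_pos]
    rw [up_of_ne hi.1, unit_apply_of_ne hi.2]

/-- Expressing x_a x_b through the y's puts the products Q_lb Q_ja as coefficients. The skew
commutativity of the x's, pulled back along the injective substitution, gives a vanishing quadratic
expression in the x's, whose coefficients must be antisymmetric. -/
theorem qm_of_inverse (hall : ∀ i, S.fer i) (hP : PM S P) (h : P * Q = 1)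
    (hinj : Function.Injective (subst S P)) : QM S Q := by
  intro j l a b
  by_cases hjl : j = l
  · subst hjl
    rw [S.diag_fer _ (hall _)]; simp
  refine X_X_vacuum_apply (S := S)
    (C := fun j l => Q l b * Q j a - S.ε a b • (Q l a * Q j b)) hjl (hinj ?_)
  have key : ∀ a b, ∑ j, ∑ l, phi S P j (phi S P l (vacuum S (Q l b * Q j a))) =
      X S a (X S b (vacuum S 1)) := by
    intro a b
    have h1 : ∀ j, ∑ l, phi S P j (phi S P l (vacuum S (Q l b * Q j a))) =
        Xr S b (phi S P j (lm S (Q j a) (vacuum S 1))) := by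
      intro j
      rw [← map_sum, lm_vacuum, mul_one, ← phi_X_vacuum, ← sum_phi_lm h b]
      simp only [lm_vacuum]
    simp only [h1]
    rw [← map_sum, sum_phi_lm h, Xr_X, Xr_apply]
    congr 2
    rw [twist, vacuum, Finsupp.lsingle_apply, Finsupp.lsum_single]
    simp [Skew.tw]
  rw [map_zero]
  simp only [map_sum, subst_X hP, subst_vacuum, map_sub, map_smul, Finset.sum_sub_distrib, key,
    ← Finset.smul_sum]
  rw [X_comm, sub_eq_zero]

/-- Duality between degrees 1 and n - 1: a vector w of degree n - 1 amounts to the family h_a of top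
coefficients of the x_a w, and the top coefficient of y_j w is then ∑_a P_aj h_a. Since the
substitution carries x_j v to y_j times the image of v, its bijectivity and the invertible
determinant in top degree make this transposed system uniquely solvable. -/
theorem isUnit_transpose (hall : ∀ i, S.fer i) (hc : ∀ a b : ι, a < b → S.ε b a = c)
    (hP : PM S P) (hD : IsUnit (cdet c P)) (hbij : Function.Bijective (subst S P)) :
    IsUnit P.transpose := by
  obtain ⟨D, hDe⟩ := hD
  have hlift : ∀ h : ι → B, ∃ w ∈ degree S B (Fintype.card ι - 1),
      ∀ a, X S a w = Finsupp.single (ind S univ) (h a) := by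
    intro h
    have h1 : ∀ b : ι, ∑ i, down b (ind S univ) i = Fintype.card ι - 1 := by
      intro b
      have h2 := sum_up b (down b (ind S univ)) (down_ok (by simp [ind_apply]))
      rw [up_down _ _ (by simp [ind_apply])] at h2
      simp only [ind_apply, mem_univ, if_true, Finset.sum_const, Finset.card_univ,
        smul_eq_mul, mul_one] at h2
      omega
    refine ⟨∑ b, (S.coef b (down b (ind S univ)))⁻¹ •
      Finsupp.single (down b (ind S univ)) (h b), Submodule.sum_mem _ fun b _ =>
        Submodule.smul_mem _ _ fun e he => Finsupp.single_eq_of_ne fun h => he (by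
          rw [h, h1]), fun a => ?_⟩
    rw [map_sum, Finset.sum_eq_single a]
    · rw [map_smul, X_single S a _ (down_ok (by simp [ind_apply])),
        up_down _ _ (by simp [ind_apply]), smul_smul, inv_mul_cancel₀ (S.coef_ne_zero _ _),
        one_smul]
    · intro b _ hba
      rw [map_smul, X_single_of_ne, smul_zero]
      intro h
      have := h (hall a)
      rw [down_of_ne hba.symm] at this
      simp [ind_apply] at this
    · simp
  have htop : ∀ (w : Fock S B) (g : ι → B), (∀ a, X S a w = Finsupp.single (ind S univ) (g a)) →
      ∀ j, phi S P j w = Finsupp.single (ind S univ) (∑ a, P a j * g a) := by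
    intro w g hw j
    rw [phi_apply, Finsupp.single_finsetSum]
    exact Finset.sum_congr rfl fun a _ => by rw [X_lm, hw, lm_single]
  have hinj : ∀ h : ι → B, (∀ j, ∑ a, P a j * h a = 0) → ∀ a, h a = 0 := by
    intro h hh a
    obtain ⟨w, -, hw⟩ := hlift h
    obtain ⟨v, rfl⟩ := hbij.2 w
    have h1 : ∀ j, X S j v = 0 := fun j => hbij.1 (by
      rw [subst_X hP, htop _ h hw, hh, Finsupp.single_zero, map_zero])
    rw [eq_single_top hall h1, subst_single_top hall hc hP] at hw
    have := hw a
    rw [X_single_top a hall] at this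
    exact Finsupp.single_eq_zero.1 this.symm
  have hsurj : ∀ g : ι → B, ∃ h : ι → B, ∀ j, ∑ a, P a j * h a = g j := by
    intro g
    obtain ⟨v, hv, hvX⟩ := hlift fun b => ↑D⁻¹ * g b
    have h1 := subst_mem_degree hP hv
    refine ⟨fun a => X S a (subst S P v) (ind S univ), fun j => ?_⟩
    have h2 : ∀ a, X S a (subst S P v) =
        Finsupp.single (ind S univ) (X S a (subst S P v) (ind S univ)) := by
      intro a
      refine eq_single_top hall fun i => ?_
      have h3 := X_mem_degree (X_mem_degree h1 a) i
      ext e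
      refine h3 e (ne_of_lt ?_)
      calc ∑ i, e i ≤ ∑ i : ι, 1 := Finset.sum_le_sum fun i _ => e.2 i (hall i)
        _ = Fintype.card ι := by simp
        _ < _ := by omega
    have h3 := htop _ _ h2 j
    rw [← subst_X hP, hvX, subst_single_top hall hc hP, ← mul_assoc, ← hDe, Units.mul_inv,
      one_mul] at h3
    exact (Finsupp.single_injective _ h3).symm
  choose Z hZ using fun k => hsurj (Pi.single k 1)
  have h1 : P.transpose * Matrix.of (fun a k => Z k a) = 1 := by
    ext j k
    rw [Matrix.mul_apply, Matrix.one_apply]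
    exact (hZ k j).trans (by simp [Pi.single_apply])
  refine ⟨⟨_, _, h1, ?_⟩, rfl⟩
  rw [← sub_eq_zero]
  ext f b
  refine hinj (fun f => (Matrix.of (fun a k => Z k a) * P.transpose - 1 : Matrix ι ι B) f b)
    (fun a => ?_) f
  have h2 : P.transpose * (Matrix.of (fun a k => Z k a) * P.transpose - 1) = 0 := by
    rw [mul_sub, ← mul_assoc, h1, one_mul, mul_one, sub_self]
  exact congrFun (congrFun h2 a) b

end Exterior

end Exterior

/-! ### Schur complements, complementary minors and a mixed expansion -/

section Minors

open Finset Skew State SuperManin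

variable {𝕜 ι : Type*} [Field 𝕜] [CharZero 𝕜] [Fintype ι] [LinearOrder ι] {S : Skew 𝕜 ι}
variable {B : Type*} [Ring B] [Algebra 𝕜 B]
variable {α β : Type*} [Fintype α] [LinearOrder α] [Fintype β] [LinearOrder β]

theorem list_X_mem_zero {A : Finset ι} (hA : ∀ i ∈ A, S.fer i) {l : List ι} (hl : ∀ i ∈ A, i ∈ l)
    {w : Fock S B} (hw : w ∈ involving S B A) : (l.map (X S)).prod w = 0 := by
  suffices h : involving S B A ≤ LinearMap.ker ((l.map (X S)).prod : Module.End 𝕜 (Fock S B))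
    from h hw
  rw [involving_eq]
  refine iSup₂_le fun a ha => ?_
  rintro _ ⟨u, rfl⟩
  rw [LinearMap.mem_ker]
  exact LinearMap.congr_fun (X_skewComm.list_mul_eq_zero (hA a ha) (hl a ha)) u

theorem sum_eq_add_of_compl {M : Type*} [AddCommMonoid M] {f : α → ι} {g : β → ι}
    (hf : Function.Injective f) (hg : Function.Injective g)
    (hfg : ∀ i, (∃ a, f a = i) ↔ ¬ ∃ b, g b = i) (F : ι → M) :
    ∑ i, F i = ∑ a, F (f a) + ∑ b, F (g b) := by
  have hbij : Function.Bijective (Sum.elim f g) := by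
    refine ⟨hf.sumElim hg fun a b h => (hfg (f a)).1 ⟨a, rfl⟩ ⟨b, h.symm⟩, fun i => ?_⟩
    by_cases h : ∃ b, g b = i
    · obtain ⟨b, hb⟩ := h
      exact ⟨Sum.inr b, hb⟩
    · obtain ⟨a, ha⟩ := (hfg i).2 h
      exact ⟨Sum.inl a, ha⟩
  rw [← hbij.sum_comp, Fintype.sum_sum_type]
  rfl

theorem enum_append_perm {f : α → ι} {g : β → ι} (hf : Function.Injective f)
    (hg : Function.Injective g) (hfg : ∀ i, (∃ a, f a = i) ↔ ¬ ∃ b, g b = i) :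
    (enum f ++ enum g).Perm (enum (id : ι → ι)) := by
  rw [List.perm_ext_iff_of_nodup ((enum_nodup hf).append (enum_nodup hg) ?_)
    (enum_nodup Function.injective_id)]
  · intro i
    simp only [List.mem_append, mem_enum, hfg]
    exact ⟨fun _ => ⟨i, rfl⟩, fun _ => em' _⟩
  · intro i hi hi'
    exact (hfg i).1 (mem_enum.1 hi) (mem_enum.1 hi')

theorem single_top_injective {l : List ι} (hl : l.Nodup) {b b' : B}
    (h : (l.map (X S)).prod (vacuum S b) = (l.map (X S)).prod (vacuum S b')) : b = b' := by
  obtain ⟨s, hs, h1⟩ := list_X_vacuum (S := S) (B := B) hl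
  rw [h1, h1] at h
  exact Finsupp.single_injective _ (smul_right_injective _ hs h)

/-- The quantum determinant of the odd-odd block factors through the Schur complement. -/
theorem cdet_eq_schur {P : Matrix ι ι B} (hP : PM S P) (hall : ∀ i, S.fer i)
    {f : α → ι} {g : β → ι} (hf : Function.Injective f) (hg : Function.Injective g)
    (hfg : ∀ i, (∃ a, f a = i) ↔ ¬ ∃ b, g b = i) {c cf cg : 𝕜}
    (hc : ∀ a b : ι, a < b → S.ε b a = c)
    (hcf : ∀ a b, a < b → S.ε (f b) (f a) = cf) (hcg : ∀ a b, a < b → S.ε (g b) (g a) = cg)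
    {C : α → β → B} (hC : ∀ i k, P (g k) (f i) = ∑ k', C i k' * P (g k) (g k')) :
    cdet c P = cdet cf (Matrix.of fun a i => P (f a) (f i) - ∑ k, C i k * P (f a) (g k)) *
      cdet cg (P.submatrix g g) := by
  classical
  set A : Finset ι := univ.filter fun i => ∃ a, f a = i with hA
  have hAf : ∀ a, f a ∈ A := fun a => by simp [A]
  have hAl : ∀ i ∈ A, i ∈ enum f := fun i hi => by simpa [A, mem_enum] using hi
  set S1 : Matrix α α B := Matrix.of fun a i => P (f a) (f i) - ∑ k, C i k * P (f a) (g k)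
  -- Block elimination: by `hC`, the combination `Z i` contains only the variables in the range of
  -- `f`, with the Schur complement as coefficients.
  set Z : α → Module.End 𝕜 (Fock S B) := fun i =>
    phi S P (f i) - ∑ k, lm S (C i k) * phi S P (g k) with hZ
  set u : Fock S B := ((enum g).map (phi S P)).prod (vacuum S 1) with hu
  have hZX : Z = fun i => ∑ a, X S (f a) * lm S (S1 a i) := by
    funext i
    refine LinearMap.ext fun w => ?_
    have h1 : Z i w = ∑ b, X S b (lm S (P b (f i) - ∑ k, C i k * P b (g k)) w) := by
      simp only [hZ, LinearMap.sub_apply, LinearMap.sum_apply, Module.End.mul_apply, phi_apply,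
        map_sub, map_sum, map_mul, Finset.sum_sub_distrib, X_lm]
      rw [Finset.sum_comm]
    rw [h1, sum_eq_add_of_compl hf hg hfg, LinearMap.sum_apply]
    have h2 : ∀ b, P (g b) (f i) - ∑ k, C i k * P (g b) (g k) = 0 := fun b => by
      rw [hC, sub_self]
    simp only [h2, map_zero, LinearMap.zero_apply, Finset.sum_const_zero, add_zero]
    rfl
  -- The subtracted terms contain a factor y_g which occurs again in `u`, so they vanish.
  have hZl : ∀ l : List α, (l.map Z).prod u = ((l.map f ++ enum g).map (phi S P)).prod
      (vacuum S 1) := by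
    intro l
    induction l with
    | nil => rfl
    | cons i l ih =>
      rw [List.map_cons, List.prod_cons, Module.End.mul_apply, ih, hZ, LinearMap.sub_apply,
        LinearMap.sum_apply, Finset.sum_eq_zero, sub_zero]
      · simp
      · intro k _
        rw [Module.End.mul_apply, ← Module.End.mul_apply (phi S P (g k)),
          (phi_skewComm hP).mul_list_eq_zero (hall _), LinearMap.zero_apply, map_zero]
        exact List.mem_append_right _ (mem_enum.2 ⟨k, rfl⟩)
  have h1 : ((enum f).map (X S)).prod (lm S (cdet cf S1) u) =
      ((enum f ++ enum g).map (phi S P)).prod (vacuum S 1) := by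
    have h2 := oprod_X_lm (S := S) (fun a => hall _) hcf S1
    rw [← Module.End.mul_apply, ← h2, ← hZX]
    exact hZl _
  have h2 := list_phi_sub_mem (P := P) hg (fun b => hall _) hcg (V := involving S B A)
    (fun j w hw => X_mem_involving_of_mem j hw) (fun b w hw => lm_mem_involving b hw)
    (v := vacuum S 1) (fun j hj => X_mem_involving (by
      have := (hfg j).2 (by simpa using hj)
      simpa [A] using this) _)
  -- `u` is the product of the x_g times its minor, up to terms containing some x_f; multiplication
  -- by all x_f removes these.
  have h3 := list_X_mem_zero (fun i _ => hall i) hAl (lm_mem_involving (cdet cf S1) h2)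
  rw [map_sub, map_sub, sub_eq_zero, h1] at h3
  obtain ⟨s, hs, hperm⟩ := exists_scalar_of_perm (S := S) (T := Module.End 𝕜 (Fock S B))
    (enum_append_perm hf hg hfg)
  have h4 := list_phi_sub_mem (P := P) (f := id) Function.injective_id hall hc (V := ⊥)
    (fun j w hw => by rw [(Submodule.mem_bot _).1 hw, map_zero]; exact Submodule.zero_mem _)
    (fun b w hw => by rw [(Submodule.mem_bot _).1 hw, map_zero]; exact Submodule.zero_mem _)
    (v := vacuum S 1) (fun j hj => absurd rfl (hj j))
  rw [Submodule.mem_bot, sub_eq_zero, Matrix.submatrix_id_id] at h4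
  rw [hperm _ (phi_skewComm hP), LinearMap.smul_apply, h4, ← LinearMap.smul_apply,
    ← hperm _ X_skewComm, ← list_X_lm, List.map_append, List.prod_append, Module.End.mul_apply, lm_vacuum, lm_vacuum, lm_vacuum, mul_one, mul_one] at h3
  refine single_top_injective (S := S) (l := enum f ++ enum g) ((enum_append_perm hf hg hfg).nodup_iff.2
    (enum_nodup Function.injective_id)) ?_
  rw [List.map_append, List.prod_append]
  exact h3

variable (S B) in
/-- Left multiplication of the values of a linear map. -/
abbrev lmHom : B →ₐ[𝕜] Module.End 𝕜 (B →ₗ[𝕜] Fock S B) :=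
  Algebra.lsmul 𝕜 𝕜 (B →ₗ[𝕜] Fock S B)

theorem lmHom_apply (b : B) (G : B →ₗ[𝕜] Fock S B) (h : B) : lmHom S B b G h = lm S b (G h) := rfl

theorem xi_lmHom (Q : Matrix ι ι B) (a : ι) (b : B) :
    lmHom S B b * xi S Q a = xi S Q a * lmHom S B b := by
  refine LinearMap.ext fun G => LinearMap.ext fun h => ?_
  simp only [Module.End.mul_apply, lmHom_apply, xi_apply, map_sum, X_lm]

theorem unsubst_list_X {Q : Matrix ι ι B} (hQ : QM S Q) (l : List ι) (h : B) :
    unsubst S Q ((l.map (X S)).prod (vacuum S h)) = (l.map (xi S Q)).prod (vacuum S) h := by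
  induction l generalizing h with
  | nil => exact lift_vac h
  | cons a l ih =>
    rw [List.map_cons, List.prod_cons, Module.End.mul_apply, lift_xi_X hQ, List.map_cons,
      List.prod_cons, Module.End.mul_apply, xi_apply]
    simp only [← list_X_lm, lm_vacuum, ih]

theorem unsubst_list_phi {P Q : Matrix ι ι B} (hQ : QM S Q) (h : Q * P = 1) (l : List ι)
    (w : Fock S B) :
    unsubst S Q ((l.map (phi S P)).prod w) = (l.map (X S)).prod (unsubst S Q w) := by
  induction l with
  | nil => rfl
  | cons a l ih =>
    simp only [List.map_cons, List.prod_cons, Module.End.mul_apply, unsubst_phi hQ h, ih]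

/-- Jacobi's theorem for the quantum determinant of an invertible matrix of fermionic type. -/
theorem cdet_eq_minor_mul {P Q : Matrix ι ι B} (hP : PM S P) (hall : ∀ i, S.fer i)
    (hPQ : P * Q = 1) (hQP : Q * P = 1)
    {f : α → ι} {g : β → ι} (hf : Function.Injective f) (hg : Function.Injective g)
    (hfg : ∀ i, (∃ a, f a = i) ↔ ¬ ∃ b, g b = i) {c cf cg : 𝕜}
    (hc : ∀ a b : ι, a < b → S.ε b a = c)
    (hcf : ∀ a b, a < b → S.ε (f b) (f a) = cf) (hcg : ∀ a b, a < b → S.ε (g b) (g a) = cg)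
    (hD : ∀ b, cdet c P * b = 0 → b = 0) {Y : Matrix α α B} (hY : P.submatrix f f * Y = 1)
    {L : Matrix β β B} (hL : ∀ l j, ∑ b, L l b * Q (g j) (g b) = if l = j then 1 else 0) :
    cdet c P = cdet cf (P.submatrix f f) * cdet cg L.transpose := by
  classical
  set A : Finset ι := univ.filter fun i => ∃ a, f a = i with hA
  have hAf : ∀ a, f a ∈ A := fun a => by simp [A]
  have hAl : ∀ i ∈ A, i ∈ enum f := fun i hi => by simpa [A, mem_enum] using hi
  obtain ⟨D, hDu⟩ := isUnit_cdet hall hc hP hPQ hD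
  have hinj := subst_injective hall hc hP hD
  have hQ := qm_of_inverse hall hP hPQ hinj
  obtain ⟨e, he⟩ := exists_cdet_mul_eq_one (S := S.restrict f) (fun _ => hall _) hcf
    (hP.restrict f) hY
  set z := cdet cg L.transpose with hz
  -- Since L inverts the transposed block of Q from the left, `Z l` behaves like multiplication by
  -- x_{g l} up to terms containing some x_f.
  set Z : β → Module.End 𝕜 (B →ₗ[𝕜] Fock S B) := fun l =>
    ∑ b, xi S Q (g b) * lmHom S B (L l b) with hZ
  have hZprod : oprod Z = ((enum g).map (xi S Q)).prod * lmHom S B z := by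
    have h3 := oprod_sum_mul (y := fun i => xi S Q (g i)) (c := cg)
      (a := L.transpose.map (lmHom S B))
      (fun a b hab => by rw [← hcg a b hab]; exact xi_skewComm hQ (g b) (g a)) (fun k hk => by
        rw [oprod_comp (xi S Q) fun i => g (k i)]
        refine (xi_skewComm hQ).list_eq_zero (fun j _ => hall j) fun h => hk fun a b hab => ?_
        exact (List.nodup_map_iff_inj_on (Finset.sort_nodup _ _)).1 h a (by simp) b (by simp)
            (by rw [hab]))
      (fun i j k => xi_lmHom _ _ _)
    rw [← map_cdet, oprod_comp (xi S Q) g] at h3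
    exact h3
  have hmod : ∀ (l : List β) (h : B), (l.map Z).prod (vacuum S) h -
      ((l.map g).map (X S)).prod (vacuum S h) ∈ involving S B A := by
    intro l
    induction l with
    | nil => intro h; simp
    | cons i l ih =>
      intro h
      set G := (l.map Z).prod (vacuum S)
      have h1 : (((i :: l).map g).map (X S)).prod (vacuum S h) =
          ∑ b, ∑ j, X S (g j) (lm S (L i b)
            (((l.map g).map (X S)).prod (vacuum S (Q (g j) (g b) * h)))) := by
        rw [Finset.sum_comm]
        simp only [← list_X_lm, lm_vacuum, ← map_sum, ← mul_assoc, ← Finset.sum_mul, hL]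
        rw [Finset.sum_eq_single i (fun j _ hj => by simp [hj.symm]) (by simp), if_pos rfl, one_mul]
        simp
      have h2 : ((i :: l).map Z).prod (vacuum S) h =
          ∑ b, ((∑ j, X S (f j) (lm S (L i b) (G (Q (f j) (g b) * h)))) +
            ∑ j, X S (g j) (lm S (L i b) (G (Q (g j) (g b) * h)))) := by
        rw [List.map_cons, List.prod_cons, Module.End.mul_apply, hZ, LinearMap.sum_apply,
          LinearMap.sum_apply]
        refine Finset.sum_congr rfl fun b _ => ?_
        rw [Module.End.mul_apply, xi_apply, sum_eq_add_of_compl hf hg hfg]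
        rfl
      rw [h1, h2, ← Finset.sum_sub_distrib]
      refine Submodule.sum_mem _ fun b _ => ?_
      rw [add_sub_assoc, ← Finset.sum_sub_distrib]
      refine Submodule.add_mem _ (Submodule.sum_mem _ fun j _ => X_mem_involving (hAf j) _)
        (Submodule.sum_mem _ fun j _ => ?_)
      rw [← map_sub, ← map_sub]
      exact X_mem_involving_of_mem _ (lm_mem_involving _ (ih _))
  -- The product of the x_g is z times its inverse substitution, modulo the x_f. Multiplying by all
  -- x_f removes the error. Inside the inverse substitution the x_f become y_f, and in the presence
  -- of all x_g their product is the product of the x_f times the minor of P.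
  have htop : ∀ h : B, ((enum f ++ enum g).map (X S)).prod (vacuum S h) =
      lm S z (unsubst S Q (((enum f ++ enum g).map (X S)).prod
        (vacuum S (cdet cf (P.submatrix f f) * h)))) := by
    intro h
    have h1 := list_X_mem_zero (fun i _ => hall i) hAl (hmod ((univ : Finset β).sort (· ≤ ·)) h)
    rw [map_sub, sub_eq_zero] at h1
    have h2 := list_phi_sub_mem (P := P) hf (fun _ => hall _) hcf (V := ⊥)
      (fun j w hw => by rw [(Submodule.mem_bot _).1 hw, map_zero]; exact Submodule.zero_mem _)
      (fun b w hw => by rw [(Submodule.mem_bot _).1 hw, map_zero]; exact Submodule.zero_mem _)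
      (v := ((enum g).map (X S)).prod (vacuum S h)) (fun j hj => by
        rw [Submodule.mem_bot, ← Module.End.mul_apply, X_skewComm.mul_list_eq_zero (hall j),
          LinearMap.zero_apply]
        refine mem_enum.2 (not_not.1 fun h => ?_)
        obtain ⟨a, ha⟩ := (hfg j).2 h
        exact hj a ha)
    rw [Submodule.mem_bot, sub_eq_zero, ← list_X_lm, lm_vacuum] at h2
    rw [List.map_append, List.prod_append, Module.End.mul_apply, Module.End.mul_apply, ← h2,
      unsubst_list_phi hQ hQP, ← list_X_lm, unsubst_list_X hQ]
    refine h1.symm.trans (congrArg _ ?_)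
    have h3 := LinearMap.congr_fun (LinearMap.congr_fun hZprod (vacuum S)) h
    rw [← lmHom_apply]
    refine h3.trans ?_
    rw [← Module.End.mul_apply (lmHom S B z)]
    congr 2
    have h4 : ∀ l : List ι, (l.map (xi S Q)).prod * lmHom S B z =
        lmHom S B z * (l.map (xi S Q)).prod := by
      intro l
      induction l with
      | nil => simp
      | cons a l ih =>
        rw [List.map_cons, List.prod_cons, mul_assoc, ih, ← mul_assoc, ← xi_lmHom, mul_assoc]
    exact h4 _
  obtain ⟨s, hs, hsing⟩ := list_X_vacuum (S := S) (B := B)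
    ((enum_append_perm hf hg hfg).nodup_iff.2 (enum_nodup Function.injective_id))
  rw [List.toFinset_eq_of_perm _ _ (enum_append_perm hf hg hfg), enum_id_toFinset] at hsing
  have h1 := htop 1
  have h2 := subst_single_top hall hc hP (↑D⁻¹ * (cdet cf (P.submatrix f f) * 1))
  rw [← hDu, Units.mul_inv_cancel_left] at h2
  rw [hsing, hsing, map_smul, map_smul, ← h2, unsubst_subst hP hQ hQP, lm_single] at h1
  have h3 := Finsupp.single_injective _ (smul_right_injective _ hs h1)
  rw [mul_one, ← mul_assoc] at h3
  -- Top coefficients give 1 = z D⁻¹ times the minor of P. The minor also has the right inverse e,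
  -- so e = z D⁻¹, and the factors may be put in the order of the claim.
  have h4 := left_inv_eq_right_inv h3.symm he
  rw [← h4, ← mul_assoc, Units.mul_inv_eq_one] at he
  rw [he, hDu]

theorem SkewComm.list_mul {T : Type*} [Semiring T] [Algebra 𝕜 T] {y : ι → T}
    (hy : SkewComm S y) (j : ι) (l : List ι) :
    (l.map y).prod * y j = (l.map fun i => S.ε i j).prod • (y j * (l.map y).prod) := by
  induction l with
  | nil => simp
  | cons a l ih =>
    simp only [List.map_cons, List.prod_cons]
    rw [mul_assoc, ih, mul_smul_comm, ← mul_assoc, hy a j, smul_mul_assoc, smul_smul, mul_assoc,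
      mul_comm (S.ε a j)]

theorem list_eq_tw {l : List ι} (hl : l.Nodup) (j : ι) :
    (l.map fun i => S.ε i j).prod = S.tw j (ind S l.toFinset) := by
  rw [Skew.tw, ← List.prod_toFinset _ hl, ← Finset.prod_subset (Finset.subset_univ l.toFinset)]
  · exact Finset.prod_congr rfl fun i hi => by rw [ind_apply, if_pos hi, pow_one]
  · intro i _ hi
    rw [ind_apply, if_neg hi, pow_zero]

theorem list_phi_vacuum_apply (P : Matrix ι ι B) (l : List ι) (h : B) (e : S.State) :
    (l.map (phi S P)).prod (vacuum S h) e = (l.map (phi S P)).prod (vacuum S 1) e * h := by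
  induction l generalizing e with
  | nil =>
    by_cases he : e = vac
    · subst he; simp [vacuum_apply]
    · simp [vacuum, Finsupp.single_eq_of_ne he]
  | cons a l ih =>
    simp only [List.map_cons, List.prod_cons, Module.End.mul_apply, phi_apply,
      Finsupp.finsetSum_apply, Finset.sum_mul, X_apply, lm_apply]
    refine Finset.sum_congr rfl fun i _ => ?_
    split_ifs
    · rw [zero_mul]
    · rw [ih, smul_mul_assoc, mul_assoc]

theorem list_phi_Xr (P : Matrix ι ι B) (l : List ι) (b : ι) (w : Fock S B) :
    (l.map (phi S P)).prod (Xr S b w) = Xr S b ((l.map (phi S P)).prod w) := by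
  induction l with
  | nil => rfl
  | cons a l ih => simp only [List.map_cons, List.prod_cons, Module.End.mul_apply, ih, Xr_phi]

theorem Xr_vacuum (b : ι) (h : B) : Xr S b (vacuum S h) = X S b (vacuum S h) := by
  rw [Xr_apply]
  congr 1
  rw [twist, vacuum, Finsupp.lsingle_apply, Finsupp.lsum_single]
  simp [Skew.tw]

/-- Comparison of the two ways to write the product of all transformed fermions with one more
transformed variable. -/
theorem exists_coefficients {P : Matrix ι ι B} (hP : PM S P) {k : α → ι}
    (hk : Function.Injective k) (hfer : ∀ i, S.fer i ↔ ∃ a, k a = i) {c : 𝕜}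
    (hc : ∀ a b, a < b → S.ε (k b) (k a) = c) {γ : ι → 𝕜}
    (hγ : γ = fun j => S.tw j (ind S (enum k).toFinset)) {i : ι} (hi : ¬ S.fer i) :
    ∃ W W' : α → B,
      (∀ j, ¬ S.fer j → γ i • (cdet c (P.submatrix k k) * P i j) + ∑ a, W a * P (k a) j =
        γ j • (P i j * cdet c (P.submatrix k k) + ∑ a, P (k a) j * W' a)) ∧
      ∀ j, S.fer j → γ i • (cdet c (P.submatrix k k) * P i j) + ∑ a, W a * P (k a) j = 0 ∧
        P i j * cdet c (P.submatrix k k) + ∑ a, P (k a) j * W' a = 0 := by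
  set y := cdet c (P.submatrix k k) with hy
  set w := ((enum k).map (phi S P)).prod (vacuum S 1) with hw
  set K : S.State := ind S (enum k).toFinset with hK
  have hiK : i ∉ (enum k).toFinset := by
    rw [List.mem_toFinset, mem_enum, ← hfer]; exact hi
  have hKi : S.fer i → K i = 0 := fun h => absurd h hi
  -- All identities are read off at the monomial containing `i` and each fermion once. Its
  -- coefficient involves only monomials obtained by removing `i` or one fermion.
  set T : S.State := up i K hKi with hT
  obtain ⟨s, hs, hsing⟩ := list_X_vacuum (S := S) (B := B) (enum_nodup hk)
  have hwK : w K = s • y := by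
    have h1 := list_phi_sub_mem (P := P) hk (fun a => (hfer _).2 ⟨a, rfl⟩) hc
      (V := involving S B (bosons S))
      (fun j w hw => X_mem_involving_of_mem j hw) (fun b w hw => lm_mem_involving b hw)
      (v := vacuum S 1) (fun j hj => X_mem_involving (mem_bosons.2 fun h => by
        obtain ⟨a, ha⟩ := (hfer j).1 h
        exact hj a ha) _)
    rw [lm_vacuum, mul_one, hsing] at h1
    have h2 := h1 K fun b hb => by
      rw [hK, ind_apply, if_neg]
      rw [List.mem_toFinset, mem_enum, ← hfer]
      exact mem_bosons.1 hb
    rw [Finsupp.sub_apply, sub_eq_zero] at h2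
    rw [hw, h2, Finsupp.smul_apply, Finsupp.single_eq_same]
  have hsum : ∀ F : ι → B, (∀ b, T b = 0 → F b = 0) → ∑ b, F b = F i + ∑ a, F (k a) := by
    intro F hF
    rw [← Finset.add_sum_erase _ _ (mem_univ i), add_right_inj,
      ← Finset.sum_subset (s₁ := univ.map ⟨k, hk⟩), Finset.sum_map]
    · rfl
    · intro b hb
      obtain ⟨a, rfl⟩ : ∃ a, k a = b := by simpa using hb
      exact Finset.mem_erase.2 ⟨fun h => hi (h ▸ (hfer _).2 ⟨a, rfl⟩), mem_univ _⟩
    · intro b hb hb'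
      refine hF b ?_
      rw [hT, up_of_ne (Finset.ne_of_mem_erase hb), hK, ind_apply, if_neg]
      rw [List.mem_toFinset, mem_enum]
      simpa using hb'
  have hcoef : ∀ (v : Fock S B) (b : ι), X S b v T =
      if T b = 0 then 0 else S.coef b (down b T) • v (down b T) := fun v b => X_apply S b v T
  have hTi : T i ≠ 0 := by rw [hT, up_self]; omega
  have hTk : ∀ a, T (k a) ≠ 0 := fun a => by
    have h1 : k a ≠ i := fun h => hi (h ▸ (hfer _).2 ⟨a, rfl⟩)
    rw [hT, up_of_ne h1, hK, ind_apply, if_pos]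
    · exact one_ne_zero
    · exact List.mem_toFinset.2 (mem_enum.2 ⟨a, rfl⟩)
  set r : 𝕜 := S.coef i K * s with hr
  have hr0 : r ≠ 0 := mul_ne_zero (S.coef_ne_zero _ _) hs
  -- The extra variable is taken out as a right multiplication, so the entries of P stand on the
  -- right of the coefficients of `w`; in `hright` they stand on the left. The factor `γ j` compares
  -- the two products.
  have hleft : ∀ j, ((enum k).map (phi S P)).prod (phi S P j (vacuum S 1)) T =
      r • (γ i • (y * P i j) + ∑ a, (r⁻¹ • S.coef (k a) (down (k a) T) •
        S.tw (k a) (down (k a) T) • w (down (k a) T)) * P (k a) j) := by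
    intro j
    rw [phi_apply, map_sum]
    simp only [lm_vacuum, mul_one, ← Xr_vacuum, list_phi_Xr]
    rw [Finsupp.finsetSum_apply, hsum]
    · simp only [Xr_apply, hcoef, twist_apply, list_phi_vacuum_apply P _ (P _ j), ← hw]
      rw [if_neg hTi, hT, down_up, hwK, smul_add, Finset.smul_sum]
      congr 1
      · simp only [smul_smul, smul_mul_assoc, hr, hγ]
        congr 1
        ring
      · refine Finset.sum_congr rfl fun a _ => ?_
        rw [← hT, if_neg (hTk a)]
        simp only [smul_mul_assoc]
        rw [smul_inv_smul₀ hr0]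
    · intro b hb
      rw [Xr_apply, hcoef, if_pos hb]
  have hright : ∀ j, phi S P j w T = r • (P i j * y + ∑ a, P (k a) j *
      (r⁻¹ • S.coef (k a) (down (k a) T) • w (down (k a) T))) := by
    intro j
    rw [phi_apply, Finsupp.finsetSum_apply, hsum]
    · simp only [hcoef, lm_apply]
      rw [if_neg hTi, hT, down_up, hwK, smul_add, Finset.smul_sum]
      congr 1
      · simp only [smul_smul, mul_smul_comm, hr]
      · refine Finset.sum_congr rfl fun a _ => ?_
        rw [← hT, if_neg (hTk a)]
        simp only [mul_smul_comm]
        rw [smul_inv_smul₀ hr0]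
    · intro b hb
      rw [hcoef, if_pos hb]
  refine ⟨fun a => r⁻¹ • S.coef (k a) (down (k a) T) • S.tw (k a) (down (k a) T) •
    w (down (k a) T), fun a => r⁻¹ • S.coef (k a) (down (k a) T) • w (down (k a) T),
    fun j hj => ?_, fun j hj => ?_⟩
  · refine smul_right_injective _ hr0 ?_
    change r • _ = r • _
    rw [← hleft, smul_comm, ← hright, ← Module.End.mul_apply, (phi_skewComm hP).list_mul,
      list_eq_tw (enum_nodup hk), hγ]
    rfl
  · have hjk : j ∈ enum k := mem_enum.2 ((hfer j).1 hj)
    constructor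
    · refine smul_right_injective _ hr0 ?_
      change r • _ = r • _
      rw [← hleft, smul_zero, ← Module.End.mul_apply, (phi_skewComm hP).list_mul_eq_zero hj hjk]
      rfl
    · refine smul_right_injective _ hr0 ?_
      change r • _ = r • _
      rw [← hright, smul_zero, hw, ← Module.End.mul_apply,
        (phi_skewComm hP).mul_list_eq_zero hj hjk]
      rfl

end Minors

/-! ### Manin matrices without super signs and the ratio of determinants -/

section Manin

open Finset Skew State SuperManin

variable {𝕜 ι : Type*} [Field 𝕜] [CharZero 𝕜] [Fintype ι] [LinearOrder ι]
variable {R : Type*} [Ring R] [Algebra 𝕜 R]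
variable {α β : Type*} [Fintype α] [LinearOrder α] [Fintype β] [LinearOrder β]

/-- The relations of a Manin matrix with commutation factors `u`. -/
def UManin (u : ι → ι → 𝕜) (M : Matrix ι ι R) : Prop := ∀ i j k l,
  M i j * M k l + u l j • (M i l * M k j) = u i k • (M k j * M i l + u l j • (M k l * M i j))

/-- The signs and `q`-factors of a family of indices, the even ones being those in `ev`. -/
structure Factors (u : ι → ι → 𝕜) (ev od : ι → Prop) : Prop where
  mul_swap : ∀ i j, u i j * u j i = 1
  diag_even : ∀ i, ev i → u i i = 1
  diag_odd : ∀ i, od i → u i i = -1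
  odd_iff : ∀ i, od i ↔ ¬ ev i

variable {u : ι → ι → 𝕜} {ev od : ι → Prop}

/-- The variables for which the even indices are fermionic. -/
def evenSkew (hu : Factors u ev od) : Skew 𝕜 ι where
  ε i j := -u j i
  fer := ev
  mul_swap i j := by rw [neg_mul_neg, hu.mul_swap]
  diag_fer i hi := by rw [hu.diag_even i hi]
  diag_bos i hi := by rw [hu.diag_odd i ((hu.odd_iff i).2 hi), neg_neg]

/-- The variables for which the odd indices are fermionic. -/
def oddSkew (hu : Factors u ev od) : Skew 𝕜 ι where
  ε i j := u j i
  fer := od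
  mul_swap i j := by rw [hu.mul_swap]
  diag_fer i hi := by rw [hu.diag_odd i hi]
  diag_bos i hi := by rw [hu.diag_even i (not_not.1 fun h => hi ((hu.odd_iff i).2 h))]

/-- The variables for which the odd indices are fermionic, in the opposite order. -/
def oddSkewOp (hu : Factors u ev od) : Skew 𝕜 ι where
  ε i j := u i j
  fer := od
  mul_swap i j := by rw [hu.mul_swap]
  diag_fer i hi := by rw [hu.diag_odd i hi]
  diag_bos i hi := by rw [hu.diag_even i (not_not.1 fun h => hi ((hu.odd_iff i).2 h))]

instance (hu : Factors u ev od) [h : DecidablePred ev] : DecidablePred (evenSkew hu).fer := h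

instance (hu : Factors u ev od) [h : DecidablePred od] : DecidablePred (oddSkewOp hu).fer := h

theorem pm_even (hu : Factors u ev od) {M : Matrix ι ι R} (hM : UManin u M) :
    PM (evenSkew hu) M := by
  intro i j k l
  simp only [evenSkew, neg_smul, sub_neg_eq_add, neg_neg]
  exact hM i j k l

theorem qm_even (hu : Factors u ev od) {N : Matrix ι ι R} (hN : UManin (fun i j => u j i) N) :
    QM (evenSkew hu) N := by
  intro j l a b
  simp only [evenSkew, neg_smul, sub_neg_eq_add, neg_neg]
  exact hN l b j a

theorem pm_odd (hu : Factors u ev od) {N : Matrix ι ι R} (hN : UManin (fun i j => u j i) N) :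
    PM (oddSkew hu) N.transpose := by
  intro i j k l
  simp only [oddSkew, Matrix.transpose_apply]
  have h := hN j i l k
  simp only [smul_add, smul_sub] at h ⊢
  rw [smul_comm (u l j)] at h
  rw [sub_eq_iff_eq_add, eq_sub_of_add_eq h]
  abel

/-- Over a noncommutative ring transposes of inverse matrices need not be inverse to each other, but
they are after passing to the opposite ring. There the regularity results apply to the transpose of
N. -/
theorem pm_odd_op (hu : Factors u ev od) {N : Matrix ι ι R} (hN : UManin (fun i j => u j i) N) :
    PM (oddSkewOp hu) (Matrix.of fun i j => MulOpposite.op (N j i)) := by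
  intro i j k l
  simp only [oddSkewOp, Matrix.of_apply, ← MulOpposite.op_mul, ← MulOpposite.op_smul,
    ← MulOpposite.op_sub, ← MulOpposite.op_neg]
  refine congrArg _ ?_
  have h := congrArg (fun x => (u j l * u k i) • x) (hN j i l k)
  simp only [smul_add, smul_smul] at h
  have h1 : u j l * u k i * u i k = u j l := by rw [mul_assoc, hu.mul_swap, mul_one]
  have h2 : u j l * u k i * u l j = u k i := by
    rw [mul_right_comm, hu.mul_swap, one_mul]
  have h3 : u j l * u k i * (u l j * u i k) = 1 := by
    rw [← mul_assoc, h2, hu.mul_swap]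
  rw [h1, h2, h3, one_smul] at h
  rw [smul_sub, smul_smul, mul_comm (u k i), sub_eq_iff_eq_add]
  rw [← sub_eq_iff_eq_add'] at h
  rw [← h]
  abel

theorem qm_odd_op (hu : Factors u ev od) {M : Matrix ι ι R} (hM : UManin u M) :
    QM (oddSkewOp hu) (Matrix.of fun i j => MulOpposite.op (M j i)) := by
  intro j l a b
  simp only [oddSkewOp, Matrix.of_apply, ← MulOpposite.op_mul, ← MulOpposite.op_smul,
    ← MulOpposite.op_sub, ← MulOpposite.op_neg]
  refine congrArg _ ?_
  have h := hM a j b l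
  simp only [smul_add, smul_sub] at h ⊢
  rw [smul_comm (u l j)]
  rw [sub_eq_iff_eq_add, eq_sub_of_add_eq h]
  abel

theorem op_mul_op_eq_one {M N : Matrix ι ι R} (h : N * M = 1) :
    (Matrix.of fun i j => MulOpposite.op (M j i)) * (Matrix.of fun i j => MulOpposite.op (N j i)) =
      1 := by
  ext i j
  rw [Matrix.mul_apply]
  simp only [Matrix.of_apply, ← MulOpposite.op_mul, ← Finset.op_sum, ← Matrix.mul_apply, h,
    Matrix.one_apply]
  by_cases hij : i = j
  · simp [hij]
  · simp [hij, Ne.symm hij]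

/-- Each term uses every row and every column once, so the diagonal scalars cancel, while the inner
factors y⁻¹ y telescope. -/
theorem cdet_smul_conj (c : 𝕜) (s : α → 𝕜) (hs : ∀ a, s a ≠ 0) (y : Rˣ) (a : Matrix α α R) :
    cdet c (Matrix.of fun i j => (s j * (s i)⁻¹) • (↑y * a i j * ↑y⁻¹)) =
      ↑y * cdet c a * ↑y⁻¹ := by
  have h : ∀ (l : List α) (t : α → 𝕜) (b : α → R),
      (l.map fun i => t i • (↑y * b i * ↑y⁻¹)).prod =
        (l.map t).prod • (↑y * (l.map b).prod * ↑y⁻¹) := by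
    intro l t b
    induction l with
    | nil => simp
    | cons i l ih =>
      simp only [List.map_cons, List.prod_cons, ih, smul_mul_smul_comm]
      congr 1
      simp only [mul_assoc, Units.inv_mul_cancel_left]
  rw [cdet, cdet, Finset.mul_sum, Finset.sum_mul]
  refine Finset.sum_congr rfl fun σ _ => ?_
  rw [mul_smul_comm, smul_mul_assoc]
  congr 1
  simp only [oprod, Matrix.of_apply]
  rw [h, ← List.prod_toFinset _ (Finset.sort_nodup _ _), Finset.sort_toFinset,
    Finset.prod_mul_distrib, Finset.prod_inv_distrib, Equiv.prod_comp σ s, mul_inv_cancel₀, one_smul]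
  exact Finset.prod_ne_zero_iff.2 fun i _ => hs i

section Ratio

variable [DecidablePred ev] [DecidablePred od] (hu : Factors u ev od) {M N : Matrix ι ι R} (hM : UManin u M)
  (hN : UManin (fun i j => u j i) N) (hMN : M * N = 1) (hNM : N * M = 1)

include hu hM hN hMN hNM

theorem evenBlock_bijective : Function.Bijective (subst (evenSkew hu) M) :=
  subst_bijective (pm_even hu hM) (qm_even hu hN) hMN hNM

/-- Over the opposite ring, regularity makes the fermionic block and its determinant invertible, and
`isUnit_transpose` then treats the block with rows and columns exchanged. Both facts are brought
back to R. -/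
theorem oddBlock_isUnit {c : 𝕜} (hc : ∀ a b : {i // od i}, a < b → u a b = c) :
    IsUnit (cdet c (N.transpose.submatrix Subtype.val Subtype.val :
      Matrix {i // od i} {i // od i} R)) ∧
    ∃ Z, (N.transpose.submatrix Subtype.val Subtype.val :
      Matrix {i // od i} {i // od i} R) * Z = 1 := by
  have hc' : ∀ a b : {i // od i}, a < b → u b a = c⁻¹ := fun a b hab => by
    rw [← hc a b hab]; exact eq_inv_of_mul_eq_one_left (hu.mul_swap _ _)
  have hP := pm_odd_op hu hN
  have hbij := subst_bijective hP (qm_odd_op hu hM) (op_mul_op_eq_one hMN) (op_mul_op_eq_one hNM)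
  have hD : ∀ b, cdet c⁻¹ ((Matrix.of fun i j => MulOpposite.op (N j i)).submatrix
      (Subtype.val : {i // od i} → ι) Subtype.val) * b = 0 → b = 0 := fun b hb =>
    cdet_mul_eq_zero hP hbij Subtype.val_injective (fun i => by simp [oddSkewOp]) hc' hb
  obtain ⟨V, hV⟩ : IsUnit ((Matrix.of fun i j => MulOpposite.op (N j i)).submatrix
      Subtype.val Subtype.val : Matrix {i // od i} {i // od i} Rᵐᵒᵖ) := ferBlock_isUnit hP hbij
  have hP' := hP.restrict (Subtype.val : {i // od i} → ι)
  have hunit := isUnit_cdet (S := (oddSkewOp hu).restrict (Subtype.val : {i // od i} → ι))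
    (fun i => i.2) hc' hP' (Q := (↑V⁻¹ : Matrix {i // od i} {i // od i} Rᵐᵒᵖ))
    ((congrArg (· * _) hV.symm).trans V.mul_inv) hD
  have hbij' : Function.Bijective (subst ((oddSkewOp hu).restrict
      (Subtype.val : {i // od i} → ι)) _) :=
    ⟨subst_injective (fun i => i.2) hc' hP' hD, subst_surjective hP'
      (Q := (↑V⁻¹ : Matrix {i // od i} {i // od i} Rᵐᵒᵖ))
      ((congrArg (· * _) hV.symm).trans V.mul_inv)⟩
  obtain ⟨T, hT⟩ := isUnit_transpose (fun i => i.2) hc' hP' hunit hbij'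
  constructor
  · have h2 : IsUnit (MulOpposite.unop (cdet c⁻¹ ((Matrix.of fun i j =>
        MulOpposite.op (N j i)).submatrix (Subtype.val : {i // od i} → ι) Subtype.val))) :=
      hunit.unop
    rw [unop_cdet] at h2
    -- The opposite ring yields the determinant for the reversed order with weight c⁻¹; independence
    -- of the enumeration identifies it with the one for the given order.
    have h3 := cdet_submatrix_eq (pm_odd hu hN) (f := (Subtype.val : {i // od i} → ι))
      (g := fun i : {i // od i}ᵒᵈ => (OrderDual.ofDual i).1) Subtype.val_injective
      (Subtype.val_injective.comp OrderDual.ofDual.injective)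
      (fun i => ⟨fun ⟨a, h⟩ => ⟨OrderDual.toDual a, h⟩, fun ⟨b, h⟩ => ⟨OrderDual.ofDual b, h⟩⟩)
      (fun a => a.2) hc (d := c⁻¹) (fun a b hab => hc' _ _ hab)
    rw [h3]
    exact h2
  · refine ⟨Matrix.of fun a b => MulOpposite.unop ((↑T⁻¹ : Matrix _ _ Rᵐᵒᵖ) b a), ?_⟩
    ext a b
    have h1 := congrFun (congrFun (T.inv_mul) b) a
    rw [hT, Matrix.mul_apply] at h1
    have h2 := congrArg MulOpposite.unop h1
    rw [Finset.unop_sum] at h2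
    rw [Matrix.mul_apply]
    refine Eq.trans (Finset.sum_congr rfl fun i _ => ?_) (h2.trans ?_)
    · simp
    · rw [Matrix.one_apply, Matrix.one_apply]
      by_cases h : a = b
      · simp [h]
      · simp [h, Ne.symm h]

/-- The Jacobi ratio theorem for a Manin matrix and a set of even indices. -/
theorem cdet_ratio {c cK cI cJ : 𝕜} (hc : ∀ a b : {i // ev i}, a < b → -u a b = c)
    (hcK : ∀ a b : {i // od i}, a < b → u a b = cK)
    {f : α → {i // ev i}} {g : β → {i // ev i}}
    (hf : Function.Injective f) (hg : Function.Injective g)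
    (hfg : ∀ i, (∃ a, f a = i) ↔ ¬ ∃ b, g b = i)
    (hcI : ∀ a b, a < b → -u (f a) (f b) = cI) (hcJ : ∀ a b, a < b → -u (g a) (g b) = cJ)
    {Y : Matrix α α R} (hY : M.submatrix (fun a => (f a).1) (fun a => (f a).1) * Y = 1)
    {L : Matrix β β R} {L' : Matrix β {i // od i} R}
    (hL : ∀ l j, ∑ b, L l b * N (g j) (g b) + ∑ a, L' l a * N (g j) a = if l = j then 1 else 0)
    (hL' : ∀ l (j : {i // od i}), ∑ b, L l b * N j (g b) + ∑ a, L' l a * N j a = 0) :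
    cdet c (M.submatrix Subtype.val Subtype.val : Matrix {i // ev i} {i // ev i} R) *
        cdet cK (N.transpose.submatrix Subtype.val Subtype.val :
          Matrix {i // od i} {i // od i} R) =
      cdet cI (M.submatrix (fun a => (f a).1) (fun a => (f a).1)) *
        cdet cK (N.transpose.submatrix Subtype.val Subtype.val :
          Matrix {i // od i} {i // od i} R) * cdet cJ L.transpose := by
  obtain ⟨⟨y, hy⟩, X, hX⟩ := oddBlock_isUnit hu hM hN hMN hNM hcK
  have hbij := evenBlock_bijective hu hM hN hMN hNM
  have hP := pm_even hu hM
  obtain ⟨V, hV⟩ : IsUnit (M.submatrix Subtype.val Subtype.val :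
      Matrix {i // ev i} {i // ev i} R) := ferBlock_isUnit hP hbij
  set U : Matrix {i // ev i} {i // ev i} R := ↑V⁻¹ with hU
  have hMU : (M.submatrix Subtype.val Subtype.val : Matrix {i // ev i} {i // ev i} R) * U = 1 :=
    (congrArg (· * _) hV.symm).trans V.mul_inv
  have hUM : U * (M.submatrix Subtype.val Subtype.val : Matrix {i // ev i} {i // ev i} R) = 1 :=
    (congrArg (_ * ·) hV.symm).trans V.inv_mul
  obtain ⟨γ, hγ⟩ : ∃ γ : ι → 𝕜, γ = fun j => (oddSkew hu).tw j (ind (oddSkew hu)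
    (enum (Subtype.val : {i // od i} → ι)).toFinset) := ⟨_, rfl⟩
  have hγ0 : ∀ j, γ j ≠ 0 := fun j => by rw [hγ]; exact Skew.tw_ne_zero _ _ _
  have hcoef := fun i : {i // ev i} => exists_coefficients (pm_odd hu hN)
    Subtype.val_injective (fun i => by simp [oddSkew]) (k := (Subtype.val : {i // od i} → ι)) hcK hγ
    (i := i.1) fun h => (hu.odd_iff _).1 h i.2
  rw [← hy] at hcoef ⊢
  choose W W' hW hW0 using hcoef
  -- For fixed i, this column vanishes at odd j, and M times it is `y` times the i-th unit vector on
  -- even rows. Hence the even block of M determines it, and it is the i-th column of U times `y`.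
  have hr : ∀ i j : {i // ev i}, N j i * ↑y + ∑ a : {i // od i}, N j a * W' i a = U j i * ↑y := by
    intro i j
    have h1 : ∀ j' : {i // ev i}, ∑ j : {i // ev i}, M j' j *
        (N j i * ↑y + ∑ a : {i // od i}, N j a * W' i a) = if j' = i then ↑y else 0 := by
      intro j'
      have h2 : ∑ j, M j' j * (N j i * ↑y + ∑ a : {i // od i}, N j a * W' i a) =
          if j' = i then ↑y else 0 := by
        simp only [mul_add, Finset.mul_sum, Finset.sum_add_distrib, ← mul_assoc]
        rw [Finset.sum_comm]
        simp only [← Finset.sum_mul, ← Matrix.mul_apply, hMN, Matrix.one_apply]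
        rw [Finset.sum_eq_zero, add_zero]
        · simp only [Subtype.ext_iff]; split_ifs <;> simp
        · intro a _
          rw [if_neg, zero_mul]
          intro h
          exact (hu.odd_iff _).1 a.2 (h ▸ j'.2)
      rw [← h2, sum_eq_add_of_compl (f := (Subtype.val : {i // ev i} → ι))
        (g := (Subtype.val : {i // od i} → ι)) Subtype.val_injective Subtype.val_injective
        (fun i => by simp [hu.odd_iff])]
      rw [left_eq_add]
      refine Finset.sum_eq_zero fun a _ => ?_
      have := (hW0 i a.1 a.2).2
      simp only [Matrix.transpose_apply] at this
      rw [this, mul_zero]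
    have h3 : ∑ j', U j j' * (if j' = i then (y : R) else 0) = U j i * ↑y := by simp
    rw [← h3]
    simp only [← h1, Finset.mul_sum, ← mul_assoc]
    rw [Finset.sum_comm]
    have h4 : ∀ k : {i // ev i}, ∑ j', U j j' * M j' k = if j = k then 1 else 0 := fun k => by
      have := congrFun (congrFun hUM j) k
      rwa [Matrix.mul_apply, Matrix.one_apply] at this
    simp only [← Finset.sum_mul, h4]
    simp
  set nJJ : Matrix β β R := Matrix.of fun b j => N (g j) (g b) with hnJJ
  set nJK : Matrix β {i // od i} R := Matrix.of fun b a => N a (g b) with hnJK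
  set nKJ : Matrix {i // od i} β R := Matrix.of fun a j => N (g j) a with hnKJ
  set nKK : Matrix {i // od i} {i // od i} R := N.transpose.submatrix Subtype.val Subtype.val
  -- `A` eliminates the odd columns of the transposed block of N. By the comparison of left and
  -- right multiplication, what remains is the transposed block of U conjugated by `y`, up to
  -- diagonal scalars.
  set A : Matrix β {i // od i} R := Matrix.of fun b a => (γ (g b))⁻¹ • (↑y⁻¹ * W (g b) a) with hA
  have hA1 : nJK + A * nKK = 0 := by
    ext b j
    have h1 := (hW0 (g b) j.1 j.2).1
    have h2 := congrArg (fun x : R => (γ (g b))⁻¹ • (((y⁻¹ : Rˣ) : R) * x)) h1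
    simp only [mul_add, smul_add, mul_smul_comm, inv_smul_smul₀ (hγ0 _), Units.inv_mul_cancel_left,
      Finset.mul_sum, Finset.smul_sum, mul_zero, smul_zero] at h2
    rw [Matrix.add_apply, Matrix.mul_apply, Matrix.zero_apply, ← h2]
    simp [nJK, A, nKK, mul_assoc]
  have hA2 : ∀ b j, (nJJ + A * nKJ) b j = (γ (g j) * (γ (g b))⁻¹) • (↑y⁻¹ * U (g j) (g b) * ↑y) := by
    intro b j
    have h1 := hW (g b) (g j).1 fun h => (hu.odd_iff _).1 h (g j).2
    simp only [Matrix.transpose_apply] at h1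
    rw [hr] at h1
    have h2 := congrArg (fun x : R => (γ (g b))⁻¹ • (((y⁻¹ : Rˣ) : R) * x)) h1
    simp only [mul_add, smul_add, mul_smul_comm, inv_smul_smul₀ (hγ0 _), Units.inv_mul_cancel_left,
      Finset.mul_sum, Finset.smul_sum] at h2
    rw [mul_comm (γ _), mul_smul, mul_assoc, ← h2, Matrix.add_apply, Matrix.mul_apply]
    simp [nJJ, nKJ, A, mul_assoc]
  have hB1 : L * nJJ + L' * nKJ = 1 := by
    ext l j
    rw [Matrix.add_apply, Matrix.mul_apply, Matrix.mul_apply, Matrix.one_apply]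
    exact hL l j
  have hB2 : L * nJK + L' * nKK = 0 := by
    ext l j
    rw [Matrix.add_apply, Matrix.mul_apply, Matrix.mul_apply, Matrix.zero_apply]
    exact hL' l j
  -- Both `A` and `L'` are determined by the odd columns, because the odd block has a right inverse.
  have hLA : L * A = L' := by
    have h1 : A = -(nJK * X) := by
      have := congrArg (· * X) hA1
      simp only [Matrix.add_mul, Matrix.zero_mul, Matrix.mul_assoc, hX,
        Matrix.mul_one] at this
      exact eq_neg_of_add_eq_zero_right this
    have h2 := congrArg (· * X) hB2
    simp only [Matrix.add_mul, Matrix.zero_mul, Matrix.mul_assoc, hX, Matrix.mul_one] at h2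
    rw [h1, Matrix.mul_neg]
    exact neg_eq_of_add_eq_zero_right h2
  have hLV : L * (nJJ + A * nKJ) = 1 := by
    rw [Matrix.mul_add, ← Matrix.mul_assoc, hLA, hB1]
  set s : β → 𝕜 := fun b => γ (g b)
  -- Jacobi's theorem for the even block of M and its inverse U; the conjugated and rescaled `L` is
  -- the required left inverse of the transposed complementary block of U.
  have key := cdet_eq_minor_mul (S := (evenSkew hu).restrict Subtype.val)
    (hP.restrict (Subtype.val : {i // ev i} → ι)) (fun i => i.2) hMU hUM hf hg hfg hc hcI hcJ
    (fun b hb => cdet_mul_eq_zero hP hbij Subtype.val_injective (fun i => by simp [evenSkew]) hc hb)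
    hY (L := Matrix.of fun l b => (s l * (s b)⁻¹) • (↑y * L l b * ↑y⁻¹)) (fun l j => by
      have h1 := congrFun (congrFun hLV l) j
      rw [Matrix.mul_apply] at h1
      simp only [hA2] at h1
      have h2 := congrArg (fun x : R => (s l * (s j)⁻¹) • ((y : R) * x * ((y⁻¹ : Rˣ) : R))) h1
      simp only [Finset.mul_sum, Finset.sum_mul, Finset.smul_sum] at h2
      refine Eq.trans (Finset.sum_congr rfl fun b _ => ?_) (h2.trans ?_)
      · simp only [Matrix.of_apply, mul_smul_comm, smul_mul_assoc, smul_smul]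
        have h3 : s l * (s j)⁻¹ * (γ (g j) * (γ (g b))⁻¹) = s l * (s b)⁻¹ := by
          have := hγ0 (g j)
          simp only [s]; field_simp
        rw [h3]
        simp only [mul_assoc, Units.mul_inv, mul_one]
      · rw [Matrix.one_apply]
        split_ifs with h
        · rw [h, mul_inv_cancel₀ (hγ0 _), one_smul, mul_one, Units.mul_inv]
        · simp)
  have hconj := cdet_smul_conj cJ s (fun b => hγ0 _) y L.transpose
  have htr : (Matrix.of fun l b => (s l * (s b)⁻¹) • ((y : R) * L l b * ↑y⁻¹)).transpose =
      Matrix.of fun i j => (s j * (s i)⁻¹) • (↑y * L.transpose i j * ↑y⁻¹) := rfl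
  rw [htr, hconj] at key
  rw [key, Matrix.submatrix_submatrix]
  simp only [mul_assoc, Units.inv_mul, mul_one]
  rfl

end Ratio

end Manin

/-! ### Removal of the super signs by the parity automorphism -/

section ParityTwist

open Finset Skew State SuperManin

section Sign

theorem zmod_two_cases (a : ZMod 2) : a = 0 ∨ a = 1 := by revert a; decide

variable {R : Type*} [Ring R]

theorem sgn_zero : sgn R 0 = 1 := by simp [sgn]

theorem sgn_one : sgn R 1 = -1 := by simp [sgn, ZMod.val_one]

theorem sgn_add (a b : ZMod 2) : sgn R (a + b) = sgn R a * sgn R b := by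
  rcases zmod_two_cases a with rfl | rfl <;> rcases zmod_two_cases b with rfl | rfl
  · simp [sgn_zero]
  · simp [sgn_zero]
  · simp [sgn_zero]
  · rw [show (1 + 1 : ZMod 2) = 0 by decide, sgn_zero, sgn_one]; simp

theorem sgn_mul_self (a : ZMod 2) : sgn R a * sgn R a = 1 := by
  rw [← sgn_add, CharTwo.add_self_eq_zero, sgn_zero]

theorem sgn_mul_eq_smul {𝕜 : Type*} [Field 𝕜] [Algebra 𝕜 R] (a : ZMod 2) (x : R) :
    sgn R a * x = sgn 𝕜 a • x := by
  rcases zmod_two_cases a with rfl | rfl <;> simp [sgn_zero, sgn_one]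

end Sign

variable {𝕜 A : Type*} [Field 𝕜] [Ring A] [Algebra 𝕜 A]

section Parity

variable (𝒜 : ZMod 2 → Submodule 𝕜 A) [GradedAlgebra 𝒜]

/-- The parity automorphism as a linear map. -/
def parityMap : A →ₗ[𝕜] A := GradedAlgebra.proj 𝒜 0 - GradedAlgebra.proj 𝒜 1

theorem parityMap_of_mem {i : ZMod 2} {a : A} (ha : a ∈ 𝒜 i) :
    parityMap 𝒜 a = sgn 𝕜 i • a := by
  rw [parityMap, LinearMap.sub_apply, GradedAlgebra.proj_apply, GradedAlgebra.proj_apply]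
  rcases zmod_two_cases i with rfl | rfl
  · rw [DirectSum.decompose_of_mem_same 𝒜 ha, DirectSum.decompose_of_mem_ne 𝒜 ha (by decide),
      sgn_zero, one_smul, sub_zero]
  · rw [DirectSum.decompose_of_mem_same 𝒜 ha, DirectSum.decompose_of_mem_ne 𝒜 ha (by decide),
      sgn_one, zero_sub, neg_one_smul]

/-- The parity automorphism. -/
def parityHom : A →ₐ[𝕜] A :=
  AlgHom.ofLinearMap (parityMap 𝒜)
    (by rw [parityMap_of_mem 𝒜 SetLike.GradedOne.one_mem, sgn_zero, one_smul])
    (fun a b => by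
      induction a using DirectSum.Decomposition.inductionOn 𝒜 with
      | zero => simp
      | add x y hx hy => simp only [add_mul, map_add, hx, hy]
      | homogeneous a =>
        induction b using DirectSum.Decomposition.inductionOn 𝒜 with
        | zero => simp
        | add x y hx hy => simp only [mul_add, map_add, hx, hy]
        | homogeneous b =>
          rw [parityMap_of_mem 𝒜 (SetLike.mul_mem_graded a.2 b.2), parityMap_of_mem 𝒜 a.2,
            parityMap_of_mem 𝒜 b.2, sgn_add, smul_mul_smul_comm])

theorem parityHom_of_mem {i : ZMod 2} {a : A} (ha : a ∈ 𝒜 i) :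
    parityHom 𝒜 a = sgn 𝕜 i • a := parityMap_of_mem 𝒜 ha

theorem parityHom_parityHom (a : A) : parityHom 𝒜 (parityHom 𝒜 a) = a := by
  induction a using DirectSum.Decomposition.inductionOn 𝒜 with
  | zero => simp
  | add x y hx hy => simp only [map_add, hx, hy]
  | homogeneous a =>
    rw [parityHom_of_mem 𝒜 a.2, map_smul, parityHom_of_mem 𝒜 a.2, smul_smul, sgn_mul_self,
      one_smul]

end Parity

section Twist

/-- `x` is homogeneous of parity `i` for the parity automorphism `T`. -/
def HasParity (T : A →ₐ[𝕜] A) (i : ZMod 2) (x : A) : Prop := T x = sgn 𝕜 i • x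

variable {T : A →ₐ[𝕜] A}

variable (T) in
/-- A power of the parity automorphism. -/
def tp (a : ZMod 2) : Module.End 𝕜 A := T.toLinearMap ^ a.val

theorem tp_zero : tp T 0 = 1 := by simp [tp]

theorem tp_one : tp T 1 = T.toLinearMap := by simp [tp, ZMod.val_one]

theorem tp_mul_self (hT : ∀ a, T (T a) = a) (a : ZMod 2) : tp T a * tp T a = 1 := by
  rcases zmod_two_cases a with rfl | rfl
  · simp [tp_zero]
  · rw [tp_one]; exact LinearMap.ext hT

theorem tp_comm (a b : ZMod 2) : tp T a * tp T b = tp T b * tp T a := by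
  rw [tp, tp, ← pow_add, ← pow_add, add_comm]

local notation "ℓ" => Algebra.lmul 𝕜 A

theorem tp_mul_lmul {i : ZMod 2} {x : A} (hx : HasParity T i x) (a : ZMod 2) :
    tp T a * ℓ x = sgn 𝕜 (a * i) • (ℓ x * tp T a) := by
  rcases zmod_two_cases a with rfl | rfl
  · simp [tp_zero, sgn_zero]
  · rw [tp_one, one_mul]
    refine LinearMap.ext fun y => ?_
    have h : T (x * y) = sgn 𝕜 i • (x * T y) := by rw [map_mul, hx, smul_mul_assoc]
    simpa using h

theorem lmul_mul_tp {i : ZMod 2} {x : A} (hx : HasParity T i x) (a : ZMod 2) :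
    ℓ x * tp T a = sgn 𝕜 (a * i) • (tp T a * ℓ x) := by
  rw [tp_mul_lmul hx, smul_smul, sgn_mul_self, one_smul]

theorem lmul_injective : Function.Injective (ℓ : A → Module.End 𝕜 A) :=
  Algebra.lmul_injective

variable {ι : Type*} [LinearOrder ι]

/-- The commutation factors of a super Manin matrix. -/
def factor (q : 𝕜) (p : ι → ZMod 2) (i j : ι) : 𝕜 := qeps q i j * sgn 𝕜 (p i * p j)

theorem qeps_of_lt {q : 𝕜} {i j : ι} (h : i < j) : qeps q i j = q⁻¹ := by
  rw [qeps, if_neg h.not_gt, if_pos h]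

theorem qeps_of_gt {q : 𝕜} {i j : ι} (h : j < i) : qeps q i j = q := by
  rw [qeps, if_pos h]

theorem qeps_self {q : 𝕜} (i : ι) : qeps q i i = 1 := by simp [qeps]

theorem qeps_inv (q : 𝕜) (i j : ι) : qeps q⁻¹ i j = qeps q j i := by
  rcases lt_trichotomy i j with h | rfl | h
  · rw [qeps_of_lt h, qeps_of_gt h, inv_inv]
  · rw [qeps_self, qeps_self]
  · rw [qeps_of_gt h, qeps_of_lt h]

theorem qeps_mul {q : 𝕜} (hq : q ≠ 0) (i j : ι) : qeps q i j * qeps q j i = 1 := by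
  rcases lt_trichotomy i j with h | rfl | h
  · rw [qeps_of_lt h, qeps_of_gt h, inv_mul_cancel₀ hq]
  · rw [qeps_self, one_mul]
  · rw [qeps_of_gt h, qeps_of_lt h, mul_inv_cancel₀ hq]

theorem factors {q : 𝕜} (hq : q ≠ 0) (p : ι → ZMod 2) :
    Factors (factor q p) (fun i => p i = 0) (fun i => p i = 1) where
  mul_swap i j := by
    rw [factor, factor, mul_mul_mul_comm, qeps_mul hq, mul_comm (p j), sgn_mul_self, one_mul]
  diag_even i hi := by rw [factor, qeps_self, hi, mul_zero, sgn_zero, one_mul]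
  diag_odd i hi := by rw [factor, qeps_self, hi, mul_one, sgn_one, one_mul]
  odd_iff i := by rcases zmod_two_cases (p i) with h | h <;> simp [h]

theorem factor_inv (q : 𝕜) (p : ι → ZMod 2) (i j : ι) : factor q⁻¹ p i j = factor q p j i := by
  rw [factor, factor, qeps_inv, mul_comm (p i)]

variable (T) in
/-- The matrix with the parity operators put to the right. -/
def twistR (p : ι → ZMod 2) (M : Matrix ι ι A) : Matrix ι ι (Module.End 𝕜 A) :=
  Matrix.of fun i j => ℓ (M i j) * tp T (p j)

variable (T) in
/-- The matrix with the parity operators put to the left. -/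
def twistL (p : ι → ZMod 2) (M : Matrix ι ι A) : Matrix ι ι (Module.End 𝕜 A) :=
  Matrix.of fun i j => tp T (p i) * ℓ (M i j)

variable {p : ι → ZMod 2} {M N : Matrix ι ι A}

theorem twistR_mul (hM : ∀ i j, HasParity T (p i + p j) (M i j)) (i j k l : ι) :
    twistR T p M i j * twistR T p M k l =
      sgn 𝕜 (p j * (p k + p l)) • (ℓ (M i j * M k l) * (tp T (p j) * tp T (p l))) := by
  rw [twistR, Matrix.of_apply, Matrix.of_apply, mul_assoc, ← mul_assoc (tp T (p j)),
    tp_mul_lmul (hM k l), smul_mul_assoc, mul_smul_comm, map_mul]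
  simp only [mul_assoc]

theorem twistL_mul (hM : ∀ i j, HasParity T (p i + p j) (M i j)) (i j k l : ι) :
    twistL T p M i j * twistL T p M k l =
      sgn 𝕜 (p k * (p i + p j)) • ((tp T (p i) * tp T (p k)) * ℓ (M i j * M k l)) := by
  rw [twistL, Matrix.of_apply, Matrix.of_apply, mul_assoc, ← mul_assoc (ℓ (M i j)),
    lmul_mul_tp (hM i j), smul_mul_assoc, mul_smul_comm, map_mul]
  simp only [mul_assoc]

/-- Moving a parity operator past an entry produces the sign which splits the exponents of the super
relation into contributions of the row pair and of the column pair. The identities between exponents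
are finite checks over ℤ/2. -/
theorem uManin_twistR {𝒜 : ZMod 2 → Submodule 𝕜 A} {q : 𝕜} (h : IsSuperManin 𝒜 q p M)
    (hM : ∀ i j, HasParity T (p i + p j) (M i j)) :
    UManin (factor q p) (twistR T p M) := by
  intro i j k l
  simp only [twistR_mul hM, tp_comm (p l)]
  have h1 := congrArg (fun x => sgn 𝕜 (p j * (p k + p l)) • (ℓ x * (tp T (p j) * tp T (p l))))
    (h.cross i j k l)
  simp only [map_sub, map_smul, sub_mul, smul_mul_assoc, smul_sub, smul_smul] at h1
  have e1 : sgn 𝕜 (p j * (p k + p l)) * sgn 𝕜 ((p i + p j) * (p k + p l)) =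
      sgn 𝕜 (p i * p k) * sgn 𝕜 (p l * p j) * sgn 𝕜 (p l * (p i + p j)) := by
    simp only [← sgn_add]; congr 1
    generalize p i = a, p j = b, p k = c, p l = d; revert a b c d; decide
  have e2 : sgn 𝕜 (p j * (p k + p l)) * sgn 𝕜 (p i * p k + p j * p k + p i * p j) =
      sgn 𝕜 (p i * p k) * sgn 𝕜 (p j * (p i + p l)) := by
    simp only [← sgn_add]; congr 1
    generalize p i = a, p j = b, p k = c, p l = d; revert a b c d; decide
  have e3 : sgn 𝕜 (p j * (p k + p l)) * sgn 𝕜 (p j * p k + p j * p l + p k * p l) =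
      sgn 𝕜 (p l * p j) * sgn 𝕜 (p l * (p k + p j)) := by
    simp only [← sgn_add]; congr 1
    generalize p i = a, p j = b, p k = c, p l = d; revert a b c d; decide
  rw [mul_left_comm, mul_left_comm _ (qeps q i k), mul_left_comm _ (qeps q l j), e1, e2, e3] at h1
  simp only [factor, smul_add, smul_smul]
  linear_combination (norm := module) h1

theorem uManin_twistL {𝒜 : ZMod 2 → Submodule 𝕜 A} {q : 𝕜} (h : IsSuperManin 𝒜 q⁻¹ p N)
    (hN : ∀ i j, HasParity T (p i + p j) (N i j)) :
    UManin (fun i j => factor q p j i) (twistL T p N) := by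
  rw [show (fun i j => factor q p j i) = factor q⁻¹ p from
    funext fun i => funext fun j => (factor_inv q p i j).symm]
  intro i j k l
  rw [twistL_mul hN, twistL_mul hN, twistL_mul hN, twistL_mul hN, tp_comm (p k) (p i)]
  have h1 := congrArg (fun x => sgn 𝕜 (p k * (p i + p j)) • ((tp T (p i) * tp T (p k)) * ℓ x))
    (h.cross i j k l)
  simp only [map_sub, map_smul, mul_sub, mul_smul_comm, smul_sub, smul_smul] at h1
  have e1 : sgn 𝕜 (p k * (p i + p j)) * sgn 𝕜 ((p i + p j) * (p k + p l)) =
      sgn 𝕜 (p i * p k) * sgn 𝕜 (p l * p j) * sgn 𝕜 (p i * (p k + p l)) := by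
    simp only [← sgn_add]; congr 1
    generalize p i = a, p j = b, p k = c, p l = d; revert a b c d; decide
  have e2 : sgn 𝕜 (p k * (p i + p j)) * sgn 𝕜 (p i * p k + p j * p k + p i * p j) =
      sgn 𝕜 (p i * p k) * sgn 𝕜 (p i * (p k + p j)) := by
    simp only [← sgn_add]; congr 1
    generalize p i = a, p j = b, p k = c, p l = d; revert a b c d; decide
  have e3 : sgn 𝕜 (p k * (p i + p j)) * sgn 𝕜 (p j * p k + p j * p l + p k * p l) =
      sgn 𝕜 (p l * p j) * sgn 𝕜 (p k * (p i + p l)) := by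
    simp only [← sgn_add]; congr 1
    generalize p i = a, p j = b, p k = c, p l = d; revert a b c d; decide
  rw [mul_left_comm, mul_left_comm _ (qeps q⁻¹ i k), mul_left_comm _ (qeps q⁻¹ l j), e1, e2, e3]
    at h1
  simp only [factor, smul_add, smul_smul]
  linear_combination (norm := module) h1

/-- The parity operators stand to the right in one matrix and to the left in the other so that the
two adjacent ones cancel. -/
theorem twistR_mul_twistL [Fintype ι] (hT : ∀ a, T (T a) = a) (h : M * N = 1) :
    twistR T p M * twistL T p N = 1 := by
  ext1 i k
  rw [Matrix.mul_apply]
  have h1 : ∀ j, twistR T p M i j * twistL T p N j k = ℓ (M i j * N j k) := fun j => by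
    rw [twistR, twistL, Matrix.of_apply, Matrix.of_apply, mul_assoc, ← mul_assoc (tp T (p j)),
      tp_mul_self hT, one_mul, map_mul]
  simp only [h1, ← map_sum, ← Matrix.mul_apply, h, Matrix.one_apply]
  split_ifs
  · exact map_one ℓ
  · exact map_zero ℓ

theorem twistL_mul_twistR [Fintype ι] (hT : ∀ a, T (T a) = a) (h : N * M = 1) :
    twistL T p N * twistR T p M = 1 := by
  ext1 i k
  rw [Matrix.mul_apply]
  have h1 : ∀ j, twistL T p N i j * twistR T p M j k =
      tp T (p i) * ℓ (N i j * M j k) * tp T (p k) := fun j => by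
    rw [twistR, twistL, Matrix.of_apply, Matrix.of_apply, map_mul]
    simp only [mul_assoc]
  simp only [h1, ← Finset.sum_mul, ← Finset.mul_sum, ← map_sum, ← Matrix.mul_apply, h,
    Matrix.one_apply]
  split_ifs with hik
  · rw [hik, map_one, mul_one, tp_mul_self hT]
  · simp

/-- The entries of the inverse of a matrix with homogeneous entries are homogeneous. -/
theorem hasParity_inverse [Fintype ι] {X Y : Matrix ι ι A}
    (hX : ∀ i j, HasParity T (p i + p j) (X i j)) (hXY : X * Y = 1) (hYX : Y * X = 1) (i j : ι) :
    HasParity T (p i + p j) (Y i j) := by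
  -- Applying the parity automorphism to XY = 1 and correcting by the expected signs gives a second
  -- right inverse of X, which must be Y.
  set Z : Matrix ι ι A := Matrix.of fun i j => sgn 𝕜 (p i + p j) • T (Y i j) with hZ
  have h1 : X * Z = 1 := by
    ext i k
    have h2 := congrArg (fun x => sgn 𝕜 (p i + p k) • T x) (congrFun (congrFun hXY i) k)
    simp only [Matrix.mul_apply, map_sum, map_mul, Finset.smul_sum] at h2
    rw [Matrix.mul_apply]
    refine Eq.trans (Finset.sum_congr rfl fun j _ => ?_) (h2.trans ?_)
    · rw [hX i j, hZ, Matrix.of_apply, mul_smul_comm, smul_mul_assoc, smul_smul]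
      congr 1
      rw [← sgn_add]; congr 1
      generalize p i = a, p j = b, p k = c; revert a b c; decide
    · rw [Matrix.one_apply]
      split_ifs with hik
      · rw [hik, CharTwo.add_self_eq_zero, sgn_zero, one_smul, map_one]
      · rw [map_zero, smul_zero]
  have h3 : Y = Z := left_inv_eq_right_inv hYX h1
  have h4 := congrFun (congrFun h3 i) j
  rw [HasParity]
  conv_rhs => rw [h4, hZ, Matrix.of_apply, smul_smul, sgn_mul_self, one_smul]

end Twist

end ParityTwist

/-! ### Determinants of the twisted matrices -/

section TwistedDeterminants

open Finset Skew State SuperManin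

theorem cdet_of_isEmpty {𝕜 α R : Type*} [Field 𝕜] [Ring R] [Algebra 𝕜 R] [Fintype α]
    [LinearOrder α] [IsEmpty α] (c : 𝕜) (P : Matrix α α R) : cdet c P = 1 := by
  simp [cdet, oprod, invCount, Finset.univ_eq_empty]

variable {𝕜 A : Type*} [Field 𝕜] [Ring A] [Algebra 𝕜 A]

local notation "ℓ" => Algebra.lmul 𝕜 A

section Twist

variable {ι α : Type*} [LinearOrder ι] [Fintype α] [LinearOrder α]
variable {T : A →ₐ[𝕜] A} {p : ι → ZMod 2} {M N : Matrix ι ι A} {f : α → ι}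

theorem map_cdet_eq_self {P : Matrix α α A} (hP : ∀ i j, T (P i j) = P i j) (c : 𝕜) :
    T (cdet c P) = cdet c P := by
  rw [map_cdet]
  congr 1
  ext i j
  exact hP i j

theorem cdet_twistR (hf : ∀ a, p (f a) = 0) (c : 𝕜) :
    cdet c ((twistR T p M).submatrix f f) = ℓ (cdet c (M.submatrix f f)) := by
  rw [map_cdet]
  congr 1
  ext1 i j
  simp [twistR, hf, tp_zero]

/-- Odd-odd entries are fixed by T, so on vectors fixed by T the parity operators have no effect and
every partial product stays fixed. -/
theorem cdet_twistL_apply (hN : ∀ i j, HasParity T (p i + p j) (N i j)) (hf : ∀ a, p (f a) = 1)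
    (c : 𝕜) {x : A} (hx : T x = x) :
    cdet c ((twistL T p N).transpose.submatrix f f) x = cdet c (N.transpose.submatrix f f) * x := by
  have hfix : ∀ i j, T (N (f i) (f j)) = N (f i) (f j) := fun i j => by
    have := hN (f i) (f j)
    rwa [HasParity, hf, hf, CharTwo.add_self_eq_zero, sgn_zero, one_smul] at this
  have h : ∀ (l : List α) (b : α → A), (∀ i, T (b i) = b i) →
      (l.map fun i => T.toLinearMap * ℓ (b i)).prod x = (l.map b).prod * x ∧
        T ((l.map b).prod * x) = (l.map b).prod * x := by
    intro l b hb
    induction l with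
    | nil => simp [hx]
    | cons i l ih =>
      have h1 : T (b i * ((l.map b).prod * x)) = b i * ((l.map b).prod * x) := by
        rw [map_mul, hb, ih.2]
      simp only [List.map_cons, List.prod_cons, mul_assoc]
      refine ⟨?_, h1⟩
      rw [Module.End.mul_apply, Module.End.mul_apply, ih.1]
      exact h1
  rw [cdet, cdet, LinearMap.sum_apply, Finset.sum_mul]
  refine Finset.sum_congr rfl fun σ _ => ?_
  rw [LinearMap.smul_apply, smul_mul_assoc, oprod, oprod]
  congr 1
  refine Eq.trans ?_ (h _ _ fun i => hfix i (σ i)).1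
  simp [twistL, hf, tp_one]

/-- The sign from moving the parity operator past L and the sign of the supertranspose combine to
one independent of the summation index, given that the row `l` comes from an even index. The sum is
therefore an entry of LY = 1. -/
theorem sum_lmul_mul_twistL {κ : Type*} [Fintype κ] [DecidableEq κ] {e : κ → ι}
    {Y L : Matrix κ κ A}
    (hY : ∀ b j, Y b j =
      sgn A ((p (e b) + 1) * ((p (e b) + 1) + (p (e j) + 1))) * N (e j) (e b))
    (hLY : L * Y = 1) (hL : ∀ l b, HasParity T ((p (e l) + 1) + (p (e b) + 1)) (L l b))
    {l : κ} (hl : p (e l) = 0) (j : κ) :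
    ∑ b, ℓ (L l b) * twistL T p N (e j) (e b) = if l = j then 1 else 0 := by
  have h1 : ∀ b, ℓ (L l b) * twistL T p N (e j) (e b) =
      sgn 𝕜 (p (e j)) • (tp T (p (e j)) * ℓ (L l b * Y b j)) := fun b => by
    rw [twistL, Matrix.of_apply, ← mul_assoc, lmul_mul_tp (hL l b), hY, sgn_mul_eq_smul (𝕜 := 𝕜),
      mul_smul_comm, map_smul, mul_smul_comm, smul_smul, smul_mul_assoc, mul_assoc, map_mul,
      ← sgn_add]
    congr 2
    rw [hl]
    generalize p (e j) = x, p (e b) = y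
    revert x y; decide
  simp only [h1, ← Finset.smul_sum, ← Finset.mul_sum, ← map_sum, ← Matrix.mul_apply, hLY,
    Matrix.one_apply]
  split_ifs with h
  · rw [← h, hl, sgn_zero, tp_zero, one_smul, one_mul]
    exact map_one ℓ
  · simp

end Twist

section Factor

variable {ι : Type*} [LinearOrder ι] {q : 𝕜} {p : ι → ZMod 2}

theorem neg_factor_of_lt {i j : ι} (hi : p i = 0) (h : i < j) : -factor q p i j = (-q)⁻¹ := by
  rw [factor, qeps_of_lt h, hi, zero_mul, sgn_zero, mul_one, neg_inv]

theorem neg_factor_of_gt {i j : ι} (hi : p i = 0) (h : j < i) : -factor q p i j = (-q⁻¹)⁻¹ := by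
  rw [factor, qeps_of_gt h, hi, zero_mul, sgn_zero, mul_one, ← neg_inv, inv_inv]

theorem factor_of_lt {i j : ι} (hi : p i = 1) (hj : p j = 1) (h : i < j) :
    factor q p i j = (-q)⁻¹ := by
  rw [factor, qeps_of_lt h, hi, hj, mul_one, sgn_one, mul_neg_one, neg_inv]

theorem factor_of_gt {i j : ι} (hi : p i = 1) (hj : p j = 1) (h : j < i) :
    factor q p i j = (-q⁻¹)⁻¹ := by
  rw [factor, qeps_of_gt h, hi, hj, mul_one, sgn_one, mul_neg_one, ← neg_inv, inv_inv]

theorem Factors.comap {κ : Type*} {u : ι → ι → 𝕜} {ev od : ι → Prop} (hu : Factors u ev od)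
    (f : κ → ι) : Factors (fun i j => u (f i) (f j)) (fun i => ev (f i)) fun i => od (f i) where
  mul_swap _ _ := hu.mul_swap _ _
  diag_even _ := hu.diag_even _
  diag_odd _ := hu.diag_odd _
  odd_iff _ := hu.odd_iff _

/-- On the odd-odd block all entries are even, so the relations hold in A itself without parity
operators. -/
theorem uManin_odd {𝒜 : ZMod 2 → Submodule 𝕜 A} {N : Matrix ι ι A} (h : IsSuperManin 𝒜 q⁻¹ p N) :
    UManin (fun i j : {i // p i = 1} => factor q p j i)
      (N.submatrix Subtype.val Subtype.val) := by
  intro i j k l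
  have h1 := h.cross i j k l
  simp only [i.2, j.2, k.2, l.2, CharTwo.add_self_eq_zero, mul_one, zero_add, mul_zero, sgn_zero,
    sgn_one, mul_neg] at h1
  simp only [factor, i.2, j.2, k.2, l.2, mul_one, sgn_one, mul_neg, Matrix.submatrix_apply,
    ← qeps_inv q]
  linear_combination (norm := module) h1

end Factor

end TwistedDeterminants

/-! ### The two cases of the ratio theorem -/

section Berezinian

open Finset Skew State SuperManin

section Jacobi

variable {𝕜 A ι : Type*} [Field 𝕜] [CharZero 𝕜] [Ring A] [Algebra 𝕜 A] [Fintype ι] [LinearOrder ι]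
variable (𝒜 : ZMod 2 → Submodule 𝕜 A) [GradedAlgebra 𝒜] {q : 𝕜} (hq : q ≠ 0) {p : ι → ZMod 2}
variable {M : Matrix ι ι A} (hM : IsSuperManin 𝒜 q p M) (hMu : IsUnit M)
  (hN : IsSuperManin 𝒜 q⁻¹ p (Ring.inverse M))

/-- The signs of the supertranspose are trivial in rows of even parity. -/
theorem colDet_piSt {κ : Type*} [Fintype κ] [LinearOrder κ] (c : 𝕜) (p : κ → ZMod 2)
    (X : Matrix κ κ A) : colDet c (principal (fun i => piParity p i = 0) (piSt p X)) =
      cdet (-c)⁻¹ (X.transpose.submatrix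
        (fun i : {i // piParity p i = 0} => OrderDual.ofDual i.1)
        (fun i : {i // piParity p i = 0} => OrderDual.ofDual i.1)) := by
  have h : principal (fun i => piParity p i = 0) (piSt p X) = X.transpose.submatrix
      (fun i : {i // piParity p i = 0} => OrderDual.ofDual i.1)
      (fun i : {i // piParity p i = 0} => OrderDual.ofDual i.1) := by
    ext i j
    change sgn A (piParity p i.1 * _) * _ = _
    rw [i.2, zero_mul, sgn_zero, one_mul]
    rfl
  rw [h]
  rfl

include hq hM hMu hN

/-- The Jacobi ratio theorem for a set of even indices. -/
theorem ber_eq_of_subset_even {I : Finset ι} (hI : ∀ i ∈ I, p i = 0)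
    (hMI : IsUnit (principal (fun i => i ∈ I) M))
    (hX : IsUnit (piSt (fun i : {i // i ∈ Iᶜ} => p i)
      (principal (fun i => i ∈ Iᶜ) (Ring.inverse M)))) :
    ber q p M =
      ber q (fun i : {i // i ∈ I} => p i) (principal (fun i => i ∈ I) M) *
        ber q⁻¹ (piParity (fun i : {i // i ∈ Iᶜ} => p i))
          (piSt (fun i : {i // i ∈ Iᶜ} => p i)
            (principal (fun i => i ∈ Iᶜ) (Ring.inverse M))) := by
  set N := Ring.inverse M with hNdef
  have hMN : M * N = 1 := Ring.mul_inverse_cancel _ hMu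
  have hNM : N * M = 1 := Ring.inverse_mul_cancel _ hMu
  set T : A →ₐ[𝕜] A := parityHom 𝒜
  have hT : ∀ a, T (T a) = a := parityHom_parityHom 𝒜
  have pM : ∀ i j, HasParity T (p i + p j) (M i j) := fun i j =>
    parityHom_of_mem 𝒜 (hM.homogeneous i j)
  have pN : ∀ i j, HasParity T (p i + p j) (N i j) := fun i j =>
    parityHom_of_mem 𝒜 (hN.homogeneous i j)
  set Y := piSt (fun i : {i // i ∈ Iᶜ} => p i) (principal (fun i => i ∈ Iᶜ) N) with hY
  set L := Ring.inverse Y with hLdef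
  have hLY : L * Y = 1 := Ring.inverse_mul_cancel _ hX
  have hYL : Y * L = 1 := Ring.mul_inverse_cancel _ hX
  have hI' : ∀ i, p i = 1 → i ∈ Iᶜ := fun i hi => by
    rw [Finset.mem_compl]
    intro h
    rw [hI i h] at hi
    exact absurd hi (by decide)
  set e : {i // i ∈ Iᶜ}ᵒᵈ → ι := fun i => (OrderDual.ofDual i).1 with he
  have hYe : ∀ b j, Y b j =
      sgn A ((p (e b) + 1) * ((p (e b) + 1) + (p (e j) + 1))) * N (e j) (e b) := fun b j => rfl
  have pY : ∀ b j, HasParity T ((p (e b) + 1) + (p (e j) + 1)) (Y b j) := fun b j => by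
    rw [hYe, sgn_mul_eq_smul (𝕜 := 𝕜), HasParity, map_smul, pN, smul_comm]
    congr 2
    generalize p (e j) = x, p (e b) = y
    revert x y; decide
  have pL : ∀ l b, HasParity T ((p (e l) + 1) + (p (e b) + 1)) (L l b) :=
    hasParity_inverse (p := fun i => p (e i) + 1) pY hYL hLY
  have hfac := factors hq p
  set f : {i : {i // i ∈ I} // p i = 0} → {i // p i = 0} := fun a => ⟨a.1.1, a.2⟩ with hf
  set g : {i : {i // i ∈ Iᶜ}ᵒᵈ // piParity (fun i : {i // i ∈ Iᶜ} => p i) i = 1} →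
    {i // p i = 0} := fun b => ⟨e b.1, by simpa [piParity] using b.2⟩ with hg
  have hginj : Function.Injective g := fun a b h => by
    simpa [g, e, Subtype.ext_iff] using h
  set g' : {i // p i = 1} → {i // i ∈ Iᶜ}ᵒᵈ := fun a => OrderDual.toDual ⟨a.1, hI' _ a.2⟩ with hg'
  -- The relation LY = 1 with its sum over the complement of I split into even and odd indices;
  -- these are the two conditions on `L` and `L'` in `cdet_ratio`.
  have hsum := fun (l : {i : {i // i ∈ Iᶜ}ᵒᵈ // piParity (fun i : {i // i ∈ Iᶜ} => p i) i = 1})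
      (j : {i // i ∈ Iᶜ}ᵒᵈ) => (sum_eq_add_of_compl
        (f := (Subtype.val : {i : {i // i ∈ Iᶜ}ᵒᵈ //
          piParity (fun i : {i // i ∈ Iᶜ} => p i) i = 1} → _)) (g := g')
        Subtype.val_injective (fun a b h => by simpa [g', Subtype.ext_iff] using h) (fun i => by
          rcases zmod_two_cases (p (e i)) with h | h
          · exact ⟨fun _ ⟨b, hb⟩ => absurd ((hb ▸ b.2 : p (e i) = 1).symm.trans h) (by decide),
              fun _ => ⟨⟨i, by simpa [piParity] using h⟩, rfl⟩⟩
          · refine ⟨fun ⟨a, ha⟩ => absurd ((ha ▸ (g a).2 : p (e i) = 0).symm.trans h) (by decide),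
              fun hn => absurd ⟨⟨e i, h⟩, rfl⟩ hn⟩) _).symm.trans (sum_lmul_mul_twistL hYe hLY pL (l := l.1) (g l).2 j)
  have hne : ∀ (l : {i : {i // i ∈ Iᶜ}ᵒᵈ // piParity (fun i : {i // i ∈ Iᶜ} => p i) i = 1})
      (j : {i // p i = 1}), l.1 ≠ g' j := fun l j h => by
    have h1 : p (e (g' j)) = 1 := j.2
    rw [← h] at h1
    exact absurd ((g l).2.symm.trans h1) (by decide)
  have hYI : (twistR T p M).submatrix (fun a => (f a).1) (fun a => (f a).1) *
      (principal (fun i : {i // i ∈ I} => p i = 0)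
        (Ring.inverse (principal (fun i => i ∈ I) M))).map (Algebra.lmul 𝕜 A) = 1 := by
    have h1 : (twistR T p M).submatrix (fun a => (f a).1) (fun a => (f a).1) =
        (principal (fun i : {i // i ∈ I} => p i = 0)
          (principal (fun i => i ∈ I) M)).map (Algebra.lmul 𝕜 A) := by
      ext1 a b
      simp [twistR, f, b.2, tp_zero, principal]
    have h2 : principal (fun i : {i // i ∈ I} => p i = 0) (principal (fun i => i ∈ I) M) *
        principal (fun i : {i // i ∈ I} => p i = 0)
          (Ring.inverse (principal (fun i => i ∈ I) M)) = 1 := by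
      have h3 := Matrix.submatrix_mul_equiv (principal (fun i => i ∈ I) M)
        (Ring.inverse (principal (fun i => i ∈ I) M)) (Subtype.val : {i : {i // i ∈ I} // p i = 0} → _)
        (Equiv.subtypeUnivEquiv fun i : {i // i ∈ I} => hI i.1 i.2)
        (Subtype.val : {i : {i // i ∈ I} // p i = 0} → _)
      rw [Ring.mul_inverse_cancel _ hMI, Matrix.submatrix_one _ Subtype.val_injective] at h3
      exact h3
    rw [h1, ← Matrix.map_mul, h2, Matrix.map_one _ (map_zero _) (map_one _)]
  have key := cdet_ratio hfac (uManin_twistR hM pM) (uManin_twistL hN pN)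
    (twistR_mul_twistL hT hMN) (twistL_mul_twistR hT hNM)
    (c := (-q)⁻¹) (cK := (-q)⁻¹) (cI := (-q)⁻¹) (cJ := (-q⁻¹)⁻¹)
    (fun a b hab => neg_factor_of_lt a.2 hab) (fun a b hab => factor_of_lt a.2 b.2 hab)
    (f := f) (g := g) (fun a b h => Subtype.ext (Subtype.ext (congrArg (fun x => x.1) h))) hginj
    (fun i => by
      by_cases h : i.1 ∈ I
      · exact ⟨fun _ ⟨b, hb⟩ => Finset.mem_compl.1 (OrderDual.ofDual b.1).2
          (by rw [← hb] at h; exact h), fun _ => ⟨⟨⟨i.1, h⟩, i.2⟩, rfl⟩⟩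
      · exact ⟨fun ⟨a, ha⟩ => absurd ((congrArg (fun x => x.1) ha : a.1.1 = i.1) ▸ a.1.2) h,
          fun hn => absurd ⟨⟨OrderDual.toDual ⟨i.1, Finset.mem_compl.2 h⟩, by
            simp [piParity, i.2]⟩, rfl⟩ hn⟩) (fun a b hab => neg_factor_of_lt (f a).2 hab)
    (fun a b hab => neg_factor_of_gt (g a).2 hab)
    (Y := (principal (fun i : {i // i ∈ I} => p i = 0)
      (Ring.inverse (principal (fun i => i ∈ I) M))).map (Algebra.lmul 𝕜 A)) hYI
    (L := Matrix.of fun l b => Algebra.lmul 𝕜 A (L l.1 b.1))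
    (L' := Matrix.of fun l a => Algebra.lmul 𝕜 A (L l.1 (g' a)))
    (fun l j => (hsum l j.1).trans (by simp only [Subtype.ext_iff]))
    (fun l j => (hsum l (g' j)).trans (if_neg (hne l j)))
  rw [cdet_twistR (f := Subtype.val) fun a => a.2,
    cdet_twistR (f := fun a => (f a).1) fun a => (f a).2] at key
  -- The identity between operators on A is evaluated at 1. The odd determinant may be read without
  -- parity operators because it acts on 1 or on the determinant of a block of L, both fixed by
  -- parity.
  have key1 := LinearMap.congr_fun key 1
  have hz : cdet (-q⁻¹)⁻¹ (Matrix.of fun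
      (l b : {i : {i // i ∈ Iᶜ}ᵒᵈ // piParity (fun i : {i // i ∈ Iᶜ} => p i) i = 1}) =>
      Algebra.lmul 𝕜 A (L l.1 b.1)).transpose =
      Algebra.lmul 𝕜 A (rowDet q⁻¹ (principal (fun i =>
        piParity (fun i : {i // i ∈ Iᶜ} => p i) i = 1) L)) :=
    (map_cdet (Algebra.lmul 𝕜 A) _ _).symm
  have hz' : T (rowDet q⁻¹ (principal (fun i =>
        piParity (fun i : {i // i ∈ Iᶜ} => p i) i = 1) L)) = rowDet q⁻¹ (principal (fun i =>
        piParity (fun i : {i // i ∈ Iᶜ} => p i) i = 1) L) := by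
    refine map_cdet_eq_self (P := (principal (fun i =>
      piParity (fun i : {i // i ∈ Iᶜ} => p i) i = 1) L).transpose) (fun i j => ?_) _
    have h1 := pL j.1 i.1
    rw [(g i).2, (g j).2] at h1
    rw [CharTwo.add_self_eq_zero, HasParity, sgn_zero, one_smul] at h1
    exact h1
  rw [hz, Module.End.mul_apply, Module.End.mul_apply, Module.End.mul_apply,
    cdet_twistL_apply pN (fun a => a.2) _ (map_one T), Algebra.coe_lmul_eq_mul,
    LinearMap.mul_apply', LinearMap.mul_apply', LinearMap.mul_apply', mul_one, mul_one,
    cdet_twistL_apply pN (fun a => a.2) _ hz'] at key1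
  -- The Π-transpose reverses the order of the odd indices, and the passage from q to q⁻¹
  -- compensates for this.
  have hodd : colDet q⁻¹ (principal (fun i =>
      piParity (fun i : {i // i ∈ Iᶜ} => p i) i = 0) Y) =
      cdet (-q)⁻¹ (N.transpose.submatrix Subtype.val Subtype.val :
        Matrix {i // p i = 1} {i // p i = 1} A) := by
    rw [colDet_piSt]
    refine (cdet_submatrix_eq (pm_odd (hfac.comap (Subtype.val : {i // p i = 1} → ι))
      (uManin_odd hN)) (f := id)
      (g := fun i : {i : {i // i ∈ Iᶜ}ᵒᵈ // piParity (fun i : {i // i ∈ Iᶜ} => p i) i = 0} =>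
        ⟨e i.1, (CharTwo.add_eq_zero.1 i.2)⟩)
      Function.injective_id (fun a b h => by simpa [e, Subtype.ext_iff] using h)
      (fun i => iff_of_true ⟨i, rfl⟩ ⟨⟨g' i, by simp [piParity, g', i.2, CharTwo.add_self_eq_zero]⟩, rfl⟩)
      (fun i => i.2) (fun a b hab => factor_of_lt a.2 b.2 hab)
      (fun a b hab => factor_of_gt (CharTwo.add_eq_zero.1 a.2) (CharTwo.add_eq_zero.1 b.2) hab)).symm
  have hone : ∀ X : Matrix {i : {i // i ∈ I} // p i = 1} {i : {i // i ∈ I} // p i = 1} A,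
      rowDet q X = 1 := fun X => by
    have : IsEmpty {i : {i // i ∈ I} // p i = 1} :=
      ⟨fun i => absurd ((hI _ i.1.2).symm.trans i.2) (by decide)⟩
    exact cdet_of_isEmpty _ X.transpose
  rw [ber, ber, ber, hodd, hone, mul_one, ← mul_assoc]
  rw [← mul_assoc] at key1
  exact key1

/-- The Jacobi ratio theorem for a set containing all even indices. -/
theorem ber_eq_of_even_subset {I : Finset ι} (hI : ∀ i, p i = 0 → i ∈ I)
    (hMI : IsUnit (principal (fun i => i ∈ I) M)) :
    ber q p M =
      ber q (fun i : {i // i ∈ I} => p i) (principal (fun i => i ∈ I) M) *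
        ber q⁻¹ (piParity (fun i : {i // i ∈ Iᶜ} => p i))
          (piSt (fun i : {i // i ∈ Iᶜ} => p i)
            (principal (fun i => i ∈ Iᶜ) (Ring.inverse M))) := by
  set N := Ring.inverse M with hNdef
  have hMN : M * N = 1 := Ring.mul_inverse_cancel _ hMu
  set Z := Ring.inverse (principal (fun i => i ∈ I) M) with hZ
  have hZM : Z * principal (fun i => i ∈ I) M = 1 := Ring.inverse_mul_cancel _ hMI
  set T : A →ₐ[𝕜] A := parityHom 𝒜
  have pM : ∀ i j, HasParity T (p i + p j) (M i j) := fun i j =>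
    parityHom_of_mem 𝒜 (hM.homogeneous i j)
  have hfac := factors hq p
  have hI' : ∀ i, i ∉ I → p i = 1 := fun i hi =>
    (zmod_two_cases (p i)).resolve_left fun h => hi (hI i h)
  set f : {i : {i // i ∈ I} // p i = 1} → {i // p i = 1} := fun a => ⟨a.1.1, a.2⟩ with hf
  set g : {i : {i // i ∈ Iᶜ}ᵒᵈ // piParity (fun i : {i // i ∈ Iᶜ} => p i) i = 0} →
    {i // p i = 1} := fun b => ⟨(OrderDual.ofDual b.1).1, CharTwo.add_eq_zero.1 b.2⟩ with hg
  have hginj : Function.Injective g := fun a b h => by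
    simpa [g, Subtype.ext_iff] using h
  have hgI : ∀ b, (g b).1 ∉ I := fun b => Finset.mem_compl.1 (OrderDual.ofDual b.1).2
  have hgsurj : ∀ i, i ∉ I → ∃ b, (g b).1 = i := fun i hi =>
    ⟨⟨OrderDual.toDual ⟨i, Finset.mem_compl.2 hi⟩, CharTwo.add_eq_zero.2 (hI' i hi)⟩, rfl⟩
  have hsum := sum_eq_add_of_compl (M := A) (f := (Subtype.val : {i // i ∈ I} → ι))
    (g := fun b => (g b).1) Subtype.val_injective (Subtype.val_injective.comp hginj) (fun i =>
      ⟨fun ⟨a, ha⟩ ⟨b, hb⟩ => hgI b (by rw [hb, ← ha]; exact a.2), fun hn =>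
        ⟨⟨i, by_contra fun hi => hn (hgsurj i hi)⟩, rfl⟩⟩)
  set M₂ := M.submatrix (Subtype.val : {i // i ∈ I} → ι) (fun b => (g b).1) with hM₂
  -- The rows of MN = 1 with index in I, multiplied by the inverse Z of M_I. Columns outside I give
  -- the coefficients for block elimination; odd columns inside I identify the Schur complement with
  -- the odd block of Z.
  have hC : ∀ (i : {i // i ∈ I}) (j : ι), N i j + ∑ k, (Z * M₂) i k * N (g k) j =
      ∑ a, Z i a * (1 : Matrix ι ι A) a.1 j := fun i j => by
    have h1 : ∀ a : {i // i ∈ I}, (1 : Matrix ι ι A) a.1 j = ∑ b : {i // i ∈ I}, M a b * N b j +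
        ∑ k, M₂ a k * N (g k) j := fun a => by
      rw [← hMN, Matrix.mul_apply, hsum]
      rfl
    have h2 : ∑ a, Z i a * ∑ b : {i // i ∈ I}, M a b * N b j = N i j := by
      simp only [Finset.mul_sum, ← mul_assoc]
      rw [Finset.sum_comm]
      simp only [← Finset.sum_mul]
      have h3 : ∀ b : {i // i ∈ I}, ∑ a, Z i a * M a b = if i = b then 1 else 0 := fun b => by
        have := congrFun (congrFun hZM i) b
        rwa [Matrix.mul_apply, Matrix.one_apply] at this
      simp only [h3]
      simp
    simp only [h1, mul_add, Finset.sum_add_distrib]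
    rw [h2]
    simp only [Matrix.mul_apply, Finset.sum_mul, Finset.mul_sum, ← mul_assoc]
    rw [Finset.sum_comm]
  have key := cdet_eq_schur (pm_odd (hfac.comap (Subtype.val : {i // p i = 1} → ι))
      (uManin_odd hN)) (fun i => i.2) (f := f) (g := g)
    (fun a b h => Subtype.ext (Subtype.ext (congrArg (fun x => x.1) h))) hginj (fun i =>
      ⟨fun ⟨a, ha⟩ ⟨b, hb⟩ => hgI b (by rw [hb, ← ha]; exact a.1.2), fun hn =>
        ⟨⟨⟨i, by_contra fun hi => hn ((hgsurj i hi).imp fun b hb => Subtype.ext hb)⟩, i.2⟩, rfl⟩⟩)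
    (c := (-q)⁻¹) (cf := (-q)⁻¹) (cg := (-q⁻¹)⁻¹)
    (fun a b hab => factor_of_lt a.2 b.2 hab) (fun a b hab => factor_of_lt (f a).2 (f b).2 hab)
    (fun a b hab => factor_of_gt (g a).2 (g b).2 hab)
    (C := Matrix.of fun i k => -(Z * M₂) i.1 k) (fun i k => by
      have h1 := hC i.1 (g k)
      rw [Finset.sum_eq_zero (f := fun a : {i // i ∈ I} => Z i.1 a * (1 : Matrix ι ι A) a.1 (g k))
        fun a _ => by
          rw [Matrix.one_apply_ne, mul_zero]
          exact fun h => hgI k (h ▸ a.2)] at h1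
      simp only [Matrix.of_apply, neg_mul, Finset.sum_neg_distrib]
      exact eq_neg_of_add_eq_zero_left h1)
  have hschur : (Matrix.of fun (a i : {i : {i // i ∈ I} // p i = 1}) =>
      (N.submatrix Subtype.val Subtype.val).transpose (f a) (f i) -
      ∑ k, (Matrix.of fun (i : {i : {i // i ∈ I} // p i = 1}) k => -(Z * M₂) i.1 k) i k *
        (N.submatrix Subtype.val Subtype.val).transpose (f a) (g k)) =
      (principal (fun i : {i // i ∈ I} => p i = 1) Z).transpose := by
    ext a i
    have h1 := hC i.1 (f a)
    simp only [Matrix.of_apply, neg_mul, Finset.sum_neg_distrib, sub_neg_eq_add]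
    refine h1.trans ?_
    rw [Finset.sum_eq_single a.1]
    · rw [Matrix.one_apply_eq, mul_one]
      rfl
    · intro b _ hb
      rw [Matrix.one_apply_ne, mul_zero]
      exact fun h => hb (Subtype.ext h)
    · exact fun h => absurd (Finset.mem_univ _) h
  rw [hschur] at key
  -- The same even block indexed by two types. Independence of the enumeration is available for the
  -- twisted matrix, which on even columns is plain left multiplication.
  have heven : colDet q (principal (fun i => p i = 0) M) =
      colDet q (principal (fun i : {i // i ∈ I} => p i = 0) (principal (fun i => i ∈ I) M)) := by
    have h1 := cdet_submatrix_eq (pm_even hfac (uManin_twistR hM pM))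
      (f := (Subtype.val : {i // p i = 0} → ι))
      (g := fun i : {i : {i // i ∈ I} // p i = 0} => i.1.1)
      Subtype.val_injective (Subtype.val_injective.comp Subtype.val_injective)
      (fun i => ⟨fun ⟨a, ha⟩ => ⟨⟨⟨a.1, hI _ a.2⟩, a.2⟩, ha⟩, fun ⟨b, hb⟩ => ⟨⟨b.1.1, b.2⟩, hb⟩⟩)
      (fun i => i.2) (c := (-q)⁻¹) (d := (-q)⁻¹) (fun a b hab => neg_factor_of_lt a.2 hab)
      (fun a b hab => neg_factor_of_lt a.2 hab)
    rw [cdet_twistR (f := Subtype.val) fun a => a.2,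
      cdet_twistR (f := fun i : {i : {i // i ∈ I} // p i = 0} => i.1.1) fun a => a.2] at h1
    exact lmul_injective h1
  have hone : ∀ X : Matrix {i : {i // i ∈ Iᶜ}ᵒᵈ // piParity (fun i : {i // i ∈ Iᶜ} => p i) i = 1}
      {i : {i // i ∈ Iᶜ}ᵒᵈ // piParity (fun i : {i // i ∈ Iᶜ} => p i) i = 1} A,
      rowDet q⁻¹ X = 1 := fun X => by
    have : IsEmpty {i : {i // i ∈ Iᶜ}ᵒᵈ // piParity (fun i : {i // i ∈ Iᶜ} => p i) i = 1} :=
      ⟨fun i => Finset.mem_compl.1 (OrderDual.ofDual i.1).2 (hI _ (by simpa [piParity] using i.2))⟩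
    exact cdet_of_isEmpty _ X.transpose
  rw [ber, ber, ber, hone, mul_one, heven, colDet_piSt, mul_assoc]
  exact congrArg _ key

end Jacobi

end Berezinian

end SkewFock

end

theorem theorem4p4 {𝕜 A : Type*} [Field 𝕜] [CharZero 𝕜] [Ring A] [Algebra 𝕜 A]
    (𝒜 : ZMod 2 → Submodule 𝕜 A) [GradedAlgebra 𝒜] (q : 𝕜) (hq : q ≠ 0) (m n : ℕ)
    (M : Matrix (Fin (m + n)) (Fin (m + n)) A)
    (hM : SuperManin.IsSuperManin 𝒜 q (SuperManin.parity m n) M)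
    (hMu : IsUnit M)
    (hN : SuperManin.IsSuperManin 𝒜 q⁻¹ (SuperManin.parity m n) (Ring.inverse M))
    (I : Finset (Fin (m + n)))
    (hI : (∀ i ∈ I, (i : ℕ) < m) ∨ (∀ i : Fin (m + n), (i : ℕ) < m → i ∈ I))
    (hMI : IsUnit (SuperManin.principal (fun i => i ∈ I) M))
    (hX : IsUnit (SuperManin.piSt
      (fun i : {i // i ∈ Iᶜ} => SuperManin.parity m n i)
      (SuperManin.principal (fun i => i ∈ Iᶜ) (Ring.inverse M)))) :
    SuperManin.ber q (SuperManin.parity m n) M =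
      SuperManin.ber q (fun i : {i // i ∈ I} => SuperManin.parity m n i)
          (SuperManin.principal (fun i => i ∈ I) M) *
        SuperManin.ber q⁻¹
          (SuperManin.piParity (fun i : {i // i ∈ Iᶜ} => SuperManin.parity m n i))
          (SuperManin.piSt (fun i : {i // i ∈ Iᶜ} => SuperManin.parity m n i)
            (SuperManin.principal (fun i => i ∈ Iᶜ) (Ring.inverse M))) := by
  have hp0 : ∀ i : Fin (m + n), SuperManin.parity m n i = 0 ↔ (i : ℕ) < m := fun i => by
    rw [SuperManin.parity]; split_ifs with h <;> simp [h]
  rcases hI with hI | hI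
  · exact SkewFock.ber_eq_of_subset_even 𝒜 hq hM hMu hN (fun i hi => (hp0 i).2 (hI i hi)) hMI hX
  · exact SkewFock.ber_eq_of_even_subset 𝒜 hq hM hMu hN (fun i hi => hI i ((hp0 i).1 hi)) hMI
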